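/- **Setting.** Let $d\ge 2$ and write positions and velocities in $\mathbb R^d$ as $\mathbf x=(x,x_\perp)$, $\mathbf v=(v_x,v_\perp)$ with $x_\perp,v_\perp\in\mathbb R^{d-1}$; $\mathbf i$ is the unit vector in the $x$-direction. A cylinder of radius $r>0$ and length $\Lambda>0$, with axis parallel to the $x$-axis, moves along its axis with velocity $V(t)$ in a gas of particles that do not interact with each other. Its ends are two discs with cross section $D=\{|x_\perp|\le r\}$. The initial density of the gas is $f_0(\mathbf v)=a_0(v_x)b(v_\perp)$. *Reflection at the ends.* For $\alpha\in[0,1)$ and $K(\mathbf v,\mathbf u)=k(v_x,u_x)b(v_\perp)$, the densities $f_-,f_+$ before and after collision satisfy, for emitted velocities ($v_x\ge V(t)$ at the right end, $v_x\le V(t)$ at the left end), $$f_+(t,\mathbf x,\mathbf v)=\alpha f_-(t,\mathbf x,2V(t)-v_x,v_\perp)+(1-\alpha)\int K(\mathbf v-\mathbf iV(t),\mathbf u-\mathbf iV(t))f_-(t,\mathbf x,\mathbf u)\,d\mathbf u ,$$ the integral being over the incident velocities ($u_x\le V(t)$ at the right end, $u_x\ge V(t)$ at the left end). *Lateral side.*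 At a lateral point with outward normal $\mathbf n$ (where the incident density is always $f_0$), for $\mathbf v\cdot\mathbf n\ge0$, $f_+(\mathbf v)=\alpha_S f_0(\mathbf v-2(\mathbf v\cdot\mathbf n)\mathbf n)+(1-\alpha_S)\int_{\mathbf u\cdot\mathbf n\le0}K_S(\mathbf v-\mathbf i\omega;\mathbf u-\mathbf i\omega)f_0(\mathbf u)d\mathbf u$, where either $\omega=0$ throughout or $\omega=V(t)$ throughout, $\alpha_S\in[0,1]$, and $K_S\ge0$ (which may depend on $\mathbf n$) is measurable, even in $v_x$ and in $u_x$ separately, with $\int_{\mathbf v\cdot\mathbf n\ge0}(\mathbf v\cdot\mathbf n)K_S(\mathbf v;\mathbf u)d\mathbf v=|\mathbf u\cdot\mathbf n|$ for $\mathbf u\cdot\mathbf n<0$. The lateral force $F_S(V)$ is the integral over the lateral side of $\int_{\mathbf v\cdot\mathbf n\le0}(\mathbf v\cdot\mathbf n)(v_x-V)f_0\,d\mathbf v+\int_{\mathbf v\cdot\mathbf n\ge0}(\mathbf v\cdot\mathbf n)(v_x-V)f_+\,d\mathbf v$; all these integrals are assumed to converge absolutely for $V$ within $\gamma_0$ of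 $V_\infty$ ($\gamma_0,V_\infty$ as below). *Fictitious force.* Put $m(w)=\int_0^\infty v^2k(v,w)\,dv$, $\ell(w)=(1+\alpha)w^2+(1-\alpha)m(w)$ and $$F_0(V)=F_S(V)+|D|\Big(\int_{v_x\le V}\ell(v_x-V)f_0(\mathbf v)d\mathbf v-\int_{v_x\ge V}\ell(v_x-V)f_0(\mathbf v)d\mathbf v\Big).$$ Let $E>0$ be the constant force on the body, and let $V_\infty$ satisfy $F_0(V_\infty)=E$. *Assumptions.* For some $\gamma_0>0$: - $a_0,b,k\ge0$; $a_0$ is continuous and even; $b$ is continuous, $\int b=1$, $b(0)>0$; $f_0$ is bounded; $k$ is even in each variable and continuous on $\{u_x\ne0\}$; $\int_{v_x\ge0}v_xK(\mathbf v,\mathbf u)d\mathbf v=|u_x|$ for $u_x\neq 0$. - (A2) $k(v_x,u_x)$ is bounded on $\{|u_x|\le\gamma_0\}$. - (A3) There are $p\in[0,2]$ and positive constants $c_1,C_1$ with $c_1|w|^p\le m(w)\le C_1|w|^p$ for $w\in[-\gamma_0,0)$; $m$ is finite and $C^1$ on $\{w\ne0\}$. - (A4) $\int_{-\infty}^{V_\infty}k(v,u-\eta)a_0(u)\,du$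 is bounded uniformly for $v\in[-\gamma_0,0]$, $\eta\in[V_\infty-\gamma_0,V_\infty]$. - (A5) There is $\delta>0$ with $(1-\alpha)\int_{-\infty}^{V_\infty-\gamma_0}k(v,u-\eta)a_0(u)\,du\ge a_0(V_\infty)+\delta$ for the same $v,\eta$. - $\ell'(w)<0$ for $w<0$, and there is $g\in L^1(-\infty,0)$ with $(\ell(w)+|\ell'(w)|)(a_0(w+V)+a_0(w-V))\le g(w)$ for all $w<0$ and $|V-V_\infty|\le\gamma_0$. *Solutions.* Let $\gamma>0$, $V_0=V_\infty-\gamma$. A solution is a $C^1$ function $V$ with $V(0)=V_0$, together with nonnegative, bounded, measurable densities $f_\pm(t,\mathbf x,\mathbf v)$ for $t\ge0$, $\mathbf x$ on the two ends (with $f_-$ for incident and $f_+$ for emitted velocities), such that the reflection law holds at the ends and the following hold. - Transport. For $\mathbf x$ on an end at time $t$, with transversal coordinate $x_\perp$, and an incident velocity $\mathbf u$, a precollision is a time $s\in(0,t)$ with $(t-s)u_x=\int_s^tV$ and $|x_\perp-(t-s)u_\perp|\le r$ for which $\mathbf u$ is an emitted velocity of that end at time $s$. If there is a latest precollision $\tau$,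 then $f_-(t,\mathbf x,\mathbf u)=f_+(\tau,\mathbf x-(t-\tau)\mathbf u,\mathbf u)$ (on the same end); otherwise $f_-(t,\mathbf x,\mathbf u)=f_0(\mathbf u)$. - Motion. $\dot V(t)=E-F(t)$ for $t\ge0$, where $F(t)=F_R(t)-F_L(t)+F_S(V(t))$, and $F_R,F_L$ are the integrals over the right and left end of $\int(v_x-V(t))^2f_-\,d\mathbf v$ over incident velocities plus $\int(v_x-V(t))^2f_+\,d\mathbf v$ over emitted velocities. The integrals in the reflection law and in $F$ are required to converge absolutely. **Theorem.** There are $\gamma_1\in(0,\gamma_0]$ and constants $c,C>0$, independent of $\gamma$, such that for every $\gamma\in(0,\gamma_1)$ the following holds. The function $F_0$ is differentiable on $[V_0,V_\infty]$, and the extrema $$B_0=\min_{[V_0,V_\infty]}F_0',\qquad B_\infty=\max_{[V_0,V_\infty]}F_0'$$ exist, with $B_0>0$ and $B_\infty<\infty$. There is $t_0>0$, depending on $\gamma$ but not on the solution, such that every solution with $V(0)=V_0=V_\infty-\gamma$ satisfies, for all $t\ge0$, $$\gamma e^{-B_\infty t}+\frac{c\,\gamma^{p+1}}{t^{d+p}}\chi_{(2t_0,\infty)}(t)\le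 V_\infty-V(t)\le\gamma e^{-B_0t}+\frac{C\gamma^{p+1}}{(1+t)^{d+p}} .$$ In particular, $V_\infty-V(t)$ is of exact order $t^{-(d+p)}$ as $t\to\infty$: it lies between two positive multiples of $t^{-(d+p)}$ for all large $t$. -/

import Mathlib

open MeasureTheory Set Filter Asymptotics

noncomputable section

/-- The space `ℝ^(d-1)` of the directions orthogonal to the axis of the cylinder. -/
abbrev Perp (d : ℕ) : Type := EuclideanSpace ℝ (Fin (d - 1))

/-- Velocities `v = (v_x, v_⊥)` in `ℝ × ℝ^(d-1)`, with Lebesgue measure. -/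
abbrev Vel (d : ℕ) : Type := ℝ × Perp d

/-- The velocity `v - c i`, where `i` is the unit vector in the `x`-direction. -/
def boost {d : ℕ} (c : ℝ) (v : Vel d) : Vel d := (v.1 - c, v.2)

/-- The two circular ends of the cylinder. -/
inductive Face
  | right
  | left

/-- Velocities of the particles that hit an end of a body moving with velocity `V`. -/
def Face.incident {d : ℕ} : Face → ℝ → Set (Vel d)
  | .right, V => {v | v.1 ≤ V}
  | .left, V => {v | V ≤ v.1}

/-- Velocities of the particles that leave an end of a body moving with velocity `V`. -/
def Face.emitted {d : ℕ} : Face → ℝ → Set (Vel d)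
  | .right, V => {v | V ≤ v.1}
  | .left, V => {v | v.1 ≤ V}

/-- The body, its reflection laws and the initial particle density.  At the ends the diffusive
kernel is `K(v,u) = k(v_x,u_x) b(v_⊥)`; the initial density is `f₀(v) = a₀(v_x) b(v_⊥)`. -/
structure BodyGas (d : ℕ) where
  /-- radius of the cylinder -/
  r : ℝ
  /-- length of the cylinder -/
  len : ℝ
  /-- fraction of specular reflection at the ends -/
  α : ℝ
  k : ℝ → ℝ → ℝ
  a₀ : ℝ → ℝ
  b : Perp d → ℝ
  /-- fraction of specular reflection at the lateral side -/
  αS : ℝ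
  /-- the lateral kernel `K_S(v;u)` at a lateral point with outward unit normal `n` -/
  KS : Metric.sphere (0 : Perp d) 1 → Vel d → Vel d → ℝ
  /-- whether the lateral kernel is evaluated at velocities relative to the body -/
  comoving : Bool

namespace BodyGas

variable {d : ℕ} (P : BodyGas d)

/-- The initial density. -/
def f₀ (v : Vel d) : ℝ := P.a₀ v.1 * P.b v.2

/-- The collision kernel at the ends. -/
def K (v u : Vel d) : ℝ := P.k v.1 u.1 * P.b v.2

/-- The cross section of the cylinder (its ends, up to translation). -/
def disc : Set (Perp d) := Metric.closedBall 0 P.r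

/-- `∫_{v_x ≥ 0} v_x² k(v_x,w) dv_x`. -/
def moment (w : ℝ) : ℝ := ∫ v in Ici (0 : ℝ), v ^ 2 * P.k v w

/-- `ℓ(w) = (1+α) w² + (1-α) ∫_{v_x ≥ 0} v_x² k(v_x,w) dv_x`. -/
def ell (w : ℝ) : ℝ := (1 + P.α) * w ^ 2 + (1 - P.α) * P.moment w

/-- Velocity of the frame in which the lateral kernel acts, for a body of velocity `V`. -/
def latFrame (V : ℝ) : ℝ := if P.comoving then V else 0

/-- Density of the particles that leave the lateral side at a point with outward normal `n`.
A particle hitting the lateral side cannot have met the body before, because it moves on a straight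
line and the cylinder is convex and moves along its axis: the incident density is `f₀`. -/
def latEmitted (V : ℝ) (n : Metric.sphere (0 : Perp d) 1) (v : Vel d) : ℝ :=
  P.αS * P.f₀ (v.1, v.2 - (2 * inner ℝ v.2 (n : Perp d)) • (n : Perp d)) +
    (1 - P.αS) * ∫ u in {u : Vel d | inner ℝ u.2 (n : Perp d) ≤ 0},
      P.KS n (boost (P.latFrame V) v) (boost (P.latFrame V) u) * P.f₀ u

/-- The horizontal force on the lateral side of a body of velocity `V`.  The surface integral
over the lateral side is `len * r^(d-2)` times the integral over the unit normals `n`. -/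
def lateralForce (V : ℝ) : ℝ :=
  P.len * P.r ^ (d - 2) *
    ∫ n : Metric.sphere (0 : Perp d) 1,
      ((∫ v in {v : Vel d | inner ℝ v.2 (n : Perp d) ≤ 0},
          inner ℝ v.2 (n : Perp d) * (v.1 - V) * P.f₀ v) +
        ∫ v in {v : Vel d | 0 ≤ inner ℝ v.2 (n : Perp d)},
          inner ℝ v.2 (n : Perp d) * (v.1 - V) * P.latEmitted V n v)
      ∂((volume : Measure (Perp d)).toSphere)

/-- The fictitious force `F₀(V)`: the force if no particle met the body more than once. -/
def F₀ (V : ℝ) : ℝ :=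
  P.lateralForce V + volume.real P.disc *
    ((∫ v in {v : Vel d | v.1 ≤ V}, P.ell (v.1 - V) * P.f₀ v) -
      ∫ v in {v : Vel d | V ≤ v.1}, P.ell (v.1 - V) * P.f₀ v)

/-- Standing assumptions on the lateral reflection law, for body velocities near `Vinf`. -/
structure LateralLaw (Vinf γ₀ : ℝ) : Prop where
  αS_mem : P.αS ∈ Icc (0 : ℝ) 1
  measurable : Measurable
    (fun q : Metric.sphere (0 : Perp d) 1 × Vel d × Vel d => P.KS q.1 q.2.1 q.2.2)
  nonneg : ∀ n v u, 0 ≤ P.KS n v u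
  even_left : ∀ n v u, P.KS n (-v.1, v.2) u = P.KS n v u
  even_right : ∀ n v u, P.KS n v (-u.1, u.2) = P.KS n v u
  /-- conservation of mass at the lateral side -/
  mass : ∀ (n : Metric.sphere (0 : Perp d) 1) (u : Vel d), inner ℝ u.2 (n : Perp d) < 0 →
    ∫ v in {v : Vel d | 0 ≤ inner ℝ v.2 (n : Perp d)},
      inner ℝ v.2 (n : Perp d) * P.KS n v u = |inner ℝ u.2 (n : Perp d)|
  /-- the integrals that define the lateral force converge -/
  integrable_diffuse : ∀ V : ℝ, |V - Vinf| ≤ γ₀ →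
    ∀ (n : Metric.sphere (0 : Perp d) 1) (v : Vel d), 0 ≤ inner ℝ v.2 (n : Perp d) →
      IntegrableOn
        (fun u => P.KS n (boost (P.latFrame V) v) (boost (P.latFrame V) u) * P.f₀ u)
        {u : Vel d | inner ℝ u.2 (n : Perp d) ≤ 0}
  integrable_incident : ∀ V : ℝ, |V - Vinf| ≤ γ₀ →
    IntegrableOn
      (fun q : Metric.sphere (0 : Perp d) 1 × Vel d =>
        inner ℝ q.2.2 (q.1 : Perp d) * (q.2.1 - V) * P.f₀ q.2)
      {q | inner ℝ q.2.2 (q.1 : Perp d) ≤ 0}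
      ((volume : Measure (Perp d)).toSphere.prod volume)
  integrable_emitted : ∀ V : ℝ, |V - Vinf| ≤ γ₀ →
    IntegrableOn
      (fun q : Metric.sphere (0 : Perp d) 1 × Vel d =>
        inner ℝ q.2.2 (q.1 : Perp d) * (q.2.1 - V) * P.latEmitted V q.1 q.2)
      {q | 0 ≤ inner ℝ q.2.2 (q.1 : Perp d)}
      ((volume : Measure (Perp d)).toSphere.prod volume)

/-- Assumptions on the body, the kernel and the initial density.  `Vinf` is the equilibrium
velocity, `E` the constant force, and `γ₀` bounds the admissible differences `γ = Vinf - V₀`: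
the conditions below hold for every `γ ∈ (0, γ₀]` as soon as they hold for `γ₀`. -/
structure Assumptions (p E Vinf γ₀ : ℝ) : Prop where
  r_pos : 0 < P.r
  len_pos : 0 < P.len
  α_mem : P.α ∈ Ico (0 : ℝ) 1
  γ₀_pos : 0 < γ₀
  /- the equilibrium velocity -/
  E_pos : 0 < E
  equilibrium : P.F₀ Vinf = E
  lateral : P.LateralLaw Vinf γ₀
  /- product form, positivity, symmetry, continuity -/
  a₀_nonneg : ∀ v, 0 ≤ P.a₀ v
  a₀_even : ∀ v, P.a₀ (-v) = P.a₀ v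
  a₀_cont : Continuous P.a₀
  b_nonneg : ∀ v, 0 ≤ P.b v
  b_cont : Continuous P.b
  b_mass : ∫ v, P.b v = 1
  b_zero_pos : 0 < P.b 0
  f₀_bdd : ∃ M, ∀ v, P.f₀ v ≤ M
  k_nonneg : ∀ v u, 0 ≤ P.k v u
  k_even_left : ∀ v u, P.k (-v) u = P.k v u
  k_even_right : ∀ v u, P.k v (-u) = P.k v u
  k_cont : ContinuousOn (fun q : ℝ × ℝ => P.k q.1 q.2) {q | q.2 ≠ 0}
  /-- conservation of mass at the ends -/
  mass : ∀ u : Vel d, u.1 ≠ 0 → ∫ v in {v : Vel d | 0 ≤ v.1}, v.1 * P.K v u = |u.1|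
  /-- the kernel is bounded for small relative incident velocities -/
  k_bdd : ∃ M, ∀ v u, |u| ≤ γ₀ → P.k v u ≤ M
  /-- the exponent `p`: momentum transferred by the diffusively emitted particles -/
  p_mem : p ∈ Icc (0 : ℝ) 2
  moment_integrable : ∀ u : ℝ, u ≠ 0 → IntegrableOn (fun v => v ^ 2 * P.k v u) (Ici 0)
  moment_bounds : ∃ c C : ℝ, 0 < c ∧ 0 < C ∧ ∀ u ∈ Ico (-γ₀) 0,
    c * |u| ^ p ≤ P.moment u ∧ P.moment u ≤ C * |u| ^ p
  moment_contDiff : ContDiffOn ℝ 1 P.moment {u | u ≠ 0}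
  /-- upper bound of the diffusive emission -/
  gain_bdd : ∃ M, ∀ v ∈ Icc (-γ₀) 0, ∀ η ∈ Icc (Vinf - γ₀) Vinf,
    IntegrableOn (fun u => P.k v (u - η) * P.a₀ u) (Iic Vinf) ∧
      ∫ u in Iic Vinf, P.k v (u - η) * P.a₀ u ≤ M
  /-- lower bound of the diffusive emission -/
  gain_lower : ∃ δ > 0, ∀ v ∈ Icc (-γ₀) 0, ∀ η ∈ Icc (Vinf - γ₀) Vinf,
    P.a₀ Vinf + δ ≤ (1 - P.α) * ∫ u in Iic (Vinf - γ₀), P.k v (u - η) * P.a₀ u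
  /-- `ℓ` is strictly decreasing on the negative half line -/
  ell_deriv_neg : ∀ w < 0, deriv P.ell w < 0
  /-- the integrals in `F₀` converge, locally uniformly and with one derivative -/
  ell_dominated : ∃ g : ℝ → ℝ, IntegrableOn g (Iio 0) ∧
    ∀ V : ℝ, |V - Vinf| ≤ γ₀ → ∀ w < 0,
      (P.ell w + |deriv P.ell w|) * (P.a₀ (w + V) + P.a₀ (w - V)) ≤ g w

/-- For a particle that hits an end at time `t` with velocity `u`, at the point with transversal
coordinate `x`: the times `s ∈ (0,t)` at which its straight line passes through the same end, with
a velocity that leaves the end (this is automatic for the latest passage if `u_x ≠ V(t)`).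
By convexity of the cross section, the particle can have met no other part of the body. -/
def precollisions (V : ℝ → ℝ) (e : Face) (t : ℝ) (x : Perp d) (u : Vel d) : Set ℝ :=
  {s | 0 < s ∧ s < t ∧ (t - s) * u.1 = ∫ τ in s..t, V τ ∧ ‖x - (t - s) • u.2‖ ≤ P.r ∧
    u ∈ e.emitted (V s)}

/-- The force on one end, up to its sign, in terms of the incident and emitted densities. -/
def faceForce (V : ℝ → ℝ) (fm fp : Face → ℝ → Perp d → Vel d → ℝ) (t : ℝ) (e : Face) : ℝ :=
  (∫ x in P.disc, ∫ v in e.incident (V t), (v.1 - V t) ^ 2 * fm e t x v) +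
    ∫ x in P.disc, ∫ v in e.emitted (V t), (v.1 - V t) ^ 2 * fp e t x v

/-- The total horizontal force on the body. -/
def force (V : ℝ → ℝ) (fm fp : Face → ℝ → Perp d → Vel d → ℝ) (t : ℝ) : ℝ :=
  P.faceForce V fm fp t .right - P.faceForce V fm fp t .left + P.lateralForce (V t)

/-- `V` is the velocity of the body, and `fm e t x v`, `fp e t x v` are the densities `f₋`, `f₊`
before and after collision on the end `e` at time `t`, at the point with transversal coordinate
`x`; the initial velocity is `V₀`. -/
structure IsSolution (E V₀ : ℝ) (V : ℝ → ℝ) (fm fp : Face → ℝ → Perp d → Vel d → ℝ) :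
    Prop where
  contDiff : ContDiff ℝ 1 V
  init : V 0 = V₀
  fm_measurable : ∀ e, Measurable (fun q : ℝ × Perp d × Vel d => fm e q.1 q.2.1 q.2.2)
  fp_measurable : ∀ e, Measurable (fun q : ℝ × Perp d × Vel d => fp e q.1 q.2.1 q.2.2)
  fm_bdd : ∃ M, ∀ e, ∀ t ≥ 0, ∀ x ∈ P.disc, ∀ v ∈ e.incident (V t), fm e t x v ∈ Icc 0 M
  fp_bdd : ∃ M, ∀ e, ∀ t ≥ 0, ∀ x ∈ P.disc, ∀ v ∈ e.emitted (V t), fp e t x v ∈ Icc 0 M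
  /-- free transport from the latest precollision -/
  transport : ∀ e, ∀ t ≥ 0, ∀ x ∈ P.disc, ∀ u ∈ e.incident (V t), ∀ τ,
    IsGreatest (P.precollisions V e t x u) τ →
      fm e t x u = fp e τ (x - (t - τ) • u.2) u
  /-- free transport from the initial time.  Precollisions without a latest one accumulate at
  `t`, which forces `u_x = V(t)`: a null set of velocities. -/
  transport_init : ∀ e, ∀ t ≥ 0, ∀ x ∈ P.disc, ∀ u ∈ e.incident (V t),
    (¬ ∃ τ, IsGreatest (P.precollisions V e t x u) τ) → fm e t x u = P.f₀ u
  diffuse_integrable : ∀ e, ∀ t ≥ 0, ∀ x ∈ P.disc, ∀ v ∈ e.emitted (V t),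
    IntegrableOn (fun u => P.K (boost (V t) v) (boost (V t) u) * fm e t x u) (e.incident (V t))
  /-- the law of reflection at the ends -/
  reflection : ∀ e, ∀ t ≥ 0, ∀ x ∈ P.disc, ∀ v ∈ e.emitted (V t),
    fp e t x v = P.α * fm e t x (2 * V t - v.1, v.2) +
      (1 - P.α) * ∫ u in e.incident (V t), P.K (boost (V t) v) (boost (V t) u) * fm e t x u
  /-- the integrals in the force converge -/
  incident_integrable : ∀ e, ∀ t ≥ 0,
    IntegrableOn (fun q : Perp d × Vel d => (q.2.1 - V t) ^ 2 * fm e t q.1 q.2)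
      (P.disc ×ˢ e.incident (V t))
  emitted_integrable : ∀ e, ∀ t ≥ 0,
    IntegrableOn (fun q : Perp d × Vel d => (q.2.1 - V t) ^ 2 * fp e t q.1 q.2)
      (P.disc ×ˢ e.emitted (V t))
  /-- the equation of motion -/
  motion : ∀ t ≥ 0, HasDerivAt V (E - P.force V fm fp t) t

end BodyGas

end

/-! Put g = V∞ - V and Φ(x) = F₀(V∞) - F₀(V∞ - x). Inserting the reflection law into the force
replaces the momentum of the emitted particles by a weight on the incident density, namely ℓ. The
equation of motion then becomes g' = -Φ(g) + R_R - R_L, where R_R and R_L integrate ℓ (f₋ - f₀) over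
the right and the left end. Only particles that met the body before contribute to them. By the mean
value theorem B₀ x ≤ Φ(x) ≤ B∞ x on [0, γ], so without the memory terms g would decay exponentially.

The power law comes from R_R. A particle emitted at time s and hit again at time t has u_x equal to
the mean of V over [s,t] and |u_⊥| ≤ 2r/(t-s). At the right end such u_x fill an interval below
V(t), whose length w is of the order of (mean of g) - g(t). There ℓ is of order w^p at distance w
from V(t), and the transversal velocities fill a ball of volume of order (t-s)^(-(d-1)). The
integral of g is of order γ, so for early s one has w ~ γ/t, hence R_R ~ (γ/t)^(p+1) t^(-(d-1)) =
γ^(p+1) t^(-(d+p)). Assumption (A5) makes the re-emitted density exceed f₀ by a fixed multiple of b,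
which gives the sign and the lower bound (`IsSolution.le_recollision_right`). Assumptions (A2) and
(A4), with a contraction argument, bound f₋ by a multiple of b uniformly in the solution
(`IsSolution.incident_le`), which gives the upper bound.

The left end works against the decay: particles of f₀ may be missing behind the body, so -R_L can be
positive. The missing pressure involves one end only, while F₀' contains the contribution 2|D| ℓ(0-)
a₀(V) of both ends together with a positive remainder. Near V∞ the loss therefore has slope at most
3/4 of a lower bound for F₀' (`Assumptions.exists_slope_bounds`). Moreover R_L = 0 whenever V(t)
exceeds all earlier values.

All estimates are comparison arguments. The bounds on the memory terms are used at a first contact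
of g with a barrier, where the barrier itself controls the past of g; no monotonicity of V is
needed. This is isolated in the abstract `MemoryFlow`: the upper bound is `MemoryFlow.le_majorant`,
the lower ones are `MemoryFlow.exp_le` and `MemoryFlow.tail_le`. `Assumptions.exists_memoryBounds`
shows that every solution is such a flow, with constants independent of the solution and of γ. -/

noncomputable section

/-! ### Barrier principle -/

/-- A function that is negative before `t` and vanishes at `t` has nonnegative derivative there. -/
theorem deriv_nonneg_of_neg_before {φ : ℝ → ℝ} {φ' a t : ℝ} (hat : a < t)
    (hd : HasDerivAt φ φ' t) (hneg : ∀ s ∈ Ico a t, φ s < 0) (h0 : φ t = 0) : 0 ≤ φ' := by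
  have h1 : Tendsto (slope φ t) (nhdsWithin t (Iio t)) (nhds φ') :=
    (hasDerivAt_iff_tendsto_slope.mp hd).mono_left
      (nhdsWithin_mono _ fun x hx => ne_of_lt hx)
  refine ge_of_tendsto h1 ?_
  filter_upwards [Ioo_mem_nhdsLT hat] with s hs
  rw [slope_def_field, h0]
  exact div_nonneg_of_nonpos (by have := hneg s ⟨hs.1.le, hs.2⟩; linarith) (by linarith [hs.2])

theorem nonpos_of_neg_before {φ : ℝ → ℝ} {a t : ℝ} (hat : a < t)
    (hc : ContinuousAt φ t) (hneg : ∀ s ∈ Ico a t, φ s < 0) : φ t ≤ 0 := by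
  have h1 : Tendsto φ (nhdsWithin t (Iio t)) (nhds (φ t)) := hc.tendsto.mono_left nhdsWithin_le_nhds
  refine le_of_tendsto h1 ?_
  filter_upwards [Ioo_mem_nhdsLT hat] with s hs
  exact (hneg s ⟨hs.1.le, hs.2⟩).le

/-- Barrier principle for two functions, with access to the past at a first contact time. -/
theorem barrier_pair {φ ψ φ' ψ' : ℝ → ℝ} {a : ℝ}
    (hφ : ∀ t ≥ a, HasDerivAt φ (φ' t) t) (hψ : ∀ t ≥ a, HasDerivAt ψ (ψ' t) t)
    (hφa : φ a < 0) (hψa : ψ a < 0)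
    (h : ∀ t > a, (∀ s ∈ Ico a t, φ s < 0 ∧ ψ s < 0) → φ t ≤ 0 → ψ t ≤ 0 →
      (φ t = 0 → φ' t < 0) ∧ (ψ t = 0 → ψ' t < 0)) :
    ∀ t ≥ a, φ t < 0 ∧ ψ t < 0 := by
  by_contra! hcon
  obtain ⟨b, hab, hb⟩ := hcon
  -- The infimum of this closed set is the first contact time of either function with zero.
  set S : Set ℝ := Icc a b ∩ {t | 0 ≤ max (φ t) (ψ t)} with hS
  have hcont : ContinuousOn (fun t => max (φ t) (ψ t)) (Icc a b) := fun t ht =>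
    ContinuousAt.continuousWithinAt
      (Tendsto.max (hφ t ht.1).continuousAt (hψ t ht.1).continuousAt)
  have hclosed : IsClosed S := by
    have := hcont.preimage_isClosed_of_isClosed isClosed_Icc (isClosed_Ici (a := (0 : ℝ)))
    exact this
  have hne : S.Nonempty := ⟨b, ⟨hab, le_rfl⟩, by
    by_cases hb' : φ b < 0
    · exact le_max_of_le_right (hb hb')
    · exact le_max_of_le_left (not_lt.mp hb')⟩
  have hbdd : BddBelow S := ⟨a, fun t ht => ht.1.1⟩
  have hmem := hclosed.csInf_mem hne hbdd
  set t := sInf S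
  have hat : a < t := lt_of_le_of_ne hmem.1.1 fun heq => by
    have := hmem.2
    rw [← heq] at this
    exact absurd (max_lt hφa hψa) (not_lt.mpr this)
  have hpast : ∀ s ∈ Ico a t, φ s < 0 ∧ ψ s < 0 := by
    intro s hs
    by_contra hneg
    have : s ∈ S := ⟨⟨hs.1, hs.2.le.trans hmem.1.2⟩, by
      by_contra hlt
      exact hneg (max_lt_iff.mp (not_le.mp hlt))⟩
    exact absurd (csInf_le hbdd this) (not_le.mpr hs.2)
  have h1 := nonpos_of_neg_before hat (hφ t hat.le).continuousAt fun s hs => (hpast s hs).1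
  have h2 := nonpos_of_neg_before hat (hψ t hat.le).continuousAt fun s hs => (hpast s hs).2
  obtain ⟨h3, h4⟩ := h t hat hpast h1 h2
  have hmax : 0 ≤ max (φ t) (ψ t) := hmem.2
  rcases le_max_iff.mp hmax with h5 | h5
  · have h6 := le_antisymm h1 h5
    exact absurd (deriv_nonneg_of_neg_before hat (hφ t hat.le) (fun s hs => (hpast s hs).1) h6)
      (not_le.mpr (h3 h6))
  · have h6 := le_antisymm h2 h5
    exact absurd (deriv_nonneg_of_neg_before hat (hψ t hat.le) (fun s hs => (hpast s hs).2) h6)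
      (not_le.mpr (h4 h6))

/-- Barrier principle, with access to the past at a first contact time. -/
theorem barrier {φ φ' : ℝ → ℝ} {a : ℝ} (hφ : ∀ t ≥ a, HasDerivAt φ (φ' t) t) (hφa : φ a < 0)
    (h : ∀ t > a, (∀ s ∈ Ico a t, φ s < 0) → φ t = 0 → φ' t < 0) : ∀ t ≥ a, φ t < 0 := by
  intro t ht
  exact (barrier_pair hφ hφ hφa hφa (fun t ht hp _ _ =>
    ⟨h t ht fun s hs => (hp s hs).1, h t ht fun s hs => (hp s hs).1⟩) t ht).1

/-! ### Time averages and the abstract equation with memory -/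

/-- The average of `g` over `[s,t]`. -/
def timeAvg (g : ℝ → ℝ) (s t : ℝ) : ℝ := (∫ τ in s..t, g τ) / (t - s)

theorem timeAvg_le {g : ℝ → ℝ} (hg : Continuous g) {s t M : ℝ} (hst : s < t)
    (h : ∀ τ ∈ Icc s t, g τ ≤ M) : timeAvg g s t ≤ M := by
  unfold timeAvg
  rw [div_le_iff₀ (by linarith)]
  calc ∫ τ in s..t, g τ ≤ ∫ τ in s..t, M :=
        intervalIntegral.integral_mono_on hst.le (hg.intervalIntegrable _ _)
          (continuous_const.intervalIntegrable _ _) h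
    _ = M * (t - s) := by simp [mul_comm]

theorem le_timeAvg {g : ℝ → ℝ} (hg : Continuous g) {s t M : ℝ} (hst : s < t)
    (h : ∀ τ ∈ Icc s t, M ≤ g τ) : M ≤ timeAvg g s t := by
  unfold timeAvg
  rw [le_div_iff₀ (by linarith)]
  calc M * (t - s) = ∫ τ in s..t, M := by simp [mul_comm]
    _ ≤ ∫ τ in s..t, g τ :=
        intervalIntegral.integral_mono_on hst.le (continuous_const.intervalIntegrable _ _)
          (hg.intervalIntegrable _ _) h

theorem lt_timeAvg {g : ℝ → ℝ} (hg : Continuous g) {s t M : ℝ} (hst : s < t)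
    (h : ∀ τ ∈ Ico s t, M < g τ) : M < timeAvg g s t := by
  unfold timeAvg
  rw [lt_div_iff₀ (by linarith)]
  have h1 : 0 < ∫ τ in s..t, (g τ - M) :=
    intervalIntegral.intervalIntegral_pos_of_pos_on
      ((hg.sub continuous_const).intervalIntegrable _ _)
      (fun x hx => sub_pos.mpr (h x ⟨hx.1.le, hx.2⟩)) hst
  rw [intervalIntegral.integral_sub (hg.intervalIntegrable _ _)
    (continuous_const.intervalIntegrable _ _)] at h1
  simp at h1
  linarith

/-- Bounds for the memory terms `RR` (right end) and `RL` (left end) in the equation for the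
difference `g` between the equilibrium velocity and the velocity of the body. -/
structure MemoryBounds (n : ℕ) (p cR K q γb : ℝ) (g RR RL : ℝ → ℝ) : Prop where
  nonneg : ∀ t ≥ 0, (∀ s ∈ Icc 0 t, 0 ≤ g s ∧ g s < γb) → 0 ≤ RR t
  lower : ∀ t > 0, (∀ s ∈ Icc 0 t, 0 ≤ g s ∧ g s < γb) → g t < timeAvg g 0 t →
    cR * (timeAvg g 0 t - g t) ^ (p + 1) / (1 + t) ^ n ≤ RR t
  upper : ∀ t ≥ 0, (∀ s ∈ Icc 0 t, 0 ≤ g s ∧ g s < γb) →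
    ∀ w₁ w₂ w₃ σ₁ σ₂ : ℝ, 0 ≤ w₁ → 0 ≤ w₂ → 0 ≤ w₃ → 0 < σ₁ → 0 < σ₂ →
    (∀ s ∈ Ioo 0 t, (timeAvg g s t - g t ≤ w₁ ∧ σ₁ ≤ t - s) ∨
      (timeAvg g s t - g t ≤ w₂ ∧ σ₂ ≤ t - s) ∨ timeAvg g s t - g t ≤ w₃) →
    RR t ≤ K * (w₁ ^ (p + 1) / σ₁ ^ n + w₂ ^ (p + 1) / σ₂ ^ n + w₃ ^ (p + 1))
  left : ∀ t ≥ 0, (∀ s ∈ Icc 0 t, 0 ≤ g s ∧ g s < γb) → ∀ w : ℝ, 0 ≤ w → w < γb →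
    (∀ s ∈ Ioo 0 t, g t - timeAvg g s t ≤ w) → -RL t ≤ q * w ∧ -RL t ≤ K * w ^ (p + 1)
  left_zero : ∀ t ≥ 0, (∀ s ∈ Icc 0 t, 0 ≤ g s ∧ g s < γb) →
    (∀ s ∈ Ico 0 t, g t < g s) → RL t = 0

/-- The equation of motion for the difference `g`, started from `γ`. -/
structure MemoryFlow (n : ℕ) (p cR K q γb γ : ℝ) (Φ g RR RL : ℝ → ℝ) : Prop
    extends MemoryBounds n p cR K q γb g RR RL where
  continuous : Continuous g
  init : g 0 = γ
  motion : ∀ t ≥ 0, HasDerivAt g (-Φ (g t) + RR t - RL t) t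

/-! ### A priori bounds for the flow -/

section Flow

variable {n : ℕ} {p cR K q γb γ β Bbar : ℝ} {Φ g RR RL : ℝ → ℝ}

/-- Both barriers must be run together, since the memory bounds presuppose two-sided control of the
past. At a first contact with 0 the left memory vanishes, because g lies below all its past values,
and the right one is strictly positive, so g is pushed up. At a first contact with γ + ε no past
average exceeds g, so the right memory is at most 0 and the left one cannot outweigh Φ because q <
β. The margin ε makes the initial inequality strict. -/
theorem MemoryFlow.mem_Ioo (h : MemoryFlow n p cR K q γb γ Φ g RR RL) (hp : 0 ≤ p) (hcR : 0 < cR)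
    (hq : q < β) (hγ : 0 < γ)
    (hΦ0 : Φ 0 = 0) (hΦ : ∀ x ∈ Ico 0 γb, β * x ≤ Φ x) {ε : ℝ} (hε : 0 < ε) (hγε : γ + ε < γb) :
    ∀ t ≥ 0, 0 < g t ∧ g t < γ + ε := by
  have key := barrier_pair (φ := fun t => - g t) (ψ := fun t => g t - (γ + ε)) (a := 0)
    (fun t ht => (h.motion t ht).neg) (fun t ht => (h.motion t ht).sub_const _)
    (by simp [h.init, hγ]) (by simp [h.init, hε]) (by
      intro t ht hpast h1 h2
      have hpast' : ∀ s ∈ Ico 0 t, 0 < g s ∧ g s < γ + ε := fun s hs => by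
        have := hpast s hs
        constructor <;> linarith
      have hle : ∀ s ∈ Icc 0 t, 0 ≤ g s ∧ g s ≤ γ + ε := by
        intro s hs
        rcases hs.2.lt_or_eq with hlt | rfl
        · exact ⟨(hpast' s ⟨hs.1, hlt⟩).1.le, (hpast' s ⟨hs.1, hlt⟩).2.le⟩
        · constructor <;> linarith
      have hist : ∀ s ∈ Icc 0 t, 0 ≤ g s ∧ g s < γb := fun s hs =>
        ⟨(hle s hs).1, (hle s hs).2.trans_lt hγε⟩
      constructor
      · intro h0
        have hg0 : g t = 0 := by linarith
        have hRL : RL t = 0 := h.left_zero t ht.le hist fun s hs => by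
          rw [hg0]; exact (hpast' s hs).1
        have hA : g t < timeAvg g 0 t := lt_timeAvg h.continuous ht fun s hs => by
          rw [hg0]; exact (hpast' s hs).1
        have hlow := h.lower t ht hist hA
        have hpos : 0 < cR * (timeAvg g 0 t - g t) ^ (p + 1) / (1 + t) ^ n := by
          have := Real.rpow_pos_of_pos (sub_pos.mpr hA) (p + 1)
          positivity
        rw [hg0, hΦ0, hRL]
        linarith
      · intro h0
        have hgt : g t = γ + ε := by linarith
        have hRR := h.upper t ht.le hist 0 0 0 1 1 le_rfl le_rfl le_rfl one_pos one_pos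
          (fun s hs => Or.inr (Or.inr (by
            have := timeAvg_le h.continuous hs.2 (M := γ + ε) fun τ hτ =>
              (hle τ ⟨hs.1.le.trans hτ.1, hτ.2⟩).2
            linarith)))
        rw [Real.zero_rpow (by linarith)] at hRR
        have hRL := (h.left t ht.le hist (γ + ε) (by linarith) hγε (fun s hs => by
            have := le_timeAvg h.continuous hs.2 (M := 0) fun τ hτ =>
              (hle τ ⟨hs.1.le.trans hτ.1, hτ.2⟩).1
            linarith)).1
        have := hΦ (γ + ε) ⟨by linarith, hγε⟩
        rw [hgt]
        have h5 : q * (γ + ε) < β * (γ + ε) := mul_lt_mul_of_pos_right hq (by linarith)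
        simp at hRR
        linarith)
  intro t ht
  have := key t ht
  constructor <;> linarith

theorem MemoryFlow.pos_le (h : MemoryFlow n p cR K q γb γ Φ g RR RL) (hp : 0 ≤ p) (hcR : 0 < cR)
    (hq : q < β) (hγ : 0 < γ) (hγb : γ < γb)
    (hΦ0 : Φ 0 = 0) (hΦ : ∀ x ∈ Ico 0 γb, β * x ≤ Φ x) :
    ∀ t ≥ 0, 0 < g t ∧ g t ≤ γ := by
  intro t ht
  refine ⟨(h.mem_Ioo hp hcR hq hγ hΦ0 hΦ (ε := (γb - γ) / 2) (by linarith) (by linarith)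
    t ht).1, ?_⟩
  refine le_of_forall_pos_lt_add fun ε hε => ?_
  have h1 := (h.mem_Ioo hp hcR hq hγ hΦ0 hΦ (ε := min ε ((γb - γ) / 2))
    (lt_min hε (by linarith)) (by have := min_le_right ε ((γb - γ) / 2); linarith) t ht).2
  have := min_le_left ε ((γb - γ) / 2)
  linarith

/-- The right memory only helps. If g first touches a decreasing exponential from above, then it
lies below all its past values, so the left memory vanishes and the right one is strictly positive.
The factor θ < 1 gives strictness at time 0 and then tends to 1. -/
theorem MemoryFlow.exp_le (h : MemoryFlow n p cR K q γb γ Φ g RR RL) (hcR : 0 < cR)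
    (hγ : 0 < γ) (hγb : γ < γb) {Binf : ℝ} (hB : 0 < Binf)
    (hg : ∀ t ≥ 0, 0 < g t ∧ g t ≤ γ)
    (hΦ : ∀ x ∈ Icc 0 γ, Φ x ≤ Binf * x) :
    ∀ t ≥ 0, γ * Real.exp (-Binf * t) ≤ g t := by
  have hist : ∀ t, ∀ s ∈ Icc 0 t, 0 ≤ g s ∧ g s < γb := fun t s hs =>
    ⟨(hg s hs.1).1.le, (hg s hs.1).2.trans_lt hγb⟩
  have main : ∀ θ ∈ Ioo (0 : ℝ) 1, ∀ t ≥ 0, θ * γ * Real.exp (-Binf * t) < g t := by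
    intro θ hθ t ht
    have hd : ∀ t, HasDerivAt (fun t => θ * γ * Real.exp (-Binf * t))
        (-Binf * (θ * γ * Real.exp (-Binf * t))) t := fun t => by
      have h1 : HasDerivAt (fun t => -Binf * t) (-Binf) t := by
        simpa using (hasDerivAt_id t).const_mul (-Binf)
      exact (h1.exp.const_mul (θ * γ)).congr_deriv (by ring)
    have := barrier (φ := fun t => θ * γ * Real.exp (-Binf * t) - g t) (a := 0)
      (fun t ht => (hd t).sub (h.motion t ht))
      (by simp only [mul_zero, Real.exp_zero, mul_one, h.init]; nlinarith [hθ.2]) (by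
        intro t ht hpast h0
        have hRL : RL t = 0 := h.left_zero t ht.le (hist t) fun s hs => by
          have h1 := hpast s hs
          have h2 : Real.exp (-Binf * t) ≤ Real.exp (-Binf * s) :=
            Real.exp_le_exp.mpr (by nlinarith [hs.2])
          have h3 : θ * γ * Real.exp (-Binf * t) ≤ θ * γ * Real.exp (-Binf * s) :=
            mul_le_mul_of_nonneg_left h2 (mul_nonneg hθ.1.le hγ.le)
          linarith
        have hA : g t < timeAvg g 0 t := lt_timeAvg h.continuous ht fun s hs => by
          have h1 := hpast s hs
          have h2 : Real.exp (-Binf * t) ≤ Real.exp (-Binf * s) :=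
            Real.exp_le_exp.mpr (by nlinarith [hs.2])
          have h3 : θ * γ * Real.exp (-Binf * t) ≤ θ * γ * Real.exp (-Binf * s) :=
            mul_le_mul_of_nonneg_left h2 (mul_nonneg hθ.1.le hγ.le)
          linarith
        have hlow := h.lower t ht (hist t) hA
        have hpos : 0 < cR * (timeAvg g 0 t - g t) ^ (p + 1) / (1 + t) ^ n := by
          have := Real.rpow_pos_of_pos (sub_pos.mpr hA) (p + 1)
          positivity
        have h1 := hΦ (g t) ⟨(hg t ht.le).1.le, (hg t ht.le).2⟩
        have h2 : θ * γ * Real.exp (-Binf * t) = g t := by linarith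
        rw [hRL, h2]
        linarith) t ht
    linarith
  intro t ht
  have hlim : Tendsto (fun θ : ℝ => θ * γ * Real.exp (-Binf * t)) (nhdsWithin 1 (Iio 1))
      (nhds (1 * γ * Real.exp (-Binf * t))) :=
    ((continuous_id.mul continuous_const).mul continuous_const).continuousAt.tendsto.mono_left
      nhdsWithin_le_nhds
  rw [one_mul] at hlim
  refine le_of_tendsto hlim ?_
  filter_upwards [Ioo_mem_nhdsLT (zero_lt_one (α := ℝ))] with θ hθ
  exact (main θ hθ t ht).le

/-- A crude bound without decay of the correction, used on the initial interval [0, T]. All averages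
are at most γ, so each of the two memory terms is at most K γ^(p+1); the factor 3 instead of 2 makes
the comparison strict. -/
theorem MemoryFlow.le_exp_add (h : MemoryFlow n p cR K q γb γ Φ g RR RL) (hp : 0 ≤ p)
    (hβ : 0 < β) (hK : 0 < K) (hγ : 0 < γ) (hγb : γ < γb) {B₀ : ℝ} (hB : β ≤ B₀)
    (hg : ∀ t ≥ 0, 0 < g t ∧ g t ≤ γ)
    (hΦ : ∀ x ∈ Icc 0 γ, B₀ * x ≤ Φ x) :
    ∀ t ≥ 0, g t ≤ γ * Real.exp (-B₀ * t) + 3 * K / β * γ ^ (p + 1) := by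
  have hist : ∀ t, ∀ s ∈ Icc 0 t, 0 ≤ g s ∧ g s < γb := fun t s hs =>
    ⟨(hg s hs.1).1.le, (hg s hs.1).2.trans_lt hγb⟩
  have hd : ∀ t, HasDerivAt (fun t => γ * Real.exp (-B₀ * t) + 3 * K / β * γ ^ (p + 1))
      (-B₀ * (γ * Real.exp (-B₀ * t))) t := fun t => by
    have h1 : HasDerivAt (fun t => -B₀ * t) (-B₀) t := by
      simpa using (hasDerivAt_id t).const_mul (-B₀)
    exact ((h1.exp.const_mul γ).add_const (3 * K / β * γ ^ (p + 1))).congr_deriv (by ring)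
  have hγp : 0 < γ ^ (p + 1) := Real.rpow_pos_of_pos hγ _
  intro t ht
  have := barrier (φ := fun t => g t - (γ * Real.exp (-B₀ * t) + 3 * K / β * γ ^ (p + 1)))
    (a := 0) (fun t ht => (h.motion t ht).sub (hd t))
    (by
      simp only [mul_zero, Real.exp_zero, mul_one, h.init]
      have : 0 < 3 * K / β * γ ^ (p + 1) := by positivity
      linarith) (by
      intro t ht hpast h0
      have hRR := h.upper t ht.le (hist t) 0 0 γ 1 1 le_rfl le_rfl hγ.le one_pos one_pos
        (fun s hs => Or.inr (Or.inr (by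
          have h1 := timeAvg_le h.continuous hs.2 (M := γ) fun τ hτ =>
            (hg τ (hs.1.le.trans hτ.1)).2
          have := (hg t ht.le).1
          linarith)))
      rw [Real.zero_rpow (by linarith)] at hRR
      have hRL := (h.left t ht.le (hist t) γ hγ.le hγb (fun s hs => by
          have h1 := le_timeAvg h.continuous hs.2 (M := 0) fun τ hτ =>
            (hg τ (hs.1.le.trans hτ.1)).1.le
          have := (hg t ht.le).2
          linarith)).2
      have h1 := hΦ (g t) ⟨(hg t ht.le).1.le, (hg t ht.le).2⟩
      have h2 : g t = γ * Real.exp (-B₀ * t) + 3 * K / β * γ ^ (p + 1) := by linarith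
      have h3 : 3 * K * γ ^ (p + 1) ≤ B₀ * (3 * K / β * γ ^ (p + 1)) := by
        calc 3 * K * γ ^ (p + 1) = β * (3 * K / β * γ ^ (p + 1)) := by field_simp
          _ ≤ _ := mul_le_mul_of_nonneg_right hB (by positivity)
      have h4 : B₀ * g t = B₀ * (γ * Real.exp (-B₀ * t)) + B₀ * (3 * K / β * γ ^ (p + 1)) := by
        rw [h2]; ring
      simp at hRR
      have : 0 < K * γ ^ (p + 1) := by positivity
      linarith) t ht
  linarith

end Flow

/-! ### The majorant and elementary power inequalities -/

theorem exists_exp_neg_le_div_rpow {β : ℝ} (hβ : 0 < β) (e : ℝ) :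
    ∃ A > 0, ∀ t ≥ 0, Real.exp (-(β * t)) ≤ A / (1 + t) ^ e := by
  set N := ⌈e⌉₊
  refine ⟨N.factorial * (1 / β) ^ N * Real.exp β, by positivity, fun t ht => ?_⟩
  have h1 : (1 + t) ^ e ≤ (1 + t) ^ N := by
    rw [← Real.rpow_natCast]
    exact Real.rpow_le_rpow_of_exponent_le (by linarith) (Nat.le_ceil e)
  have h2 := Real.pow_div_factorial_le_exp (x := β * (1 + t)) (by positivity) N
  rw [div_le_iff₀ (by positivity), mul_pow] at h2
  rw [le_div_iff₀ (by positivity)]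
  calc Real.exp (-(β * t)) * (1 + t) ^ e ≤ Real.exp (-(β * t)) * (1 + t) ^ N := by gcongr
    _ = Real.exp (-(β * t)) * ((1 / β) ^ N * (β ^ N * (1 + t) ^ N)) := by
        rw [← mul_assoc ((1 / β) ^ N), ← mul_pow]
        field_simp
        simp
    _ ≤ Real.exp (-(β * t)) * ((1 / β) ^ N * (Real.exp (β * (1 + t)) * N.factorial)) := by gcongr
    _ = N.factorial * (1 / β) ^ N * (Real.exp (-(β * t)) * Real.exp (β * (1 + t))) := by ring
    _ = _ := by rw [← Real.exp_add]; ring_nf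

theorem add_rpow_le_two_rpow_mul {a b m : ℝ} (ha : 0 ≤ a) (hb : 0 ≤ b) (hm : 0 ≤ m) :
    (a + b) ^ m ≤ 2 ^ m * (a ^ m + b ^ m) := by
  wlog hab : a ≤ b generalizing a b
  · rw [add_comm a b, add_comm (a ^ m)]
    exact this hb ha (le_of_not_ge hab)
  calc (a + b) ^ m ≤ (2 * b) ^ m := Real.rpow_le_rpow (by positivity) (by linarith) hm
    _ = 2 ^ m * b ^ m := Real.mul_rpow (by norm_num) hb
    _ ≤ _ := by
      have := Real.rpow_nonneg ha m
      gcongr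
      linarith

theorem rpow_le_self_of_le_one' {x m : ℝ} (h0 : 0 ≤ x) (h1 : x ≤ 1) (hm : 1 ≤ m) : x ^ m ≤ x := by
  rcases h0.eq_or_lt with rfl | h0
  · rw [Real.zero_rpow (by linarith)]
  · simpa using Real.rpow_le_rpow_of_exponent_ge h0 h1 hm

/-- Separates the exponential part from the algebraic part of an average. The power is kept on γ and
given up on the factors in [0, 1], so that both terms become linear in quantities of order
(1+t)^(-e). -/
theorem mul_add_rpow_le {γ a y m : ℝ} (hγ : 0 ≤ γ) (ha0 : 0 ≤ a) (ha1 : a ≤ 1) (hy0 : 0 ≤ y)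
    (hy1 : y ≤ 1) (hm : 1 ≤ m) : (γ * a + y) ^ m ≤ 2 ^ m * (γ ^ m * a + y) := by
  refine (add_rpow_le_two_rpow_mul (by positivity) hy0 (by linarith)).trans ?_
  rw [Real.mul_rpow hγ ha0]
  have h1 := rpow_le_self_of_le_one' ha0 ha1 hm
  have h2 := rpow_le_self_of_le_one' hy0 hy1 hm
  have := Real.rpow_nonneg hγ m
  gcongr

/-- The function that dominates the distance to equilibrium. -/
def majorant (e m γ B C t : ℝ) : ℝ := γ * Real.exp (-B * t) + C * γ ^ m / (1 + t) ^ e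

theorem hasDerivAt_majorant {e m γ B C t : ℝ} (ht : 0 ≤ t) :
    HasDerivAt (majorant e m γ B C)
      (-B * (γ * Real.exp (-B * t)) - e / (1 + t) * (C * γ ^ m / (1 + t) ^ e)) t := by
  have h1 : HasDerivAt (fun t => -B * t) (-B) t := by
    simpa using (hasDerivAt_id t).const_mul (-B)
  have h2 : HasDerivAt (fun t : ℝ => 1 + t) 1 t := by
    simpa using (hasDerivAt_id t).const_add 1
  have h3 := h2.rpow_const (p := -e) (Or.inl (by linarith : (1 + t) ≠ 0))
  have h4 := (h1.exp.const_mul γ).add (h3.const_mul (C * γ ^ m))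
  refine (h4.congr_deriv ?_).congr_of_eventuallyEq ?_
  · rw [Real.rpow_sub_one (by linarith), Real.rpow_neg (by linarith)]
    field_simp
    ring
  · filter_upwards [eventually_gt_nhds (show (-1 : ℝ) < t by linarith)] with s hs
    simp only [majorant, Pi.add_apply]
    rw [Real.rpow_neg (by linarith)]
    rfl

/-! ### Upper bound by the majorant -/

section Flow

variable {n : ℕ} {p cR K q γb γ β B₀ L T κ E₁ C : ℝ} {Φ g RR RL : ℝ → ℝ}

/-- Besides a term of order γ, the constant C enters only with the factor 1/(1+T). This is what
allows T to be chosen before C. -/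
theorem integral_le_of_le_majorant {e m t : ℝ} (hg : Continuous g) (hγ : 0 ≤ γ) (hβ : 0 < β)
    (hC : 0 ≤ C) (he : 2 ≤ e) (hT : 0 ≤ T) (hTt : T ≤ t) (hB : β ≤ B₀)
    (h1 : ∀ s ∈ Icc 0 T, g s ≤ γ) (h2 : ∀ s ∈ Icc T t, g s ≤ majorant e m γ B₀ C s) :
    ∫ s in (0 : ℝ)..t, g s ≤ γ * (T + 1 / β) + C * γ ^ m / (1 + T) := by
  have hγm : 0 ≤ γ ^ m := Real.rpow_nonneg hγ m
  rw [← intervalIntegral.integral_add_adjacent_intervals (hg.intervalIntegrable 0 T)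
    (hg.intervalIntegrable T t)]
  have hA : ∫ s in (0 : ℝ)..T, g s ≤ γ * T := by
    calc ∫ s in (0 : ℝ)..T, g s ≤ ∫ s in (0 : ℝ)..T, γ :=
          intervalIntegral.integral_mono_on hT (hg.intervalIntegrable _ _)
            (continuous_const.intervalIntegrable _ _) h1
      _ = γ * T := by simp [mul_comm]
  -- Lowering the rate to β and the exponent to 2 yields an integrand with an explicit primitive.
  set U : ℝ → ℝ := fun s => -(γ / β * Real.exp (-β * s)) - C * γ ^ m * (1 + s)⁻¹
  set u : ℝ → ℝ := fun s => γ * Real.exp (-β * s) + C * γ ^ m / (1 + s) ^ 2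
  have hU : ∀ s ∈ uIcc T t, HasDerivAt U (u s) s := by
    intro s hs
    rw [uIcc_of_le hTt] at hs
    have hs0 : 0 ≤ s := hT.trans hs.1
    have h1 : HasDerivAt (fun t => -β * t) (-β) s := by
      simpa using (hasDerivAt_id s).const_mul (-β)
    have h2 : HasDerivAt (fun t : ℝ => 1 + t) 1 s := by
      simpa using (hasDerivAt_id s).const_add 1
    refine (((h1.exp.const_mul (γ / β)).neg).sub
      ((h2.inv (by linarith)).const_mul (C * γ ^ m))).congr_deriv ?_
    simp only [u]
    field_simp
    ring
  have hu : ContinuousOn u (uIcc T t) := by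
    rw [uIcc_of_le hTt]
    refine ContinuousOn.add (by fun_prop) (ContinuousOn.div (by fun_prop) (by fun_prop) ?_)
    intro s hs
    have : 0 ≤ s := hT.trans hs.1
    positivity
  have hB' : ∫ s in T..t, g s ≤ ∫ s in T..t, u s := by
    refine intervalIntegral.integral_mono_on hTt (hg.intervalIntegrable _ _)
      hu.intervalIntegrable fun s hs => (h2 s hs).trans ?_
    have hs0 : 0 ≤ s := hT.trans hs.1
    simp only [majorant, u]
    have h3 : (1 + s) ^ 2 ≤ (1 + s) ^ e := by
      rw [← Real.rpow_two]
      exact Real.rpow_le_rpow_of_exponent_le (by linarith) he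
    have h4 : Real.exp (-B₀ * s) ≤ Real.exp (-β * s) := Real.exp_le_exp.mpr (by nlinarith)
    gcongr
  rw [intervalIntegral.integral_eq_sub_of_hasDerivAt hU hu.intervalIntegrable] at hB'
  have h5 : Real.exp (-β * T) ≤ 1 := Real.exp_le_one_iff.mpr (by nlinarith)
  have h6 : 0 ≤ γ / β * Real.exp (-β * t) := by positivity
  have h7 : γ / β * Real.exp (-β * T) ≤ γ / β * 1 := by gcongr
  have h8 : 0 ≤ C * γ ^ m * (1 + t)⁻¹ := by
    have : 0 ≤ t := hT.trans hTt
    positivity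
  simp only [U] at hB'
  have h9 : γ * (T + 1 / β) = γ * T + γ / β * 1 := by ring
  have h10 : C * γ ^ m * (1 + T)⁻¹ = C * γ ^ m / (1 + T) := rfl
  linarith

/-- Bound for the right memory term at a contact with the majorant. -/
theorem MemoryFlow.right_le_of_contact (h : MemoryFlow n p cR K q γb γ Φ g RR RL) (hn : 1 ≤ n)
    (hp : 0 ≤ p) (hβ : 0 < β) (hK : 0 < K) (hγ : 0 < γ) (hγb : γ < γb) (hB : β ≤ B₀)
    (hg : ∀ t ≥ 0, 0 < g t ∧ g t ≤ γ)
    (hL : 1 ≤ L) (hTL : 2 * L ≤ T) (hκ0 : 0 ≤ κ) (hκ1 : κ ≤ 1)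
    (hκ : ∀ t ≥ T, 1 / (1 + t - L) ^ (n + (p + 1)) ≤ (1 + κ) / (1 + t) ^ (n + (p + 1)))
    (hE : ∀ t ≥ 0, Real.exp (-(β / 2 * t)) ≤ E₁ / (1 + t) ^ (n + (p + 1)))
    (hC : 0 < C) (hCγ : C * γ ^ (p + 1) ≤ 1) {t : ℝ} (hTt : T ≤ t)
    (hle : ∀ s ∈ Icc 0 t, g s ≤ majorant (n + (p + 1)) (p + 1) γ B₀ C s)
    (ht : g t = majorant (n + (p + 1)) (p + 1) γ B₀ C t) :
    RR t ≤ γ ^ (p + 1) / (1 + t) ^ (n + (p + 1)) *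
      (K * 4 ^ (n + (p + 1)) * 2 ^ (p + 1) * ((T + 1 / β) ^ (p + 1) + C / (1 + T)) +
        K * 2 ^ (p + 1) * (E₁ + 2 ^ (n + (p + 1)) * C) / L +
        K * 2 ^ (p + 1) * (E₁ + κ * C)) := by
  have hn' : (1 : ℝ) ≤ n := by exact_mod_cast hn
  set m := p + 1 with hm
  set e : ℝ := n + m with he
  have hm1 : 1 ≤ m := by linarith
  have he2 : 2 ≤ e := by linarith
  have ht2 : 2 ≤ t := by linarith
  have ht0 : 0 < t := by linarith
  have hγm : 0 < γ ^ m := Real.rpow_pos_of_pos hγ m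
  have hist : ∀ s ∈ Icc 0 t, 0 ≤ g s ∧ g s < γb := fun s hs =>
    ⟨(hg s hs.1).1.le, (hg s hs.1).2.trans_lt hγb⟩
  set a := Real.exp (-(β / 2 * t)) with ha
  have ha0 : 0 < a := Real.exp_pos _
  have ha1 : a ≤ 1 := Real.exp_le_one_iff.mpr (by nlinarith)
  have hD : 0 < (1 + t) ^ e := Real.rpow_pos_of_pos (by linarith) e
  have hD1 : 1 ≤ (1 + t) ^ e := Real.one_le_rpow (by linarith) (by linarith)
  have hexp : ∀ τ ≥ t / 2, Real.exp (-B₀ * τ) ≤ a := fun τ hτ =>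
    Real.exp_le_exp.mpr (by nlinarith)
  set I := γ * (T + 1 / β) + C * γ ^ m / (1 + T) with hI
  have hT0 : 0 < T := by linarith
  have hI0 : 0 ≤ I := by positivity
  have hint : ∫ s in (0 : ℝ)..t, g s ≤ I :=
    integral_le_of_le_majorant h.continuous hγ.le hβ hC.le he2 hT0.le hTt hB
      (fun s hs => (hg s hs.1).2) (fun s hs => hle s ⟨hT0.le.trans hs.1, hs.2⟩)
  set y₂ := C * γ ^ m / (1 + t / 2) ^ e with hy₂
  have hD2 : 0 < (1 + t / 2) ^ e := Real.rpow_pos_of_pos (by linarith) e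
  have hD21 : 1 ≤ (1 + t / 2) ^ e := Real.one_le_rpow (by linarith) (by linarith)
  have hy20 : 0 ≤ y₂ := by positivity
  have hy21 : y₂ ≤ 1 := (div_le_one hD2).mpr (hCγ.trans hD21)
  set y₃ := κ * (C * γ ^ m / (1 + t) ^ e) with hy₃
  have hy30 : 0 ≤ y₃ := by positivity
  have hy31 : y₃ ≤ 1 := mul_le_one₀ hκ1 (by positivity) ((div_le_one hD).mpr (hCγ.trans hD1))
  -- Precollision times fall into three classes. For s ≤ t/2 the average is at most I/(t/2), by the
  -- integral of g. For t/2 < s ≤ t - L the majorant at t/2 bounds it, and the elapsed time gains a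
  -- factor 1/L. For s > t - L there is no gain from the elapsed time, but the average exceeds g(t)
  -- only by a fraction κ of the algebraic part, up to an exponential term.
  have hup := h.upper t ht0.le hist (I / (t / 2)) (γ * a + y₂) (γ * a + y₃) (t / 2) L
    (by positivity) (by positivity) (by positivity) (by linarith) (by linarith) (by
      intro s hs
      have hgt := (hg t ht0.le).1
      by_cases h1 : s ≤ t / 2
      · left
        refine ⟨?_, by linarith⟩
        have h2 : ∫ τ in s..t, g τ ≤ ∫ τ in (0 : ℝ)..t, g τ := by
          rw [← intervalIntegral.integral_add_adjacent_intervals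
            (h.continuous.intervalIntegrable 0 s) (h.continuous.intervalIntegrable s t)]
          have := intervalIntegral.integral_nonneg (μ := volume) hs.1.le
            fun τ (hτ : τ ∈ Icc 0 s) => (hg τ hτ.1).1.le
          linarith
        have h3 : timeAvg g s t ≤ I / (t / 2) := by
          unfold timeAvg
          exact div_le_div₀ hI0 (h2.trans hint) (by linarith) (by linarith)
        linarith
      · push Not at h1
        right
        by_cases h2 : s ≤ t - L
        · left
          refine ⟨?_, by linarith⟩
          have h3 : timeAvg g s t ≤ γ * a + y₂ := by
            refine timeAvg_le h.continuous hs.2 fun τ hτ =>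
              (hle τ ⟨hs.1.le.trans hτ.1, hτ.2⟩).trans ?_
            have hτ2 : t / 2 ≤ τ := h1.le.trans hτ.1
            have := hexp τ hτ2
            have h4 : (1 + t / 2) ^ e ≤ (1 + τ) ^ e :=
              Real.rpow_le_rpow (by linarith) (by linarith) (by linarith)
            simp only [majorant, hy₂]
            gcongr
          linarith
        · right
          push Not at h2
          have h3 : timeAvg g s t ≤ γ * a + C * γ ^ m * ((1 + κ) / (1 + t) ^ e) := by
            refine timeAvg_le h.continuous hs.2 fun τ hτ =>
              (hle τ ⟨hs.1.le.trans hτ.1, hτ.2⟩).trans ?_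
            have := hexp τ (h1.le.trans hτ.1)
            have h4 : (1 + t - L) ^ e ≤ (1 + τ) ^ e :=
              Real.rpow_le_rpow (by linarith) (by linarith [hτ.1]) (by linarith)
            have h5 : 0 < (1 + t - L) ^ e := Real.rpow_pos_of_pos (by linarith) _
            have h6 : 1 / (1 + τ) ^ e ≤ (1 + κ) / (1 + t) ^ e :=
              (one_div_le_one_div_of_le h5 h4).trans (hκ t hTt)
            simp only [majorant]
            rw [div_eq_mul_one_div (C * γ ^ m)]
            gcongr
          -- The contact is used here: subtracting g(t) cancels the main algebraic term and leaves
          -- only the part y₃ with the factor κ.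
          have h4 : C * γ ^ m / (1 + t) ^ e ≤ g t := by
            rw [ht]
            simp only [majorant]
            have : 0 < γ * Real.exp (-B₀ * t) := by positivity
            linarith
          have h5 : C * γ ^ m * ((1 + κ) / (1 + t) ^ e) = C * γ ^ m / (1 + t) ^ e + y₃ := by
            rw [hy₃]; ring
          linarith)
  have ht1 : (I / (t / 2)) ^ m / (t / 2) ^ n ≤ γ ^ m / (1 + t) ^ e *
      (4 ^ e * 2 ^ m * ((T + 1 / β) ^ m + C / (1 + T))) := by
    have h1 : (I / (t / 2)) ^ m / (t / 2) ^ n = I ^ m / (t / 2) ^ e := by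
      rw [Real.div_rpow hI0 (by linarith), he,
        Real.rpow_add (by linarith : 0 < t / 2) n m, Real.rpow_natCast,
        div_div, mul_comm ((t / 2) ^ n)]
    have h2 : I ^ m ≤ 2 ^ m * ((γ * (T + 1 / β)) ^ m + (C * γ ^ m / (1 + T)) ^ m) :=
      add_rpow_le_two_rpow_mul (by positivity) (by positivity) (by linarith)
    have h3 : (C * γ ^ m / (1 + T)) ^ m ≤ C * γ ^ m / (1 + T) :=
      rpow_le_self_of_le_one' (by positivity)
        ((div_le_one (by linarith)).mpr (hCγ.trans (by linarith))) hm1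
    rw [Real.mul_rpow hγ.le (by positivity)] at h2
    have h4 : (1 + t) ^ e ≤ 4 ^ e * (t / 2) ^ e := by
      rw [← Real.mul_rpow (by norm_num) (by linarith)]
      exact Real.rpow_le_rpow (by linarith) (by linarith) (by linarith)
    have h5 : 0 < (t / 2) ^ e := Real.rpow_pos_of_pos (by linarith) _
    have h6 : 1 / (t / 2) ^ e ≤ 4 ^ e / (1 + t) ^ e := by
      rw [div_le_div_iff₀ h5 hD]; linarith
    rw [h1]
    calc I ^ m / (t / 2) ^ e = I ^ m * (1 / (t / 2) ^ e) := by ring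
      _ ≤ (2 ^ m * (γ ^ m * (T + 1 / β) ^ m + C * γ ^ m / (1 + T))) * (4 ^ e / (1 + t) ^ e) := by
        refine mul_le_mul (h2.trans ?_) h6 (by positivity) (by positivity)
        gcongr
      _ = _ := by ring
  have haE : a ≤ E₁ / (1 + t) ^ e := hE t ht0.le
  have hE0 : 0 ≤ E₁ / (1 + t) ^ e := ha0.le.trans haE
  have hE1 : 0 ≤ E₁ := by
    by_contra hneg
    exact absurd hE0 (not_le.mpr (div_neg_of_neg_of_pos (not_le.mp hneg) hD))
  have ht2' : (γ * a + y₂) ^ m / L ^ n ≤ γ ^ m / (1 + t) ^ e *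
      (2 ^ m * (E₁ + 2 ^ e * C) / L) := by
    have h1 := mul_add_rpow_le hγ.le ha0.le ha1 hy20 hy21 hm1
    have h2 : L ≤ L ^ n := le_self_pow₀ hL (by omega)
    have h3 : y₂ ≤ C * γ ^ m * (2 ^ e / (1 + t) ^ e) := by
      rw [hy₂, div_eq_mul_one_div]
      refine mul_le_mul_of_nonneg_left ?_ (by positivity)
      rw [div_le_div_iff₀ hD2 hD, one_mul, ← Real.mul_rpow (by norm_num) (by linarith)]
      exact Real.rpow_le_rpow (by linarith) (by linarith) (by linarith)
    calc (γ * a + y₂) ^ m / L ^ n ≤ (2 ^ m * (γ ^ m * (E₁ / (1 + t) ^ e) +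
          C * γ ^ m * (2 ^ e / (1 + t) ^ e))) / L := by
          refine div_le_div₀ (by positivity) (h1.trans ?_) (by linarith) h2
          gcongr
      _ = _ := by ring
  have ht3 : (γ * a + y₃) ^ m ≤ γ ^ m / (1 + t) ^ e * (2 ^ m * (E₁ + κ * C)) := by
    have h1 := mul_add_rpow_le hγ.le ha0.le ha1 hy30 hy31 hm1
    calc (γ * a + y₃) ^ m ≤ 2 ^ m * (γ ^ m * (E₁ / (1 + t) ^ e) + y₃) := by
          refine h1.trans ?_
          gcongr
      _ = _ := by rw [hy₃]; ring
  calc RR t ≤ _ := hup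
    _ ≤ K * (γ ^ m / (1 + t) ^ e * (4 ^ e * 2 ^ m * ((T + 1 / β) ^ m + C / (1 + T))) +
      γ ^ m / (1 + t) ^ e * (2 ^ m * (E₁ + 2 ^ e * C) / L) +
      γ ^ m / (1 + t) ^ e * (2 ^ m * (E₁ + κ * C))) := by gcongr
    _ = _ := by ring

/-- Bound for the left memory term at a contact with the majorant. -/
theorem MemoryFlow.left_le_of_contact (h : MemoryFlow n p cR K q γb γ Φ g RR RL)
    (hp : 0 ≤ p) (hβ : 0 < β) (hq : q ≤ 3 / 4 * β) (hK : 0 < K) (hγ : 0 < γ) (hγb : γ < γb)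
    (hB : β ≤ B₀) (hg : ∀ t ≥ 0, 0 < g t ∧ g t ≤ γ)
    (hE : ∀ t ≥ 0, Real.exp (-(β / 2 * t)) ≤ E₁ / (1 + t) ^ (n + (p + 1)))
    (hC : 0 < C) {t : ℝ} (ht0 : 0 ≤ t)
    (ht : g t = majorant (n + (p + 1)) (p + 1) γ B₀ C t) :
    -RL t ≤ γ ^ (p + 1) / (1 + t) ^ (n + (p + 1)) *
      (5 / 6 * β * C + K * 10 ^ (p + 1) * E₁) := by
  set m := p + 1 with hm
  set e : ℝ := n + m with he
  have hm1 : 1 ≤ m := by linarith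
  have hγm : 0 < γ ^ m := Real.rpow_pos_of_pos hγ m
  have hist : ∀ s ∈ Icc 0 t, 0 ≤ g s ∧ g s < γb := fun s hs =>
    ⟨(hg s hs.1).1.le, (hg s hs.1).2.trans_lt hγb⟩
  have hD : 0 < (1 + t) ^ e := Real.rpow_pos_of_pos (by linarith) e
  set a := Real.exp (-(β / 2 * t)) with ha
  have ha0 : 0 < a := Real.exp_pos _
  have ha1 : a ≤ 1 := Real.exp_le_one_iff.mpr (by nlinarith)
  have haE : a ≤ E₁ / (1 + t) ^ e := hE t ht0
  have hE0 : 0 ≤ E₁ / (1 + t) ^ e := ha0.le.trans haE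
  have hE1 : 0 ≤ E₁ := by
    by_contra hneg
    exact absurd hE0 (not_le.mpr (div_neg_of_neg_of_pos (not_le.mp hneg) hD))
  obtain ⟨h1, h2⟩ := h.left t ht0 hist (g t) (hg t ht0).1.le ((hg t ht0).2.trans_lt hγb)
    (fun s hs => by
      have h1 := le_timeAvg h.continuous hs.2 (M := 0) fun τ hτ =>
        (hg τ (hs.1.le.trans hτ.1)).1.le
      linarith)
  have hexp : Real.exp (-B₀ * t) ≤ a := Real.exp_le_exp.mpr (by nlinarith)
  set ψ₁ := γ * Real.exp (-B₀ * t) with hψ₁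
  set ψ₂ := C * γ ^ m / (1 + t) ^ e with hψ₂
  have hψ₁0 : 0 < ψ₁ := by positivity
  have hψ₂0 : 0 < ψ₂ := by positivity
  have hgt : g t = ψ₁ + ψ₂ := ht
  have hX : γ ^ m / (1 + t) ^ e * (5 / 6 * β * C + K * 10 ^ m * E₁) =
      5 / 6 * β * ψ₂ + K * 10 ^ m * (γ ^ m * (E₁ / (1 + t) ^ e)) := by rw [hψ₂]; ring
  rw [hX]
  -- If the algebraic part is at least 9 times the exponential one, the linear bound with q
  -- suffices, since 3/4 · 10/9 = 5/6. Otherwise g(t) is at most 10 times an exponential, and the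
  -- superlinear bound gives a term in which C does not occur.
  by_cases hcase : 9 * ψ₁ ≤ ψ₂
  · have h3 : q * g t ≤ 3 / 4 * β * g t := mul_le_mul_of_nonneg_right hq (hg t ht0).1.le
    have h4 : 3 / 4 * β * g t ≤ 5 / 6 * β * ψ₂ := by
      rw [hgt]; nlinarith
    have h5 : 0 ≤ K * 10 ^ m * (γ ^ m * (E₁ / (1 + t) ^ e)) := by positivity
    linarith
  · push Not at hcase
    have h3 : g t ^ m ≤ 10 ^ m * (γ ^ m * (E₁ / (1 + t) ^ e)) := by
      calc g t ^ m ≤ (10 * (γ * a)) ^ m := by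
            refine Real.rpow_le_rpow (hg t ht0).1.le ?_ (by linarith)
            have : ψ₁ ≤ γ * a := by rw [hψ₁]; gcongr
            linarith
        _ = 10 ^ m * (γ ^ m * a ^ m) := by
            rw [Real.mul_rpow (by norm_num) (by positivity), Real.mul_rpow hγ.le ha0.le]
        _ ≤ _ := by
            have := (rpow_le_self_of_le_one' ha0.le ha1 hm1).trans haE
            gcongr
    have h4 : K * g t ^ m ≤ K * (10 ^ m * (γ ^ m * (E₁ / (1 + t) ^ e))) := by gcongr
    have h5 : 0 < 5 / 6 * β * ψ₂ := by positivity
    linarith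

/-- Up to time T the crude bound suffices, because C exceeds 3K/β (1+T)^e. After T, at a first
contact, both memory terms and the loss e/(1+t) from differentiating the power are multiples of
γ^(p+1)/(1+t)^e. By `hsmall` the sum of their coefficients is less than the damping coefficient βC,
so g crosses downwards. -/
theorem MemoryFlow.le_majorant (h : MemoryFlow n p cR K q γb γ Φ g RR RL) (hn : 1 ≤ n)
    (hp : 0 ≤ p) (hβ : 0 < β) (hq : q ≤ 3 / 4 * β) (hK : 0 < K) (hγ : 0 < γ) (hγb : γ < γb)
    (hB : β ≤ B₀) (hg : ∀ t ≥ 0, 0 < g t ∧ g t ≤ γ) (hΦ : ∀ x ∈ Icc 0 γ, B₀ * x ≤ Φ x)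
    (hL : 1 ≤ L) (hTL : 2 * L ≤ T) (hκ0 : 0 ≤ κ) (hκ1 : κ ≤ 1)
    (hκ : ∀ t ≥ T, 1 / (1 + t - L) ^ (n + (p + 1)) ≤ (1 + κ) / (1 + t) ^ (n + (p + 1)))
    (hE : ∀ t ≥ 0, Real.exp (-(β / 2 * t)) ≤ E₁ / (1 + t) ^ (n + (p + 1)))
    (hC : 0 < C) (hCγ : C * γ ^ (p + 1) ≤ 1)
    (hCT : 3 * K / β * (1 + T) ^ (n + (p + 1)) < C)
    (hsmall : K * 4 ^ (n + (p + 1)) * 2 ^ (p + 1) * ((T + 1 / β) ^ (p + 1) + C / (1 + T)) +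
        K * 2 ^ (p + 1) * (E₁ + 2 ^ (n + (p + 1)) * C) / L + K * 2 ^ (p + 1) * (E₁ + κ * C) +
        (5 / 6 * β * C + K * 10 ^ (p + 1) * E₁) + (n + (p + 1)) / (1 + T) * C < β * C) :
    ∀ t ≥ 0, g t ≤ majorant (n + (p + 1)) (p + 1) γ B₀ C t := by
  have hn' : (1 : ℝ) ≤ n := by exact_mod_cast hn
  have hγm : 0 < γ ^ (p + 1) := Real.rpow_pos_of_pos hγ _
  have hT0 : 0 < T := by linarith
  have hearly : ∀ t ∈ Icc 0 T, g t < majorant (n + (p + 1)) (p + 1) γ B₀ C t := by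
    intro t ht
    refine (h.le_exp_add hp hβ hK hγ hγb hB hg hΦ t ht.1).trans_lt ?_
    have ht0 := ht.1
    have h1 : (1 + t) ^ (n + (p + 1)) ≤ (1 + T) ^ (n + (p + 1)) :=
      Real.rpow_le_rpow (by linarith) (by linarith [ht.2]) (by linarith)
    have h2 : 0 < (1 + t) ^ (n + (p + 1)) := Real.rpow_pos_of_pos (by linarith) _
    simp only [majorant]
    gcongr
    rw [lt_div_iff₀ h2]
    calc 3 * K / β * γ ^ (p + 1) * (1 + t) ^ (n + (p + 1))
        ≤ 3 * K / β * γ ^ (p + 1) * (1 + T) ^ (n + (p + 1)) := by gcongr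
      _ = 3 * K / β * (1 + T) ^ (n + (p + 1)) * γ ^ (p + 1) := by ring
      _ < C * γ ^ (p + 1) := by gcongr
  have hlate := barrier (φ := fun t => g t - majorant (n + (p + 1)) (p + 1) γ B₀ C t) (a := T)
    (fun t ht => (h.motion t (by linarith)).sub (hasDerivAt_majorant (by linarith)))
    (by have := hearly T ⟨hT0.le, le_rfl⟩; simpa using this) (by
      intro t ht hpast h0
      have ht0 : 0 < t := by linarith
      have hgt : g t = majorant (n + (p + 1)) (p + 1) γ B₀ C t := by linarith
      have hle : ∀ s ∈ Icc 0 t, g s ≤ majorant (n + (p + 1)) (p + 1) γ B₀ C s := by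
        intro s hs
        rcases le_or_gt s T with h1 | h1
        · exact (hearly s ⟨hs.1, h1⟩).le
        · rcases hs.2.lt_or_eq with h2 | rfl
          · have := hpast s ⟨h1.le, h2⟩
            linarith
          · exact hgt.le
      have hR := h.right_le_of_contact hn hp hβ hK hγ hγb hB hg hL hTL hκ0 hκ1 hκ hE hC hCγ
        ht.le hle hgt
      have hLft := h.left_le_of_contact hp hβ hq hK hγ hγb hB hg hE hC ht0.le hgt
      have h1 := hΦ (g t) ⟨(hg t ht0.le).1.le, (hg t ht0.le).2⟩
      have hD : 0 < (1 + t) ^ (n + (p + 1)) := Real.rpow_pos_of_pos (by linarith) _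
      set X := γ ^ (p + 1) / (1 + t) ^ (n + (p + 1)) with hX
      have hX0 : 0 < X := by positivity
      have h2 : g t = γ * Real.exp (-B₀ * t) + C * X := by
        rw [hgt, hX]; simp only [majorant]; ring
      have h3 : C * γ ^ (p + 1) / (1 + t) ^ (n + (p + 1)) = C * X := by rw [hX]; ring
      have h4 : (n + (p + 1)) / (1 + t) * (C * X) ≤ (n + (p + 1)) / (1 + T) * (C * X) := by
        gcongr
      have h5 := mul_lt_mul_of_pos_left hsmall hX0
      have h6 : β * (C * X) ≤ B₀ * (C * X) := mul_le_mul_of_nonneg_right hB (by positivity)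
      have h7 : B₀ * g t = B₀ * (γ * Real.exp (-B₀ * t)) + B₀ * (C * X) := by rw [h2]; ring
      simp only [h3]
      linarith)
  intro t ht
  rcases le_or_gt t T with h1 | h1
  · exact (hearly t ⟨ht, h1⟩).le
  · have := hlate t h1.le
    linarith

end Flow

/-! ### Lower bound at late times -/

section Flow

variable {n : ℕ} {p cR K q γb γ β B₀ L T κ E₁ C Binf Bbar t₀ c : ℝ} {Φ g RR RL : ℝ → ℝ}

/-- Lower bound for the right memory term at late times. -/
theorem MemoryFlow.right_ge (h : MemoryFlow n p cR K q γb γ Φ g RR RL) (hp : 0 ≤ p)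
    (hcR : 0 < cR) (hγ : 0 < γ) (hγb : γ < γb) (hg : ∀ t ≥ 0, 0 < g t ∧ g t ≤ γ)
    (hexp : ∀ t ≥ 0, γ * Real.exp (-Binf * t) ≤ g t) (hB0 : 0 < Binf) (hB : Binf ≤ Bbar)
    {t : ℝ} (ht : 1 ≤ t) (hgap : g t ≤ γ * Real.exp (-Bbar) / (2 * t)) :
    cR * (Real.exp (-Bbar) / 2) ^ (p + 1) / 2 ^ n * γ ^ (p + 1) * t ^ (-(n + (p + 1))) ≤ RR t := by
  have hist : ∀ s ∈ Icc 0 t, 0 ≤ g s ∧ g s < γb := fun s hs =>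
    ⟨(hg s hs.1).1.le, (hg s hs.1).2.trans_lt hγb⟩
  have ht0 : 0 < t := by linarith
  -- The unit time interval at the start alone contributes this much to the integral of g, by the
  -- exponential lower bound.
  have hI : γ * Real.exp (-Bbar) ≤ ∫ s in (0 : ℝ)..t, g s := by
    rw [← intervalIntegral.integral_add_adjacent_intervals
      (h.continuous.intervalIntegrable 0 1) (h.continuous.intervalIntegrable 1 t)]
    have h1 := intervalIntegral.integral_nonneg (μ := volume) ht
      fun τ (hτ : τ ∈ Icc 1 t) => (hg τ (zero_le_one.trans hτ.1)).1.le
    have h2 : ∫ s in (0 : ℝ)..1, γ * Real.exp (-Bbar) ≤ ∫ s in (0 : ℝ)..1, g s := by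
      refine intervalIntegral.integral_mono_on zero_le_one
        (continuous_const.intervalIntegrable _ _) (h.continuous.intervalIntegrable _ _) ?_
      intro s hs
      refine le_trans ?_ (hexp s hs.1)
      have : Real.exp (-Bbar) ≤ Real.exp (-Binf * s) :=
        Real.exp_le_exp.mpr (by nlinarith [hs.1, hs.2])
      gcongr
    simp at h2
    linarith
  -- By `hgap`, g(t) uses up at most half of the lower bound for the average; `a` is the other half.
  set a := γ * (Real.exp (-Bbar) / 2) / t with ha
  have ha0 : 0 < a := by positivity
  have hA : a ≤ timeAvg g 0 t - g t := by
    have h1 : γ * Real.exp (-Bbar) / t ≤ timeAvg g 0 t := by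
      unfold timeAvg
      rw [sub_zero]
      gcongr
    have h2 : γ * Real.exp (-Bbar) / t = a + γ * Real.exp (-Bbar) / (2 * t) := by
      rw [ha]; field_simp; ring
    linarith
  have hlow := h.lower t ht0 hist (by linarith)
  refine le_trans ?_ hlow
  have h3 : a ^ (p + 1) ≤ (timeAvg g 0 t - g t) ^ (p + 1) :=
    Real.rpow_le_rpow ha0.le hA (by linarith)
  have h4 : (1 + t) ^ n ≤ 2 ^ n * t ^ n := by
    rw [← mul_pow]; gcongr; linarith
  have h5 : a ^ (p + 1) = γ ^ (p + 1) * (Real.exp (-Bbar) / 2) ^ (p + 1) / t ^ (p + 1) := by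
    rw [ha, Real.div_rpow (by positivity) ht0.le, Real.mul_rpow hγ.le (by positivity)]
  have h6 : t ^ (-(n + (p + 1))) = 1 / (t ^ n * t ^ (p + 1)) := by
    rw [Real.rpow_neg ht0.le, Real.rpow_add ht0, Real.rpow_natCast, one_div]
  have h7 : 0 < t ^ (p + 1) := Real.rpow_pos_of_pos ht0 _
  have h8 : 0 ≤ (timeAvg g 0 t - g t) ^ (p + 1) := (Real.rpow_pos_of_pos ha0 _).le.trans h3
  calc _ = cR * a ^ (p + 1) / (2 ^ n * t ^ n) := by rw [h5, h6]; field_simp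
    _ ≤ cR * (timeAvg g 0 t - g t) ^ (p + 1) / (1 + t) ^ n := by gcongr

/-- The subsolution is θγ exp(-B∞ t) + η(t) with η = k t^(-e) (1 - t₀/t). It starts from the
exponential bound, as η(t₀) = 0, and contains the power law after 2t₀. At a contact η' + B∞ η ≤ (1 +
Bbar) k t^(-e), which is less than the right memory by `hc1`. -/
theorem MemoryFlow.tail_le (h : MemoryFlow n p cR K q γb γ Φ g RR RL) (hn : 1 ≤ n) (hp : 0 ≤ p)
    (hcR : 0 < cR) (hγ : 0 < γ) (hγ1 : γ ≤ 1) (hγb : γ < γb)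
    (hg : ∀ t ≥ 0, 0 < g t ∧ g t ≤ γ) (hΦ : ∀ x ∈ Icc 0 γ, Φ x ≤ Binf * x)
    (hexp : ∀ t ≥ 0, γ * Real.exp (-Binf * t) ≤ g t) (hβ : 0 < β) (hβB : β ≤ Binf)
    (hB : Binf ≤ Bbar) (ht₀ : 1 ≤ t₀)
    (hgap : ∀ t ≥ t₀, g t ≤ γ * Real.exp (-Bbar) / (2 * t)) (hc : 0 < c)
    (hc1 : 2 * c * (1 + Bbar) < cR * (Real.exp (-Bbar) / 2) ^ (p + 1) / 2 ^ n)
    (hc2 : 4 * c ≤ β * Real.exp (-(2 * Bbar * t₀))) :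
    ∀ t ≥ 2 * t₀, γ * Real.exp (-Binf * t) + c * γ ^ (p + 1) / t ^ (n + (p + 1)) ≤ g t := by
  have hn' : (1 : ℝ) ≤ n := by exact_mod_cast hn
  have hB0 : 0 < Binf := by linarith
  set e : ℝ := n + (p + 1) with he
  have he2 : 2 ≤ e := by linarith
  have hγp : 0 < γ ^ (p + 1) := Real.rpow_pos_of_pos hγ _
  have hγp1 : γ ^ (p + 1) ≤ γ := rpow_le_self_of_le_one' hγ.le hγ1 (by linarith)
  set k := 2 * c * γ ^ (p + 1) with hk
  have hk0 : 0 < k := by positivity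
  set η : ℝ → ℝ := fun t => k * (t ^ (-e) - t₀ * t ^ (-e - 1)) with hη
  set η' : ℝ → ℝ := fun t => k * (-e * t ^ (-e - 1) - t₀ * ((-e - 1) * t ^ (-e - 1 - 1))) with hη'
  have hdη : ∀ t ≥ t₀, HasDerivAt η (η' t) t := fun t ht => by
    have ht0 : t ≠ 0 := by linarith
    exact ((Real.hasDerivAt_rpow_const (Or.inl ht0)).sub
      ((Real.hasDerivAt_rpow_const (Or.inl ht0)).const_mul t₀)).const_mul k
  have hη'eq : ∀ t ≥ t₀, η' t = k * t ^ (-e - 1) * ((e + 1) * (t₀ / t) - e) := fun t ht => by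
    have ht0 : t ≠ 0 := by linarith
    simp only [hη']
    rw [Real.rpow_sub_one ht0 (-e - 1)]
    field_simp
    ring
  have hpow1 : ∀ t ≥ t₀, t ^ (-e - 1) ≤ t ^ (-e) := fun t ht =>
    Real.rpow_le_rpow_of_exponent_le (by linarith) (by linarith)
  have hpow0 : ∀ t ≥ t₀, 0 < t ^ (-e - 1) := fun t ht => Real.rpow_pos_of_pos (by linarith) _
  have hη'1 : ∀ t ≥ t₀, η' t ≤ k * t ^ (-e) := fun t ht => by
    rw [hη'eq t ht]
    have h1 : t₀ / t ≤ 1 := (div_le_one (by linarith)).mpr ht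
    have h2 : (e + 1) * (t₀ / t) - e ≤ 1 := by nlinarith
    calc k * t ^ (-e - 1) * ((e + 1) * (t₀ / t) - e) ≤ k * t ^ (-e - 1) * 1 := by
          have := hpow0 t ht
          gcongr
      _ ≤ _ := by rw [mul_one]; exact mul_le_mul_of_nonneg_left (hpow1 t ht) hk0.le
  have hη'2 : ∀ t ≥ 2 * t₀, η' t ≤ 0 := fun t ht => by
    rw [hη'eq t (by linarith)]
    have h1 : t₀ / t ≤ 1 / 2 := by rw [div_le_div_iff₀ (by linarith) (by norm_num)]; linarith
    have h2 : (e + 1) * (t₀ / t) - e ≤ 0 := by nlinarith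
    exact mul_nonpos_of_nonneg_of_nonpos
      (mul_nonneg hk0.le (hpow0 t (by linarith)).le) h2
  have main : ∀ θ ∈ Ioo (1 / 2 : ℝ) 1, ∀ t ≥ t₀,
      θ * γ * Real.exp (-Binf * t) + η t < g t := by
    intro θ hθ
    have hθ0 : 0 < θ := by linarith [hθ.1]
    set y : ℝ → ℝ := fun t => θ * γ * Real.exp (-Binf * t) + η t with hy
    have hd : ∀ t ≥ t₀, HasDerivAt y (-Binf * (θ * γ * Real.exp (-Binf * t)) + η' t) t :=
      fun t ht => by
        have h1 : HasDerivAt (fun t => -Binf * t) (-Binf) t := by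
          simpa using (hasDerivAt_id t).const_mul (-Binf)
        exact ((h1.exp.const_mul (θ * γ)).congr_deriv (by ring)).add (hdη t ht)
    -- Monotonicity of the subsolution ensures that at a contact g lies below all its past values on
    -- [t₀, t), so that the left memory vanishes. After 2t₀ both summands decrease. Between t₀ and
    -- 2t₀ the decrease of the exponential outweighs η', which is the role of `hc2` and of θ > 1/2.
    have hanti : AntitoneOn y (Ici t₀) := by
      refine antitoneOn_of_deriv_nonpos (convex_Ici _)
        (fun t ht => (hd t ht).continuousAt.continuousWithinAt)
        (fun t ht => (hd t (interior_subset ht)).differentiableAt.differentiableWithinAt) ?_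
      intro t ht
      have ht' : t₀ ≤ t := interior_subset ht
      rw [(hd t ht').deriv]
      rcases le_or_gt (2 * t₀) t with h1 | h1
      · have := hη'2 t h1
        have : 0 < Binf * (θ * γ * Real.exp (-Binf * t)) := by positivity
        linarith
      · have h2 := hη'1 t ht'
        have h3 : t ^ (-e) ≤ 1 := Real.rpow_le_one_of_one_le_of_nonpos (by linarith) (by linarith)
        have h4 : k * t ^ (-e) ≤ k := mul_le_of_le_one_right hk0.le h3
        have h5 : Real.exp (-(2 * Bbar * t₀)) ≤ Real.exp (-Binf * t) :=
          Real.exp_le_exp.mpr (by nlinarith)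
        have h6 : k ≤ Binf * (θ * γ * Real.exp (-Binf * t)) := by
          calc k ≤ 2 * c * γ := by rw [hk]; gcongr
            _ = 1 / 2 * γ * (4 * c) := by ring
            _ ≤ 1 / 2 * γ * (β * Real.exp (-(2 * Bbar * t₀))) := by gcongr
            _ ≤ θ * γ * (Binf * Real.exp (-Binf * t)) := by
              gcongr
              exact hθ.1.le
            _ = _ := by ring
        linarith
    have hstart : y t₀ < γ * Real.exp (-Binf * t₀) := by
      have h1 : η t₀ = 0 := by
        simp only [hη]
        rw [Real.rpow_sub_one (by linarith)]
        field_simp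
        simp
      simp only [hy, h1, add_zero]
      have := Real.exp_pos (-Binf * t₀)
      nlinarith [mul_pos hγ this, hθ.2]
    have := barrier (φ := fun t => y t - g t) (a := t₀)
      (fun t ht => (hd t ht).sub (h.motion t (by linarith)))
      (by have := hexp t₀ (by linarith); linarith) (by
        intro t ht hpast h0
        have ht1 : 1 ≤ t := by linarith
        have hgt : y t = g t := by linarith
        have hprev : ∀ s ∈ Ico 0 t, g t < g s := by
          intro s hs
          rcases le_or_gt t₀ s with h1 | h1
          · have h2 := hpast s ⟨h1, hs.2⟩
            have h3 := hanti h1 ht.le hs.2.le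
            linarith
          · have h2 := hexp s hs.1
            have h3 : Real.exp (-Binf * t₀) ≤ Real.exp (-Binf * s) :=
              Real.exp_le_exp.mpr (by nlinarith)
            have h4 := hanti (mem_Ici.mpr le_rfl) ht.le ht.le
            have h5 : γ * Real.exp (-Binf * t₀) ≤ γ * Real.exp (-Binf * s) := by gcongr
            linarith
        have hRL : RL t = 0 := h.left_zero t (by linarith)
          (fun s hs => ⟨(hg s hs.1).1.le, (hg s hs.1).2.trans_lt hγb⟩) hprev
        have hRR := h.right_ge hp hcR hγ hγb hg hexp hB0 hB ht1 (hgap t ht.le)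
        have h1 := hΦ (g t) ⟨(hg t (by linarith)).1.le, (hg t (by linarith)).2⟩
        have ht0 : 0 < t := by linarith
        have hte : 0 < t ^ (-e) := Real.rpow_pos_of_pos ht0 _
        have h2 : η t ≤ k * t ^ (-e) := by
          simp only [hη]
          have := hpow0 t ht.le
          have : 0 ≤ t₀ * t ^ (-e - 1) := by positivity
          nlinarith
        have h3 := hη'1 t ht.le
        have h4 : Binf * η t ≤ Bbar * (k * t ^ (-e)) := by
          calc Binf * η t ≤ Binf * (k * t ^ (-e)) := mul_le_mul_of_nonneg_left h2 hB0.le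
            _ ≤ _ := by gcongr
        have h5 : (1 + Bbar) * (k * t ^ (-e)) <
            cR * (Real.exp (-Bbar) / 2) ^ (p + 1) / 2 ^ n * γ ^ (p + 1) * t ^ (-e) := by
          calc (1 + Bbar) * (k * t ^ (-e)) = 2 * c * (1 + Bbar) * (γ ^ (p + 1) * t ^ (-e)) := by
                rw [hk]; ring
            _ < cR * (Real.exp (-Bbar) / 2) ^ (p + 1) / 2 ^ n * (γ ^ (p + 1) * t ^ (-e)) := by
                gcongr
            _ = _ := by ring
        have h6 : Binf * g t = Binf * (θ * γ * Real.exp (-Binf * t)) + Binf * η t := by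
          rw [← hgt]; simp only [hy]; ring
        rw [hRL]
        linarith)
    intro t ht
    have := this t ht
    linarith
  intro t ht
  have ht0 : 0 < t := by linarith
  have hlim : Tendsto (fun θ : ℝ => θ * γ * Real.exp (-Binf * t) + η t) (nhdsWithin 1 (Iio 1))
      (nhds (1 * γ * Real.exp (-Binf * t) + η t)) :=
    (((continuous_id.mul continuous_const).mul continuous_const).add
      continuous_const).continuousAt.tendsto.mono_left nhdsWithin_le_nhds
  rw [one_mul] at hlim
  have h1 : γ * Real.exp (-Binf * t) + η t ≤ g t := by
    refine le_of_tendsto hlim ?_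
    filter_upwards [Ioo_mem_nhdsLT (show (1 / 2 : ℝ) < 1 by norm_num)] with θ hθ
    exact (main θ hθ t (by linarith)).le
  refine le_trans ?_ h1
  have h2 : η t = c * γ ^ (p + 1) / t ^ e * (2 * (1 - t₀ / t)) := by
    simp only [hη, hk]
    rw [Real.rpow_sub_one ht0.ne', Real.rpow_neg ht0.le]
    field_simp
  have h3 : t₀ / t ≤ 1 / 2 := by rw [div_le_div_iff₀ (by linarith) (by norm_num)]; linarith
  have h4 : 0 < c * γ ^ (p + 1) / t ^ e := by
    have := Real.rpow_pos_of_pos ht0 e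
    positivity
  rw [h2]
  have : c * γ ^ (p + 1) / t ^ e * 1 ≤ c * γ ^ (p + 1) / t ^ e * (2 * (1 - t₀ / t)) := by
    gcongr; linarith
  linarith

end Flow

/-! ### Choice of constants and uniform decay -/

theorem exists_shift_rpow_le {L : ℝ} (e : ℝ) {κ : ℝ} (hκ : 0 < κ) :
    ∃ T₀ : ℝ, ∀ T ≥ T₀, 1 / (1 + T - L) ^ e ≤ (1 + κ) / (1 + T) ^ e := by
  have h1 : Tendsto (fun T : ℝ => 1 + T) atTop atTop := tendsto_atTop_add_const_left _ _ tendsto_id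
  have h2 : Tendsto (fun T : ℝ => 1 + T - L) atTop atTop := tendsto_atTop_add_const_right _ _ h1
  have h3 : Tendsto (fun T : ℝ => 1 + L / (1 + T - L)) atTop (nhds (1 + 0)) :=
    (tendsto_const_nhds.div_atTop h2).const_add 1
  have h4 : Tendsto (fun T : ℝ => (1 + L / (1 + T - L)) ^ e) atTop (nhds 1) := by
    have := h3.rpow_const (p := e) (Or.inl (by norm_num))
    simpa using this
  obtain ⟨T₀, hT₀⟩ := eventually_atTop.mp
    ((h4.eventually (gt_mem_nhds (show (1 : ℝ) < 1 + κ by linarith))).and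
      ((h2.eventually_gt_atTop 0).and (h1.eventually_gt_atTop 0)))
  refine ⟨T₀, fun T hT => ?_⟩
  obtain ⟨h5, h6, h7⟩ := hT₀ T hT
  rw [div_le_div_iff₀ (Real.rpow_pos_of_pos h6 e) (Real.rpow_pos_of_pos h7 e), one_mul]
  have h8 : 1 + T = (1 + L / (1 + T - L)) * (1 + T - L) := by field_simp; ring
  have h9 : 0 ≤ 1 + L / (1 + T - L) := by
    have : 1 + L / (1 + T - L) = (1 + T) / (1 + T - L) := by field_simp; ring
    rw [this]; positivity
  calc (1 + T) ^ e = (1 + L / (1 + T - L)) ^ e * (1 + T - L) ^ e := by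
        rw [← Real.mul_rpow h9 h6.le, ← h8]
    _ ≤ _ := by
        have := Real.rpow_pos_of_pos h6 e
        gcongr

/-- The order of choice avoids circularity: L and κ depend on K and β only, T on these, and C on all
of them. The terms in which C has a coefficient are made small by L, κ and T; the remaining ones are
absorbed by a large C. -/
theorem exists_majorant_constants {K β E₁ e m : ℝ} (hK : 0 < K) (hβ : 0 < β) (hE₁ : 0 < E₁) :
    ∃ L T κ C : ℝ, 1 ≤ L ∧ 2 * L ≤ T ∧ 0 < κ ∧ κ ≤ 1 ∧ 0 < C ∧
      (∀ t ≥ T, 1 / (1 + t - L) ^ e ≤ (1 + κ) / (1 + t) ^ e) ∧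
      3 * K / β * (1 + T) ^ e < C ∧
      K * 4 ^ e * 2 ^ m * ((T + 1 / β) ^ m + C / (1 + T)) +
        K * 2 ^ m * (E₁ + 2 ^ e * C) / L + K * 2 ^ m * (E₁ + κ * C) +
        (5 / 6 * β * C + K * 10 ^ m * E₁) + e / (1 + T) * C < β * C := by
  have h2m : (0 : ℝ) < 2 ^ m := Real.rpow_pos_of_pos two_pos _
  obtain ⟨L, hL⟩ : ∃ x : ℝ, x = max 1 (32 * (K * 2 ^ m * 2 ^ e) / β) := ⟨_, rfl⟩
  obtain ⟨κ, hκ⟩ : ∃ x : ℝ, x = min 1 (β / (32 * (K * 2 ^ m))) := ⟨_, rfl⟩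
  have hκ0 : 0 < κ := hκ ▸ lt_min one_pos (by positivity)
  obtain ⟨T₀, hT₀⟩ := exists_shift_rpow_le (L := L) e hκ0
  obtain ⟨T, hT⟩ : ∃ x : ℝ, x = max (max (2 * L) T₀)
    (max (32 * (K * 4 ^ e * 2 ^ m) / β) (32 * e / β)) := ⟨_, rfl⟩
  have hL1 : 1 ≤ L := by rw [hL]; exact le_max_left _ _
  have hTL : 2 * L ≤ T := by
    rw [hT]; exact (le_max_left _ _).trans (le_max_left _ _)
  have hTT₀ : T₀ ≤ T := by
    rw [hT]; exact (le_max_right _ _).trans (le_max_left _ _)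
  have hT1 : 32 * (K * 4 ^ e * 2 ^ m) / β ≤ T := by
    rw [hT]; exact (le_max_left _ _).trans (le_max_right _ _)
  have hT2 : 32 * e / β ≤ T := by
    rw [hT]; exact (le_max_right _ _).trans (le_max_right _ _)
  have hTpos : 0 < T := by linarith
  obtain ⟨A, hA⟩ : ∃ x : ℝ, x = K * 4 ^ e * 2 ^ m * (T + 1 / β) ^ m + K * 2 ^ m * E₁ / L +
    K * 2 ^ m * E₁ + K * 10 ^ m * E₁ := ⟨_, rfl⟩
  have hA0 : 0 < A := by rw [hA]; positivity
  obtain ⟨C, hC⟩ : ∃ x : ℝ, x = max (3 * K / β * (1 + T) ^ e + 1) (48 * A / β) := ⟨_, rfl⟩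
  have hC0 : 0 < C := by
    rw [hC]; exact lt_of_lt_of_le (by positivity) (le_max_right _ _)
  have hCT : 3 * K / β * (1 + T) ^ e < C := by
    rw [hC]; exact lt_of_lt_of_le (lt_add_one _) (le_max_left _ _)
  have hCA : A < β / 24 * C := by
    have : 48 * A / β ≤ C := by rw [hC]; exact le_max_right _ _
    rw [div_le_iff₀ hβ] at this
    linarith
  have hc1 : K * 4 ^ e * 2 ^ m / (1 + T) ≤ β / 32 := by
    rw [div_le_iff₀ hβ] at hT1
    rw [div_le_div_iff₀ (by linarith) (by norm_num)]
    linarith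
  have hc2 : K * 2 ^ m * 2 ^ e / L ≤ β / 32 := by
    have : 32 * (K * 2 ^ m * 2 ^ e) / β ≤ L := by rw [hL]; exact le_max_right _ _
    rw [div_le_iff₀ hβ] at this
    rw [div_le_div_iff₀ (by linarith) (by norm_num)]
    linarith
  have hc3 : K * 2 ^ m * κ ≤ β / 32 := by
    have : κ ≤ β / (32 * (K * 2 ^ m)) := by rw [hκ]; exact min_le_right _ _
    rw [le_div_iff₀ (by positivity)] at this
    linarith
  have hc4 : e / (1 + T) ≤ β / 32 := by
    rw [div_le_iff₀ hβ] at hT2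
    rw [div_le_div_iff₀ (by linarith) (by norm_num)]
    linarith
  -- The left end takes 5/6 of βC, the four small coefficients at most 4/32, and the terms free of C
  -- less than 1/24; together less than 5/6 + 1/8 + 1/24 = 1.
  have hsmall : K * 4 ^ e * 2 ^ m * ((T + 1 / β) ^ m + C / (1 + T)) +
        K * 2 ^ m * (E₁ + 2 ^ e * C) / L + K * 2 ^ m * (E₁ + κ * C) +
        (5 / 6 * β * C + K * 10 ^ m * E₁) + e / (1 + T) * C < β * C := by
    have h1 : K * 4 ^ e * 2 ^ m * ((T + 1 / β) ^ m + C / (1 + T)) +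
        K * 2 ^ m * (E₁ + 2 ^ e * C) / L + K * 2 ^ m * (E₁ + κ * C) +
        (5 / 6 * β * C + K * 10 ^ m * E₁) + e / (1 + T) * C =
        A + (K * 4 ^ e * 2 ^ m / (1 + T)) * C + (K * 2 ^ m * 2 ^ e / L) * C +
        (K * 2 ^ m * κ) * C + (e / (1 + T)) * C + 5 / 6 * β * C := by
      rw [hA]; ring
    rw [h1]
    have := mul_le_mul_of_nonneg_right hc1 hC0.le
    have := mul_le_mul_of_nonneg_right hc2 hC0.le
    have := mul_le_mul_of_nonneg_right hc3 hC0.le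
    have := mul_le_mul_of_nonneg_right hc4 hC0.le
    linarith
  exact ⟨L, T, κ, C, hL1, hTL, hκ0, by rw [hκ]; exact min_le_left _ _, hC0,
    fun t ht => hT₀ t (hTT₀.trans ht), hCT, hsmall⟩

/-- Uniform two-sided decay for all flows with the same memory constants. -/
theorem exists_decay_constants {n : ℕ} {p cR K q γb β Bbar : ℝ} (hn : 1 ≤ n) (hp : 0 ≤ p)
    (hcR : 0 < cR) (hK : 0 < K) (hγb : 0 < γb) (hβ : 0 < β) (hq : q ≤ 3 / 4 * β) :
    ∃ γ₁ c C t₀ : ℝ, 0 < γ₁ ∧ γ₁ ≤ γb ∧ 0 < c ∧ 0 < C ∧ 1 ≤ t₀ ∧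
      ∀ γ : ℝ, 0 < γ → γ < γ₁ → ∀ (B₀ Binf : ℝ) (Φ g RR RL : ℝ → ℝ),
        β ≤ B₀ → B₀ ≤ Binf → Binf ≤ Bbar → Φ 0 = 0 → (∀ x ∈ Ico 0 γb, β * x ≤ Φ x) →
        (∀ x ∈ Icc 0 γ, B₀ * x ≤ Φ x ∧ Φ x ≤ Binf * x) →
        MemoryFlow n p cR K q γb γ Φ g RR RL → ∀ t ≥ 0,
          (γ * Real.exp (-Binf * t) ≤ g t ∧
            (2 * t₀ ≤ t →
              γ * Real.exp (-Binf * t) + c * γ ^ (p + 1) / t ^ (n + (p + 1)) ≤ g t)) ∧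
          g t ≤ γ * Real.exp (-B₀ * t) + C * γ ^ (p + 1) / (1 + t) ^ (n + (p + 1)) := by
  have hn' : (1 : ℝ) ≤ n := by exact_mod_cast hn
  set e : ℝ := n + (p + 1) with he
  have he2 : 2 ≤ e := by linarith
  obtain ⟨E₁, hE₁, hE⟩ := exists_exp_neg_le_div_rpow (half_pos hβ) e
  obtain ⟨L, T, κ, C, hL1, hTL, hκ0, hκ1, hC0, hκT, hCT, hsmall⟩ :=
    exists_majorant_constants (e := e) (m := p + 1) hK hβ hE₁
  -- After t₀ the upper bound, which decays at least like t^(-2), is below half of the lower bound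
  -- for the time average of g, of order 1/t. Both are proportional to γ, so t₀ does not depend on
  -- γ.
  obtain ⟨t₀, ht₀1, ht₀⟩ : ∃ t₀ : ℝ, 1 ≤ t₀ ∧ ∀ t ≥ t₀,
      E₁ / (1 + t) ^ e + C / (1 + t) ^ e ≤ Real.exp (-Bbar) / (2 * t) := by
    refine ⟨max 1 ((E₁ + C) * 2 / Real.exp (-Bbar)), le_max_left _ _, fun t ht => ?_⟩
    have h1 : 1 ≤ t := (le_max_left _ _).trans ht
    have h2 : (E₁ + C) * 2 / Real.exp (-Bbar) ≤ t := (le_max_right _ _).trans ht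
    rw [div_le_iff₀ (Real.exp_pos _)] at h2
    have h3 : t * t ≤ (1 + t) ^ e := by
      calc t * t ≤ (1 + t) ^ (2 : ℝ) := by rw [Real.rpow_two]; nlinarith
        _ ≤ _ := Real.rpow_le_rpow_of_exponent_le (by linarith) he2
    rw [← add_div, div_le_div_iff₀ (Real.rpow_pos_of_pos (by linarith) _) (by linarith)]
    calc (E₁ + C) * (2 * t) = (E₁ + C) * 2 * t := by ring
      _ ≤ t * Real.exp (-Bbar) * t := by gcongr
      _ = Real.exp (-Bbar) * (t * t) := by ring
      _ ≤ _ := by gcongr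
  -- The sign of `Bbar` is not known here; `B'` keeps the denominator in the choice of c positive.
  obtain ⟨B', hB'⟩ : ∃ x : ℝ, x = max Bbar 0 := ⟨_, rfl⟩
  have hcl : 0 < cR * (Real.exp (-Bbar) / 2) ^ (p + 1) / 2 ^ n := by positivity
  obtain ⟨c, hc⟩ : ∃ x : ℝ, x = min (cR * (Real.exp (-Bbar) / 2) ^ (p + 1) / 2 ^ n / (4 * (1 + B')))
    (β * Real.exp (-(2 * Bbar * t₀)) / 4) := ⟨_, rfl⟩
  have hB'0 : 0 ≤ B' := by rw [hB']; exact le_max_right _ _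
  have hc0 : 0 < c := hc ▸ lt_min (by positivity) (by positivity)
  have hcA : 2 * c * (1 + Bbar) < cR * (Real.exp (-Bbar) / 2) ^ (p + 1) / 2 ^ n := by
    have h1 := hc.le.trans (min_le_left _ _)
    rw [le_div_iff₀ (by positivity)] at h1
    have h2 : Bbar ≤ B' := by rw [hB']; exact le_max_left _ _
    have h3 : c * (1 + Bbar) ≤ c * (1 + B') := by gcongr
    linarith
  have hcB : 4 * c ≤ β * Real.exp (-(2 * Bbar * t₀)) := by
    have h1 := hc.le.trans (min_le_right _ _)
    linarith
  -- The bounds γ ≤ 1 and γ ≤ 1/C give γ^(p+1) ≤ γ and C γ^(p+1) ≤ 1, as needed for dropping powers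
  -- of the algebraic part.
  refine ⟨min γb (min 1 (1 / C)), c, C, t₀, lt_min hγb (lt_min one_pos (by positivity)),
    min_le_left _ _, hc0, hC0, ht₀1, ?_⟩
  intro γ hγ hγ1 B₀ Binf Φ g RR RL hB hBB hBinf hΦ0 hΦ hΦγ h t ht
  have hγγb : γ < γb := hγ1.trans_le (min_le_left _ _)
  have hγle : γ ≤ 1 := (hγ1.trans_le ((min_le_right _ _).trans (min_le_left _ _))).le
  have hγC : γ ≤ 1 / C := (hγ1.trans_le ((min_le_right _ _).trans (min_le_right _ _))).le
  have hγp1 : γ ^ (p + 1) ≤ γ := rpow_le_self_of_le_one' hγ.le hγle (by linarith)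
  have hCγ : C * γ ^ (p + 1) ≤ 1 := by
    rw [le_div_iff₀ hC0] at hγC
    nlinarith
  have hqβ : q < β := by linarith
  have hg := h.pos_le hp hcR hqβ hγ hγγb hΦ0 hΦ
  have hexp := h.exp_le hcR hγ hγγb (by linarith : 0 < Binf) hg fun x hx => (hΦγ x hx).2
  have hup := h.le_majorant hn hp hβ hq hK hγ hγγb hB hg (fun x hx => (hΦγ x hx).1) hL1 hTL
    hκ0.le hκ1 hκT hE hC0 hCγ hCT hsmall
  refine ⟨⟨hexp t ht, ?_⟩, hup t ht⟩
  refine h.tail_le hn hp hcR hγ hγle hγγb hg (fun x hx => (hΦγ x hx).2) hexp hβ (hB.trans hBB)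
    hBinf ht₀1 ?_ hc0 hcA hcB t
  intro s hs
  have hs0 : 0 ≤ s := by linarith
  have h1 := ht₀ s hs
  have h2 := hE s hs0
  have h3 : Real.exp (-B₀ * s) ≤ Real.exp (-(β / 2 * s)) := Real.exp_le_exp.mpr (by nlinarith)
  have hD : 0 < (1 + s) ^ e := Real.rpow_pos_of_pos (by linarith) _
  calc g s ≤ γ * Real.exp (-B₀ * s) + C * γ ^ (p + 1) / (1 + s) ^ e := hup s hs0
    _ ≤ γ * (E₁ / (1 + s) ^ e) + C * γ / (1 + s) ^ e := by
        gcongr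
        exact h3.trans h2
    _ = γ * (E₁ / (1 + s) ^ e + C / (1 + s) ^ e) := by ring
    _ ≤ γ * (Real.exp (-Bbar) / (2 * s)) := by gcongr
    _ = _ := by ring

/-! ### Differentiability of the pressure difference -/

section Pressure

variable {l a g : ℝ → ℝ} {V₁ γ₀ l₀ : ℝ}

/-- The derivative of the pressure difference `∫_{w<0} l(w) (a(w+V) - a(w-V)) dw`. -/
def pressureDeriv (l a : ℝ → ℝ) (l₀ V : ℝ) : ℝ :=
  2 * l₀ * a V - ∫ w in Iio (0 : ℝ), deriv l w * (a (w + V) + a (w - V))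

theorem abs_mul_sum_le (ha0 : ∀ v, 0 ≤ a v) (hl0 : ∀ w < 0, 0 ≤ l w)
    (hdom : ∀ V, |V - V₁| ≤ γ₀ → ∀ w < 0,
      (l w + |deriv l w|) * (a (w + V) + a (w - V)) ≤ g w)
    {V : ℝ} (hV : |V - V₁| ≤ γ₀) {w : ℝ} (hw : w < 0) :
    l w * (a (w + V) + a (w - V)) ≤ g w ∧ |deriv l w| * (a (w + V) + a (w - V)) ≤ g w := by
  have h1 := hdom V hV w hw
  have h2 : 0 ≤ a (w + V) + a (w - V) := add_nonneg (ha0 _) (ha0 _)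
  have h3 := mul_nonneg (hl0 w hw) h2
  have h4 := mul_nonneg (abs_nonneg (deriv l w)) h2
  constructor <;> linarith [add_mul (l w) |deriv l w| (a (w + V) + a (w - V))]

theorem continuousOn_of_hasDerivAt_Iio (hl : ∀ w < 0, DifferentiableAt ℝ l w) :
    ContinuousOn l (Iio 0) := fun w hw => (hl w hw).continuousAt.continuousWithinAt

theorem integrableOn_pressure (ha : Continuous a) (ha0 : ∀ v, 0 ≤ a v)
    (hl : ∀ w < 0, DifferentiableAt ℝ l w) (hl0 : ∀ w < 0, 0 ≤ l w)
    (hg : IntegrableOn g (Iio 0))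
    (hdom : ∀ V, |V - V₁| ≤ γ₀ → ∀ w < 0,
      (l w + |deriv l w|) * (a (w + V) + a (w - V)) ≤ g w)
    {V : ℝ} (hV : |V - V₁| ≤ γ₀) :
    IntegrableOn (fun w => l w * a (w + V)) (Iio 0) ∧
      IntegrableOn (fun w => l w * a (w - V)) (Iio 0) := by
  have hlc := continuousOn_of_hasDerivAt_Iio hl
  constructor
  · refine Integrable.mono' hg ((hlc.mul (by fun_prop)).aestronglyMeasurable measurableSet_Iio) ?_
    filter_upwards [ae_restrict_mem measurableSet_Iio] with w hw
    have h1 := (abs_mul_sum_le ha0 hl0 hdom hV hw).1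
    rw [Real.norm_of_nonneg (mul_nonneg (hl0 w hw) (ha0 _))]
    nlinarith [mul_nonneg (hl0 w hw) (ha0 (w - V))]
  · refine Integrable.mono' hg ((hlc.mul (by fun_prop)).aestronglyMeasurable measurableSet_Iio) ?_
    filter_upwards [ae_restrict_mem measurableSet_Iio] with w hw
    have h1 := (abs_mul_sum_le ha0 hl0 hdom hV hw).1
    rw [Real.norm_of_nonneg (mul_nonneg (hl0 w hw) (ha0 _))]
    nlinarith [mul_nonneg (hl0 w hw) (ha0 (w + V))]

/-- Since a is merely continuous, the V-derivative cannot fall on it under the integral. The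
increment of a(w+V) - a(w-V) from V₁ to V is the w-derivative of N, so an integration by parts moves
the derivative to l. The remaining integral of l' N may be differentiated in V under the integral
sign, and the boundary value at w = 0 gives the term with l₀. -/
theorem hasDerivAt_pressure (ha : Continuous a) (ha0 : ∀ v, 0 ≤ a v) (heven : ∀ v, a (-v) = a v)
    (hl : ∀ w < 0, DifferentiableAt ℝ l w) (hl' : ContinuousOn (deriv l) (Iio 0))
    (hl0 : ∀ w < 0, 0 ≤ l w) (hlim : Tendsto l (nhdsWithin 0 (Iio 0)) (nhds l₀))
    (hγ₀ : 0 < γ₀) (hg : IntegrableOn g (Iio 0))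
    (hdom : ∀ V, |V - V₁| ≤ γ₀ → ∀ w < 0,
      (l w + |deriv l w|) * (a (w + V) + a (w - V)) ≤ g w)
    {V : ℝ} (hV : |V - V₁| < γ₀) :
    HasDerivAt (fun V => ∫ w in Iio (0 : ℝ), l w * (a (w + V) - a (w - V)))
      (pressureDeriv l a l₀ V) V := by
  have hlc := continuousOn_of_hasDerivAt_Iio hl
  -- `N V w` is the integral of `a (w + η) + a (w - η)` over `η` between `V₁` and `V`
  set N : ℝ → ℝ → ℝ := fun V w => ∫ η in V₁..V, (a (w + η) + a (w - η)) with hN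
  set A : ℝ → ℝ := fun x => ∫ y in (0 : ℝ)..x, a y with hA
  have hAd : ∀ x, HasDerivAt A (a x) x := fun x =>
    intervalIntegral.integral_hasDerivAt_right (ha.intervalIntegrable _ _)
      (ha.stronglyMeasurableAtFilter _ _) ha.continuousAt
  have hNA : ∀ V w, N V w = A (w + V) - A (w + V₁) - (A (w - V) - A (w - V₁)) := by
    intro V w
    have h1 : ∀ η ∈ uIcc V₁ V, HasDerivAt (fun η => A (w + η) - A (w - η))
        (a (w + η) + a (w - η)) η := fun η _ => by
      have h2 : HasDerivAt (fun η => A (w + η)) (a (w + η)) η := (hAd _).comp_const_add w η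
      have h3 : HasDerivAt (fun η => A (w - η)) (-a (w - η)) η := (hAd _).comp_const_sub w η
      exact (h2.sub h3).congr_deriv (by ring)
    simp only [hN]
    rw [intervalIntegral.integral_eq_sub_of_hasDerivAt h1
      (Continuous.intervalIntegrable (by fun_prop) _ _)]
    ring
  have hNd : ∀ V w, HasDerivAt (N V) (a (w + V) - a (w + V₁) - (a (w - V) - a (w - V₁))) w := by
    intro V w
    have : N V = fun w => A (w + V) - A (w + V₁) - (A (w - V) - A (w - V₁)) := funext (hNA V)
    rw [this]
    exact (((hAd _).comp_add_const w V).sub ((hAd _).comp_add_const w V₁)).sub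
      (((hAd _).comp_sub_const w V).sub ((hAd _).comp_sub_const w V₁))
  have hNc : ∀ V, Continuous (N V) := fun V =>
    continuous_iff_continuousAt.mpr fun w => (hNd V w).continuousAt
  have hNV : ∀ V w, HasDerivAt (fun V => N V w) (a (w + V) + a (w - V)) V := fun V w =>
    intervalIntegral.integral_hasDerivAt_right (Continuous.intervalIntegrable (by fun_prop) _ _)
      (Continuous.stronglyMeasurableAtFilter (by fun_prop) _ _)
      (Continuous.continuousAt (by fun_prop))
  have hmid : ∀ V, |V - V₁| ≤ γ₀ → ∀ η ∈ uIoc V₁ V, |η - V₁| ≤ γ₀ := by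
    intro V hV η hη
    rw [uIoc_eq_union] at hη
    rw [abs_le] at hV ⊢
    rcases hη with hη | hη <;> constructor <;> linarith [hη.1, hη.2, hV.1, hV.2]
  have hlN : ∀ V, |V - V₁| ≤ γ₀ → ∀ w < 0, ‖l w * N V w‖ ≤ g w * |V - V₁| ∧
      ‖deriv l w * N V w‖ ≤ g w * |V - V₁| := by
    intro V hV w hw
    simp only [hN]
    rw [← intervalIntegral.integral_const_mul, ← intervalIntegral.integral_const_mul]
    constructor
    · refine intervalIntegral.norm_integral_le_of_norm_le_const fun η hη => ?_
      have h1 := (abs_mul_sum_le ha0 hl0 hdom (hmid V hV η hη) hw).1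
      rwa [Real.norm_of_nonneg (mul_nonneg (hl0 w hw) (add_nonneg (ha0 _) (ha0 _)))]
    · refine intervalIntegral.norm_integral_le_of_norm_le_const fun η hη => ?_
      have h1 := (abs_mul_sum_le ha0 hl0 hdom (hmid V hV η hη) hw).2
      rwa [norm_mul, Real.norm_eq_abs, Real.norm_of_nonneg (add_nonneg (ha0 _) (ha0 _))]
  have hlNi : ∀ V, |V - V₁| ≤ γ₀ → IntegrableOn (fun w => l w * N V w) (Iio 0) := by
    intro V hV
    refine Integrable.mono' (hg.mul_const |V - V₁|)
      ((hlc.mul (hNc V).continuousOn).aestronglyMeasurable measurableSet_Iio) ?_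
    filter_upwards [ae_restrict_mem measurableSet_Iio] with w hw using (hlN V hV w hw).1
  have hl'Ni : ∀ V, |V - V₁| ≤ γ₀ → IntegrableOn (fun w => deriv l w * N V w) (Iio 0) := by
    intro V hV
    refine Integrable.mono' (hg.mul_const |V - V₁|)
      ((hl'.mul (hNc V).continuousOn).aestronglyMeasurable measurableSet_Iio) ?_
    filter_upwards [ae_restrict_mem measurableSet_Iio] with w hw using (hlN V hV w hw).2
  have hV₁ : |V₁ - V₁| ≤ γ₀ := by simp [hγ₀.le]
  have hparts : ∀ V, |V - V₁| ≤ γ₀ →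
      ∫ w in Iio (0 : ℝ), l w * (a (w + V) - a (w - V)) =
        (∫ w in Iio (0 : ℝ), l w * (a (w + V₁) - a (w - V₁))) +
          (2 * l₀ * (A V - A V₁) - ∫ w in Iio (0 : ℝ), deriv l w * N V w) := by
    intro V hV
    obtain ⟨i1, i2⟩ := integrableOn_pressure ha ha0 hl hl0 hg hdom hV
    obtain ⟨i3, i4⟩ := integrableOn_pressure ha ha0 hl hl0 hg hdom hV₁
    have hint : IntegrableOn
        (fun w => l w * (a (w + V) - a (w + V₁) - (a (w - V) - a (w - V₁)))) (Iio 0) := by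
      refine ((i1.sub i3).sub (i2.sub i4)).congr ?_
      filter_upwards with w
      simp only [Pi.sub_apply]; ring
    have hz : Tendsto (l * N V) (nhdsWithin 0 (Iio 0)) (nhds (l₀ * (2 * (A V - A V₁)))) := by
      have h1 : N V 0 = 2 * (A V - A V₁) := by
        have h2 : ∀ x, A (-x) = - A x := fun x => by
          simp only [hA]
          have := intervalIntegral.integral_comp_neg (a := 0) (b := x) a
          rw [neg_zero] at this
          rw [intervalIntegral.integral_symm, ← this]
          simp [heven]
        rw [hNA]
        simp only [zero_add, zero_sub, h2]
        ring
      rw [← h1]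
      exact hlim.mul ((hNc V).continuousAt.tendsto.mono_left nhdsWithin_le_nhds)
    -- The product and its derivative are both integrable near -∞, so it tends to zero there.
    have hinf : Tendsto (l * N V) atBot (nhds 0) := by
      refine tendsto_zero_of_hasDerivAt_of_integrableOn_Iic (a := -1)
        (f' := fun w => deriv l w * N V w +
          l w * (a (w + V) - a (w + V₁) - (a (w - V) - a (w - V₁)))) ?_ ?_ ?_
      · intro w hw
        have hw0 : w < 0 := lt_of_le_of_lt hw (by norm_num)
        exact (hl w hw0).hasDerivAt.mul (hNd V w)
      · exact ((hl'Ni V hV).add hint).mono_set (Iic_subset_Iio.mpr (by norm_num))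
      · exact (hlNi V hV).mono_set (Iic_subset_Iio.mpr (by norm_num))
    have := integral_Iic_mul_deriv_eq_deriv_mul (a := 0) (u := l) (v := N V)
      (fun w hw => (hl w hw).hasDerivAt) (fun w _ => hNd V w)
      (hint.congr_set_ae Iio_ae_eq_Iic.symm)
      ((hl'Ni V hV).congr_set_ae Iio_ae_eq_Iic.symm) hz hinf
    rw [integral_Iic_eq_integral_Iio, integral_Iic_eq_integral_Iio] at this
    have h5 : (∫ w in Iio (0 : ℝ), l w * (a (w + V) - a (w - V))) -
        (∫ w in Iio (0 : ℝ), l w * (a (w + V₁) - a (w - V₁))) =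
        ∫ w in Iio (0 : ℝ), l w * (a (w + V) - a (w + V₁) - (a (w - V) - a (w - V₁))) := by
      rw [← integral_sub]
      · refine integral_congr_ae ?_
        filter_upwards with w
        ring
      · refine (i1.sub i2).congr ?_
        filter_upwards with w
        simp only [Pi.sub_apply]; ring
      · refine (i3.sub i4).congr ?_
        filter_upwards with w
        simp only [Pi.sub_apply]; ring
    rw [this] at h5
    linarith
  have hball : ∀ W ∈ Metric.ball V₁ γ₀, |W - V₁| ≤ γ₀ := fun W hW => by
    rw [Metric.mem_ball, Real.dist_eq] at hW
    exact hW.le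
  have hVball : Metric.ball V₁ γ₀ ∈ nhds V := Metric.isOpen_ball.mem_nhds (by
    rw [Metric.mem_ball, Real.dist_eq]; exact hV)
  have hpar := (hasDerivAt_integral_of_dominated_loc_of_deriv_le (μ := volume.restrict (Iio 0))
    (F := fun V w => deriv l w * N V w) (F' := fun V w => deriv l w * (a (w + V) + a (w - V)))
    (bound := g) hVball
    (by
      filter_upwards [hVball] with W hW
      exact (hl'Ni W (hball W hW)).aestronglyMeasurable)
    (hl'Ni V hV.le)
    ((hl'.mul (by fun_prop)).aestronglyMeasurable measurableSet_Iio)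
    (by
      filter_upwards [ae_restrict_mem measurableSet_Iio] with w hw W hW
      rw [norm_mul, Real.norm_eq_abs, Real.norm_of_nonneg (add_nonneg (ha0 _) (ha0 _))]
      exact (abs_mul_sum_le ha0 hl0 hdom (hball W hW) hw).2)
    hg
    (by
      filter_upwards with w W _
      exact (hNV W w).const_mul _)).2
  have hfin : HasDerivAt (fun V => (∫ w in Iio (0 : ℝ), l w * (a (w + V₁) - a (w - V₁))) +
      (2 * l₀ * (A V - A V₁) - ∫ w in Iio (0 : ℝ), deriv l w * N V w))
      (pressureDeriv l a l₀ V) V :=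
    ((((hAd V).sub_const _).const_mul (2 * l₀)).sub hpar).const_add _
  refine hfin.congr_of_eventuallyEq ?_
  filter_upwards [hVball] with W hW
  exact hparts W (hball W hW)

theorem continuousOn_pressureDeriv (ha : Continuous a) (ha0 : ∀ v, 0 ≤ a v)
    (hl' : ContinuousOn (deriv l) (Iio 0)) (hl0 : ∀ w < 0, 0 ≤ l w)
    (hg : IntegrableOn g (Iio 0))
    (hdom : ∀ V, |V - V₁| ≤ γ₀ → ∀ w < 0,
      (l w + |deriv l w|) * (a (w + V) + a (w - V)) ≤ g w) :
    ContinuousOn (pressureDeriv l a l₀) {V | |V - V₁| ≤ γ₀} := by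
  refine ContinuousOn.sub (by fun_prop) (continuousOn_of_dominated (bound := g) ?_ ?_ hg ?_)
  · intro V _
    exact (hl'.mul (by fun_prop)).aestronglyMeasurable measurableSet_Iio
  · intro V hV
    filter_upwards [ae_restrict_mem measurableSet_Iio] with w hw
    rw [norm_mul, Real.norm_eq_abs, Real.norm_of_nonneg (add_nonneg (ha0 _) (ha0 _))]
    exact (abs_mul_sum_le ha0 hl0 hdom hV hw).2
  · filter_upwards with w
    fun_prop

/-- The remainder is the integral of -l' (a(w+V) + a(w-V)), whose integrand is nonnegative and
positive on a nonempty open set. The strict inequality leaves room between the slope of F₀ and the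
pressure that can be missing behind the body. -/
theorem lt_pressureDeriv (ha : Continuous a) (ha0 : ∀ v, 0 ≤ a v) (heven : ∀ v, a (-v) = a v)
    (hapos : ∃ v, a v ≠ 0)
    (hl' : ContinuousOn (deriv l) (Iio 0)) (hlneg : ∀ w < 0, deriv l w < 0)
    (hl0 : ∀ w < 0, 0 ≤ l w) (hg : IntegrableOn g (Iio 0))
    (hdom : ∀ V, |V - V₁| ≤ γ₀ → ∀ w < 0,
      (l w + |deriv l w|) * (a (w + V) + a (w - V)) ≤ g w)
    {V : ℝ} (hV : |V - V₁| ≤ γ₀) :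
    2 * l₀ * a V < pressureDeriv l a l₀ V := by
  have hint : IntegrableOn (fun w => -(deriv l w * (a (w + V) + a (w - V)))) (Iio 0) := by
    refine Integrable.mono' hg
      ((hl'.mul (by fun_prop)).neg.aestronglyMeasurable measurableSet_Iio) ?_
    filter_upwards [ae_restrict_mem measurableSet_Iio] with w hw
    rw [norm_neg, norm_mul, Real.norm_eq_abs, Real.norm_of_nonneg (add_nonneg (ha0 _) (ha0 _))]
    exact (abs_mul_sum_le ha0 hl0 hdom hV hw).2
  have hpos : 0 < ∫ w in Iio (0 : ℝ), -(deriv l w * (a (w + V) + a (w - V))) := by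
    rw [setIntegral_pos_iff_support_of_nonneg_ae _ hint]
    · set S : Set ℝ := Iio 0 ∩ {w | 0 < a (w + V) + a (w - V)} with hS
      have hSo : IsOpen S := isOpen_Iio.inter (isOpen_lt continuous_const (by fun_prop))
      -- A nonzero point of positivity is needed to get w = -|x| - |V| < 0 also for V = 0; one of w
      -- + V and w - V is then -|x|.
      obtain ⟨x, hx0, hx⟩ : ∃ x, x ≠ 0 ∧ 0 < a x := by
        obtain ⟨v, hv⟩ := hapos
        have hv' : 0 < a v := lt_of_le_of_ne (ha0 v) (Ne.symm hv)
        have h1 : ∀ᶠ x in nhdsWithin v {v}ᶜ, 0 < a x :=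
          (ha.continuousAt.eventually (lt_mem_nhds hv')).filter_mono nhdsWithin_le_nhds
        by_cases h0 : v = 0
        · subst h0
          obtain ⟨x, hx, hx'⟩ := (h1.and self_mem_nhdsWithin).exists
          exact ⟨x, hx', hx⟩
        · exact ⟨v, h0, hv'⟩
      have hx' : 0 < a (-|x|) := by
        rcases abs_cases x with h | h <;> rw [h.1] <;> simp [heven, hx]
      have hSne : S.Nonempty := by
        refine ⟨-|x| - |V|, ?_, ?_⟩
        · have := abs_pos.mpr hx0
          have := abs_nonneg V
          simp only [mem_Iio]
          linarith
        · simp only [mem_ofPred_eq]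
          rcases abs_cases V with h | h <;> rw [h.1]
          · rw [sub_add_cancel]
            have := ha0 (-|x| - V - V)
            linarith
          · rw [sub_neg_eq_add, add_sub_cancel_right]
            have := ha0 (-|x| + V + V)
            linarith
      refine lt_of_lt_of_le (hSo.measure_pos volume hSne) (measure_mono ?_)
      intro w hw
      refine ⟨?_, hw.1⟩
      have h1 := hlneg w hw.1
      have h2 : 0 < a (w + V) + a (w - V) := hw.2
      exact neg_ne_zero.mpr (mul_neg_of_neg_of_pos h1 h2).ne
    · filter_upwards [ae_restrict_mem measurableSet_Iio] with w hw
      have h1 := hlneg w hw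
      have h2 := add_nonneg (ha0 (w + V)) (ha0 (w - V))
      simp only [Pi.zero_apply]
      nlinarith
  rw [integral_neg] at hpos
  unfold pressureDeriv
  linarith

end Pressure

/-! ### One-dimensional form of the end pressure and consequences of the assumptions -/

theorem setIntegral_Iic_sub (h : ℝ → ℝ → ℝ) (V : ℝ) :
    ∫ v in Iic V, h (v - V) v = ∫ w in Iio (0 : ℝ), h w (w + V) := by
  have := (measurePreserving_add_right volume V).setIntegral_preimage_emb
    (measurableEmbedding_addRight V) (fun v => h (v - V) v) (Iio V)
  rw [integral_Iic_eq_integral_Iio, ← this]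
  simp

theorem setIntegral_Ici_sub (h : ℝ → ℝ → ℝ) (V : ℝ) :
    ∫ v in Ici V, h (v - V) v = ∫ w in Iio (0 : ℝ), h (-w) (V - w) := by
  have := (volume.measurePreserving_sub_left V).setIntegral_preimage_emb
    (MeasurableEquiv.subLeft V).measurableEmbedding (fun v => h (v - V) v) (Ioi V)
  rw [integral_Ici_eq_integral_Ioi, ← this]
  simp

namespace BodyGas

variable {d : ℕ} {P : BodyGas d} {p E Vinf γ₀ : ℝ}

theorem Assumptions.b_integrable (hP : P.Assumptions p E Vinf γ₀) : Integrable P.b := by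
  by_contra h
  have := hP.b_mass
  rw [integral_undef h] at this
  exact zero_ne_one this

/-- Evaluate the bound of f₀ at vanishing transversal velocity, where b is positive. -/
theorem Assumptions.exists_a₀_le (hP : P.Assumptions p E Vinf γ₀) :
    ∃ M > 0, ∀ v, P.a₀ v ≤ M := by
  obtain ⟨M, hM⟩ := hP.f₀_bdd
  have h1 : ∀ v, P.a₀ v ≤ M / P.b 0 := fun v => by
    rw [le_div_iff₀ hP.b_zero_pos]
    exact hM (v, 0)
  exact ⟨max 1 (M / P.b 0), by positivity, fun v => (h1 v).trans (le_max_right _ _)⟩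

/-- Otherwise the gain integral in (A5) would vanish, while its lower bound is positive. -/
theorem Assumptions.exists_a₀_ne_zero (hP : P.Assumptions p E Vinf γ₀) : ∃ v, P.a₀ v ≠ 0 := by
  by_contra! h
  obtain ⟨δ, hδ, hlow⟩ := hP.gain_lower
  have := hlow 0 ⟨by linarith [hP.γ₀_pos], le_rfl⟩ Vinf ⟨by linarith [hP.γ₀_pos], le_rfl⟩
  simp [h] at this
  linarith

theorem Assumptions.exists_b_le (hP : P.Assumptions p E Vinf γ₀) :
    ∃ M > 0, ∀ v, P.b v ≤ M := by
  obtain ⟨M, hM⟩ := hP.f₀_bdd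
  obtain ⟨x, hx⟩ := hP.exists_a₀_ne_zero
  have hx' : 0 < P.a₀ x := lt_of_le_of_ne (hP.a₀_nonneg x) (Ne.symm hx)
  have h1 : ∀ v, P.b v ≤ M / P.a₀ x := fun v => by
    rw [le_div_iff₀ hx', mul_comm]
    exact hM (x, v)
  exact ⟨max 1 (M / P.a₀ x), by positivity, fun v => (h1 v).trans (le_max_right _ _)⟩

theorem Assumptions.moment_neg (hP : P.Assumptions p E Vinf γ₀) (w : ℝ) :
    P.moment (-w) = P.moment w := by
  simp only [moment, hP.k_even_right]

theorem Assumptions.moment_nonneg (hP : P.Assumptions p E Vinf γ₀) (w : ℝ) : 0 ≤ P.moment w :=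
  integral_nonneg fun _ => mul_nonneg (sq_nonneg _) (hP.k_nonneg _ _)

theorem Assumptions.ell_neg (hP : P.Assumptions p E Vinf γ₀) (w : ℝ) :
    P.ell (-w) = P.ell w := by
  simp only [ell, hP.moment_neg, neg_sq]

theorem Assumptions.ell_nonneg (hP : P.Assumptions p E Vinf γ₀) (w : ℝ) : 0 ≤ P.ell w := by
  have h1 := hP.α_mem.1
  have h2 := hP.α_mem.2
  have h3 := hP.moment_nonneg w
  have h4 : 0 ≤ 1 - P.α := by linarith
  unfold ell
  positivity

theorem isOpen_ne_zero : IsOpen {u : ℝ | u ≠ 0} := isOpen_ne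

theorem Assumptions.ell_contDiffOn (hP : P.Assumptions p E Vinf γ₀) :
    ContDiffOn ℝ 1 P.ell {u | u ≠ 0} :=
  ContDiffOn.add (by fun_prop) (contDiffOn_const.mul hP.moment_contDiff)

theorem Assumptions.ell_differentiableAt (hP : P.Assumptions p E Vinf γ₀) {w : ℝ} (hw : w ≠ 0) :
    DifferentiableAt ℝ P.ell w :=
  (hP.ell_contDiffOn.differentiableOn (by norm_num)).differentiableAt
    (isOpen_ne_zero.mem_nhds hw)

theorem Assumptions.ell_deriv_continuousOn (hP : P.Assumptions p E Vinf γ₀) :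
    ContinuousOn (deriv P.ell) (Iio 0) :=
  (hP.ell_contDiffOn.continuousOn_deriv_of_isOpen isOpen_ne_zero le_rfl).mono fun _ hw => ne_of_lt hw

theorem Assumptions.ell_measurable (hP : P.Assumptions p E Vinf γ₀) : Measurable P.ell :=
  measurable_of_continuousOn_compl_singleton 0 hP.ell_contDiffOn.continuousOn

theorem Assumptions.ell_antitoneOn (hP : P.Assumptions p E Vinf γ₀) :
    AntitoneOn P.ell (Iio 0) := by
  refine antitoneOn_of_deriv_nonpos (convex_Iio 0)
    (fun w hw => (hP.ell_differentiableAt (ne_of_lt hw)).continuousAt.continuousWithinAt) ?_ ?_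
  · intro w hw
    rw [interior_Iio] at hw
    exact (hP.ell_differentiableAt (ne_of_lt hw)).differentiableWithinAt
  · intro w hw
    rw [interior_Iio] at hw
    exact (hP.ell_deriv_neg w hw).le

/-- The limit of `ell` at `0` from the left. -/
def ellZero (P : BodyGas d) : ℝ := sInf (P.ell '' Iio 0)

/-- Monotonicity and nonnegativity give the limit. It is positive for p = 0 and zero for p > 0; the
value of `ell` at 0 plays no role. -/
theorem Assumptions.ell_tendsto (hP : P.Assumptions p E Vinf γ₀) :
    Tendsto P.ell (nhdsWithin 0 (Iio 0)) (nhds P.ellZero) :=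
  hP.ell_antitoneOn.tendsto_nhdsLT ⟨0, by
    rintro _ ⟨w, _, rfl⟩
    exact hP.ell_nonneg w⟩

theorem Assumptions.ellZero_nonneg (hP : P.Assumptions p E Vinf γ₀) : 0 ≤ P.ellZero :=
  ge_of_tendsto hP.ell_tendsto (Eventually.of_forall hP.ell_nonneg)

/-- `ell` is comparable to `|w|^p` near zero. -/
theorem Assumptions.exists_ell_bounds (hP : P.Assumptions p E Vinf γ₀) :
    ∃ c C : ℝ, 0 < c ∧ 0 < C ∧ ∀ w, 0 < w → w ≤ γ₀ →
      c * w ^ p ≤ P.ell w ∧ P.ell w ≤ C * w ^ p := by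
  obtain ⟨c, C, hc, hC, h⟩ := hP.moment_bounds
  have hα0 := hP.α_mem.1
  have hα1 : 0 < 1 - P.α := by linarith [hP.α_mem.2]
  have hγ := hP.γ₀_pos
  refine ⟨(1 - P.α) * c, (1 + P.α) * γ₀ ^ (2 - p) + (1 - P.α) * C, by positivity, by positivity,
    fun w hw hwγ => ?_⟩
  have h1 := h (-w) ⟨by linarith, by linarith⟩
  rw [hP.moment_neg, abs_neg, abs_of_pos hw] at h1
  have h2 : w ^ 2 ≤ γ₀ ^ (2 - p) * w ^ p := by
    have h3 : w ^ (2 - p) ≤ γ₀ ^ (2 - p) :=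
      Real.rpow_le_rpow hw.le hwγ (by linarith [hP.p_mem.2])
    have h4 : w ^ 2 = w ^ (2 - p) * w ^ p := by
      rw [← Real.rpow_add hw, ← Real.rpow_two]
      congr 1
      ring
    rw [h4]
    have := Real.rpow_pos_of_pos hw p
    gcongr
  unfold ell
  constructor
  · have h5 := mul_le_mul_of_nonneg_left h1.1 hα1.le
    have : 0 ≤ (1 + P.α) * w ^ 2 := by positivity
    linarith
  · have h5 := mul_le_mul_of_nonneg_left h1.2 hα1.le
    have h6 : (1 + P.α) * w ^ 2 ≤ (1 + P.α) * (γ₀ ^ (2 - p) * w ^ p) := by gcongr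
    linarith

/-- The transversal integration gives the mass 1 of b. Evenness of `ell` and of a₀ brings both ends
to the same half line w < 0. -/
theorem Assumptions.end_pressure (hP : P.Assumptions p E Vinf γ₀) {V : ℝ} (hV : |V - Vinf| ≤ γ₀) :
    (∫ v in {v : Vel d | v.1 ≤ V}, P.ell (v.1 - V) * P.f₀ v) -
      (∫ v in {v : Vel d | V ≤ v.1}, P.ell (v.1 - V) * P.f₀ v) =
    ∫ w in Iio (0 : ℝ), P.ell w * (P.a₀ (w + V) - P.a₀ (w - V)) := by
  obtain ⟨g, hg, hdom⟩ := hP.ell_dominated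
  have h1 : {v : Vel d | v.1 ≤ V} = Iic V ×ˢ univ := by ext; simp
  have h2 : {v : Vel d | V ≤ v.1} = Ici V ×ˢ univ := by ext; simp
  have key : ∀ s : Set ℝ, ∫ v in s ×ˢ (univ : Set (Perp d)), P.ell (v.1 - V) * P.f₀ v =
      ∫ v in s, P.ell (v - V) * P.a₀ v := by
    intro s
    have := setIntegral_prod_mul (μ := (volume : Measure ℝ)) (ν := (volume : Measure (Perp d)))
      (fun v => P.ell (v - V) * P.a₀ v) P.b s univ
    rw [setIntegral_univ, hP.b_mass, mul_one] at this
    rw [← this]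
    simp only [f₀, mul_assoc]
    rfl
  obtain ⟨i1, i2⟩ := integrableOn_pressure hP.a₀_cont hP.a₀_nonneg
    (fun w hw => hP.ell_differentiableAt (ne_of_lt hw)) (fun w _ => hP.ell_nonneg w) hg hdom hV
  rw [h1, h2, key, key, setIntegral_Iic_sub (fun w v => P.ell w * P.a₀ v),
    setIntegral_Ici_sub (fun w v => P.ell w * P.a₀ v)]
  simp only [hP.ell_neg]
  have h3 : ∀ w, P.a₀ (V - w) = P.a₀ (w - V) := fun w => by rw [← hP.a₀_even, neg_sub]
  simp only [h3]
  rw [← integral_sub i1 i2]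
  simp only [mul_sub]

end BodyGas

/-! ### The lateral force is linear in the velocity -/

/-- An odd function with respect to a measure preserving symmetry of a set integrates to zero. -/
theorem setIntegral_eq_zero_of_odd {X : Type*} [MeasurableSpace X] {μ : Measure X} {σ : X ≃ᵐ X}
    (hσ : MeasurePreserving σ μ μ) {S : Set X} (hS : σ ⁻¹' S = S) {F : X → ℝ}
    (hF : ∀ v, F (σ v) = -F v) : ∫ v in S, F v ∂μ = 0 := by
  have h1 := hσ.setIntegral_preimage_emb σ.measurableEmbedding F S
  rw [hS] at h1
  simp only [hF, integral_neg] at h1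
  linarith

theorem ae_integrableOn_section {X Y : Type*} [MeasurableSpace X] [MeasurableSpace Y]
    {μ : Measure X} {ν : Measure Y} [SFinite μ] [SFinite ν] {F : X × Y → ℝ} {Q : Set (X × Y)}
    (hQ : MeasurableSet Q) (hF : IntegrableOn F Q (μ.prod ν)) :
    ∀ᵐ x ∂μ, IntegrableOn (fun y => F (x, y)) {y | (x, y) ∈ Q} ν := by
  have h1 := (integrable_indicator_iff hQ).mpr hF
  filter_upwards [h1.prod_right_ae] with x hx
  have hm : MeasurableSet {y | (x, y) ∈ Q} := measurable_prodMk_left hQ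
  rw [← integrable_indicator_iff hm]
  exact hx

variable {d : ℕ}

/-- Reflection of the longitudinal velocity at `V`. -/
def longFlip (d : ℕ) (V : ℝ) : Vel d ≃ᵐ Vel d :=
  (MeasurableEquiv.subLeft (2 * V)).prodCongr (MeasurableEquiv.refl _)

theorem longFlip_apply (V : ℝ) (v : Vel d) : longFlip d V v = (2 * V - v.1, v.2) := rfl

theorem measurePreserving_longFlip (V : ℝ) :
    MeasurePreserving (longFlip d V) (volume : Measure (Vel d)) volume :=
  (volume.measurePreserving_sub_left (2 * V)).prod (MeasurePreserving.id _)

/-- Reflection of the transversal velocity in the hyperplane orthogonal to `n`. -/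
def lateralRefl (n : Perp d) : Vel d ≃ᵐ Vel d :=
  (MeasurableEquiv.refl ℝ).prodCongr
    ((Submodule.reflection (Submodule.span ℝ {n})ᗮ).toMeasurableEquiv)

theorem lateralRefl_apply {n : Perp d} (hn : ‖n‖ = 1) (v : Vel d) :
    lateralRefl n v = (v.1, v.2 - (2 * inner ℝ v.2 n) • n) := by
  have h : lateralRefl n v = (v.1, Submodule.reflection (Submodule.span ℝ {n})ᗮ v.2) := rfl
  rw [h, Submodule.reflection_orthogonal_apply, Submodule.reflection_singleton_apply]
  congr 1
  simp only [hn, RCLike.ofReal_one, one_pow, div_one, neg_sub]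
  rw [← Nat.cast_smul_eq_nsmul ℝ, smul_smul, real_inner_comm]
  norm_num

theorem measurePreserving_lateralRefl (n : Perp d) :
    MeasurePreserving (lateralRefl n) (volume : Measure (Vel d)) volume :=
  (MeasurePreserving.id _).prod
    (Submodule.reflection (Submodule.span ℝ {n})ᗮ).measurePreserving

theorem inner_lateralRefl {n : Perp d} (hn : ‖n‖ = 1) (v : Vel d) :
    inner ℝ (lateralRefl n v).2 n = -inner ℝ v.2 n := by
  rw [lateralRefl_apply hn]
  simp only [inner_sub_left, inner_smul_left, real_inner_self_eq_norm_sq, hn]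
  simp
  ring

/-- Grazing velocities, for which mass conservation is not assumed, form a null set. -/
theorem volume_inner_eq_zero {n : Perp d} (hn : ‖n‖ = 1) :
    volume {v : Vel d | inner ℝ v.2 n = 0} = 0 := by
  have h1 : {v : Vel d | inner ℝ v.2 n = 0} =
      (univ : Set ℝ) ×ˢ ((Submodule.span ℝ {n})ᗮ : Set (Perp d)) := by
    ext v
    simp [Submodule.mem_orthogonal_singleton_iff_inner_left]
  have h2 : (volume : Measure (Perp d)) ((Submodule.span ℝ {n})ᗮ : Set (Perp d)) = 0 := by
    refine Measure.addHaar_submodule _ _ fun htop => ?_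
    have : n ∈ (Submodule.span ℝ {n})ᗮ := htop ▸ Submodule.mem_top
    rw [Submodule.mem_orthogonal_singleton_iff_inner_left, real_inner_self_eq_norm_sq, hn] at this
    norm_num at this
  rw [h1, Measure.volume_eq_prod, Measure.prod_prod, h2, mul_zero]

theorem measurableSet_inner_le (n : Perp d) :
    MeasurableSet {v : Vel d | inner ℝ v.2 n ≤ 0} :=
  (isClosed_le (by fun_prop) continuous_const).measurableSet

theorem measurableSet_le_inner (n : Perp d) :
    MeasurableSet {v : Vel d | 0 ≤ inner ℝ v.2 n} :=
  (isClosed_le continuous_const (by fun_prop)).measurableSet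

namespace BodyGas

variable {P : BodyGas d} {p E Vinf γ₀ : ℝ}

theorem Assumptions.f₀_nonneg (hP : P.Assumptions p E Vinf γ₀) (v : Vel d) : 0 ≤ P.f₀ v :=
  mul_nonneg (hP.a₀_nonneg _) (hP.b_nonneg _)

theorem Assumptions.f₀_continuous (hP : P.Assumptions p E Vinf γ₀) : Continuous P.f₀ := by
  have h1 := hP.a₀_cont
  have h2 := hP.b_cont
  unfold f₀
  fun_prop

theorem Assumptions.f₀_longFlip (hP : P.Assumptions p E Vinf γ₀) (v : Vel d) :
    P.f₀ (longFlip d 0 v) = P.f₀ v := by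
  simp [longFlip_apply, f₀, hP.a₀_even]

/-- The diffusively emitted part of the density at the lateral side. -/
def latDiffuse (P : BodyGas d) (V : ℝ) (n : Metric.sphere (0 : Perp d) 1) (v : Vel d) : ℝ :=
  ∫ u in {u : Vel d | inner ℝ u.2 (n : Perp d) ≤ 0},
      P.KS n (boost (P.latFrame V) v) (boost (P.latFrame V) u) * P.f₀ u

theorem latEmitted_eq (V : ℝ) (n : Metric.sphere (0 : Perp d) 1) (v : Vel d) :
    P.latEmitted V n v = P.αS * P.f₀ (lateralRefl (n : Perp d) v) +
      (1 - P.αS) * P.latDiffuse V n v := by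
  rw [lateralRefl_apply (by simp), latEmitted, latDiffuse]

/-- The flux of the incident particles on the lateral side. -/
def latFlux (P : BodyGas d) (n : Metric.sphere (0 : Perp d) 1) : ℝ :=
  ∫ v in {v : Vel d | inner ℝ v.2 (n : Perp d) ≤ 0}, -inner ℝ v.2 (n : Perp d) * P.f₀ v

theorem Assumptions.latFlux_nonneg (hP : P.Assumptions p E Vinf γ₀)
    (n : Metric.sphere (0 : Perp d) 1) : 0 ≤ P.latFlux n := by
  refine setIntegral_nonneg (measurableSet_inner_le _) fun v hv => ?_
  have hv' : inner ℝ v.2 (n : Perp d) ≤ 0 := hv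
  exact mul_nonneg (by linarith) (hP.f₀_nonneg v)

theorem Assumptions.latDiffuse_longFlip (hP : P.Assumptions p E Vinf γ₀) (V : ℝ)
    (n : Metric.sphere (0 : Perp d) 1) (v : Vel d) :
    P.latDiffuse V n (longFlip d (P.latFrame V) v) = P.latDiffuse V n v := by
  unfold latDiffuse
  have h1 : boost (P.latFrame V) (longFlip d (P.latFrame V) v) =
      (-(boost (P.latFrame V) v).1, (boost (P.latFrame V) v).2) := by
    simp only [boost, longFlip_apply]
    congr 1
    ring
  simp only [h1, hP.lateral.even_left]

/-- Tonelli and conservation of mass: the diffusely emitted flux equals the incident one. The fixed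
frame avoids any shift of the kernel; in the comoving frame the diffuse term vanishes by symmetry
and this identity is not needed. -/
theorem Assumptions.integral_latDiffuse (hP : P.Assumptions p E Vinf γ₀) {V : ℝ}
    (hV : |V - Vinf| ≤ γ₀) (hfr : P.latFrame V = 0) (n : Metric.sphere (0 : Perp d) 1)
    (hm : AEStronglyMeasurable (fun v : Vel d => inner ℝ v.2 (n : Perp d) * P.latDiffuse V n v)
      (volume.restrict {v : Vel d | 0 ≤ inner ℝ v.2 (n : Perp d)})) :
    ∫ v in {v : Vel d | 0 ≤ inner ℝ v.2 (n : Perp d)},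
      inner ℝ v.2 (n : Perp d) * P.latDiffuse V n v = P.latFlux n := by
  have hn : ‖(n : Perp d)‖ = 1 := by simp
  have hb : ∀ v : Vel d, boost (P.latFrame V) v = v := fun v => by simp [boost, hfr]
  have hKm : Measurable fun q : Vel d × Vel d => P.KS n q.1 q.2 :=
    hP.lateral.measurable.comp (measurable_const.prodMk measurable_id)
  have hf₀ : Measurable P.f₀ := hP.f₀_continuous.measurable
  have hDnn : ∀ v, 0 ≤ P.latDiffuse V n v := fun v =>
    integral_nonneg fun u => mul_nonneg (hP.lateral.nonneg _ _ _) (hP.f₀_nonneg u)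
  unfold latFlux
  rw [integral_eq_lintegral_of_nonneg_ae _ hm, integral_eq_lintegral_of_nonneg_ae]
  · congr 1
    calc ∫⁻ v in {v : Vel d | 0 ≤ inner ℝ v.2 (n : Perp d)},
          ENNReal.ofReal (inner ℝ v.2 (n : Perp d) * P.latDiffuse V n v)
        = ∫⁻ v in {v : Vel d | 0 ≤ inner ℝ v.2 (n : Perp d)},
            ∫⁻ u in {u : Vel d | inner ℝ u.2 (n : Perp d) ≤ 0},
              ENNReal.ofReal (P.f₀ u) *
                ENNReal.ofReal (inner ℝ v.2 (n : Perp d) * P.KS n v u) := by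
          refine setLIntegral_congr_fun (measurableSet_le_inner _) fun v hv => ?_
          have hv' : 0 ≤ inner ℝ v.2 (n : Perp d) := hv
          rw [ENNReal.ofReal_mul hv', latDiffuse, ofReal_integral_eq_lintegral_ofReal
            (hP.lateral.integrable_diffuse V hV n v hv')
            (Eventually.of_forall fun u => mul_nonneg (hP.lateral.nonneg _ _ _) (hP.f₀_nonneg u)),
            ← lintegral_const_mul]
          · refine lintegral_congr fun u => ?_
            simp only [hb]
            rw [← ENNReal.ofReal_mul hv', ← ENNReal.ofReal_mul (hP.f₀_nonneg u)]
            congr 1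
            ring
          · simp only [hb]
            exact ((hKm.comp (measurable_const.prodMk measurable_id)).mul hf₀).ennreal_ofReal
      _ = ∫⁻ u in {u : Vel d | inner ℝ u.2 (n : Perp d) ≤ 0},
            ∫⁻ v in {v : Vel d | 0 ≤ inner ℝ v.2 (n : Perp d)},
              ENNReal.ofReal (P.f₀ u) *
                ENNReal.ofReal (inner ℝ v.2 (n : Perp d) * P.KS n v u) := by
          refine lintegral_lintegral_swap (Measurable.aemeasurable ?_)
          refine Measurable.mul (hf₀.comp measurable_snd).ennreal_ofReal ?_
          refine Measurable.ennreal_ofReal (Measurable.mul ?_ hKm)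
          exact Continuous.measurable (by fun_prop)
      _ = _ := by
          refine lintegral_congr_ae ?_
          have hne : ∀ᵐ u : Vel d, inner ℝ u.2 (n : Perp d) ≠ 0 := by
            rw [ae_iff]
            simpa using volume_inner_eq_zero hn
          filter_upwards [ae_restrict_mem (measurableSet_inner_le _),
            ae_restrict_of_ae hne] with u hu hu0
          have hu' : inner ℝ u.2 (n : Perp d) < 0 := lt_of_le_of_ne hu hu0
          have hmass := hP.lateral.mass n u hu'
          have hint : IntegrableOn (fun v : Vel d => inner ℝ v.2 (n : Perp d) * P.KS n v u)
              {v : Vel d | 0 ≤ inner ℝ v.2 (n : Perp d)} := by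
            by_contra hcon
            rw [integral_undef hcon] at hmass
            exact abs_ne_zero.mpr hu0 hmass.symm
          rw [lintegral_const_mul' _ _ ENNReal.ofReal_ne_top, ← ofReal_integral_eq_lintegral_ofReal
            hint, hmass, abs_of_neg hu', ← ENNReal.ofReal_mul (hP.f₀_nonneg u), mul_comm]
          filter_upwards [ae_restrict_mem (measurableSet_le_inner _)] with v hv
          exact mul_nonneg hv (hP.lateral.nonneg _ _ _)
  · filter_upwards [ae_restrict_mem (measurableSet_inner_le _)] with v hv
    have hv' : inner ℝ v.2 (n : Perp d) ≤ 0 := hv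
    exact mul_nonneg (by linarith) (hP.f₀_nonneg v)
  · exact Continuous.aestronglyMeasurable
      (((continuous_snd.inner continuous_const).neg).mul hP.f₀_continuous)
  · filter_upwards [ae_restrict_mem (measurableSet_le_inner _)] with v hv
    exact mul_nonneg hv (hDnn v)

/-- The drag coefficient of the lateral side at a point with outward normal `n`. -/
def latDrag (P : BodyGas d) (n : Metric.sphere (0 : Perp d) 1) : ℝ :=
  if P.comoving then (1 - P.αS) * P.latFlux n else 0

/-- By the symmetry in v_x the incident part gives V times the flux, and specular reflection returns
-αS times that. A diffuse law in the comoving frame emits symmetrically about V, so it contributes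
nothing and leaves (1 - αS) V times the flux. In the fixed frame it contributes -(1 - αS) V times
the flux, and the total is zero. -/
theorem Assumptions.lateral_density (hP : P.Assumptions p E Vinf γ₀) {V V' : ℝ}
    (hV : |V - Vinf| ≤ γ₀) (hne : V' ≠ V)
    (n : Metric.sphere (0 : Perp d) 1)
    (h1 : IntegrableOn (fun v : Vel d => inner ℝ v.2 (n : Perp d) * (v.1 - V) * P.f₀ v)
      {v : Vel d | inner ℝ v.2 (n : Perp d) ≤ 0})
    (h1' : IntegrableOn (fun v : Vel d => inner ℝ v.2 (n : Perp d) * (v.1 - V') * P.f₀ v)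
      {v : Vel d | inner ℝ v.2 (n : Perp d) ≤ 0})
    (h2 : IntegrableOn (fun v : Vel d => inner ℝ v.2 (n : Perp d) * (v.1 - V) * P.latEmitted V n v)
      {v : Vel d | 0 ≤ inner ℝ v.2 (n : Perp d)})
    (h2' : IntegrableOn
      (fun v : Vel d => inner ℝ v.2 (n : Perp d) * (v.1 - V') * P.latEmitted V' n v)
      {v : Vel d | 0 ≤ inner ℝ v.2 (n : Perp d)}) :
    (∫ v in {v : Vel d | inner ℝ v.2 (n : Perp d) ≤ 0},
          inner ℝ v.2 (n : Perp d) * (v.1 - V) * P.f₀ v) +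
        ∫ v in {v : Vel d | 0 ≤ inner ℝ v.2 (n : Perp d)},
          inner ℝ v.2 (n : Perp d) * (v.1 - V) * P.latEmitted V n v = P.latDrag n * V := by
  have hn : ‖(n : Perp d)‖ = 1 := by simp
  set Sm : Set (Vel d) := {v : Vel d | inner ℝ v.2 (n : Perp d) ≤ 0} with hSm
  set Sp : Set (Vel d) := {v : Vel d | 0 ≤ inner ℝ v.2 (n : Perp d)} with hSp
  have hsub : V' - V ≠ 0 := sub_ne_zero.mpr hne
  have hflipm : ∀ W, longFlip d W ⁻¹' Sm = Sm := fun W => by ext v; simp [hSm, longFlip_apply]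
  have hflipp : ∀ W, longFlip d W ⁻¹' Sp = Sp := fun W => by ext v; simp [hSp, longFlip_apply]
  -- incident particles
  have split : ∀ (S : Set (Vel d)) (D : Vel d → ℝ) (W W' : ℝ), W' - W ≠ 0 →
      (∀ v, D (longFlip d 0 v) = D v) → longFlip d 0 ⁻¹' S = S →
      IntegrableOn (fun v : Vel d => inner ℝ v.2 (n : Perp d) * (v.1 - W) * D v) S →
      IntegrableOn (fun v : Vel d => inner ℝ v.2 (n : Perp d) * (v.1 - W') * D v) S →
      IntegrableOn (fun v : Vel d => inner ℝ v.2 (n : Perp d) * D v) S ∧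
      ∫ v in S, inner ℝ v.2 (n : Perp d) * (v.1 - W) * D v =
        -W * ∫ v in S, inner ℝ v.2 (n : Perp d) * D v := by
    intro S D W W' hW hD hS i1 i2
    -- The second velocity serves here: the difference of the two integrands is W' - W times the
    -- bare flux density, which is therefore integrable.
    have i3 : IntegrableOn (fun v : Vel d => inner ℝ v.2 (n : Perp d) * D v) S := by
      refine ((i1.sub i2).const_mul (W' - W)⁻¹).congr ?_
      filter_upwards with v
      simp only [Pi.sub_apply]
      field_simp
      ring
    have i4 : IntegrableOn (fun v : Vel d => inner ℝ v.2 (n : Perp d) * v.1 * D v) S := by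
      refine (i1.add (i3.const_mul W)).congr ?_
      filter_upwards with v
      simp only [Pi.add_apply]
      ring
    have h0 : ∫ v in S, inner ℝ v.2 (n : Perp d) * v.1 * D v = 0 := by
      refine setIntegral_eq_zero_of_odd (measurePreserving_longFlip 0) hS fun v => ?_
      rw [hD]
      simp [longFlip_apply]
    refine ⟨i3, ?_⟩
    have h5 : ∀ v : Vel d, inner ℝ v.2 (n : Perp d) * (v.1 - W) * D v =
        inner ℝ v.2 (n : Perp d) * v.1 * D v - W * (inner ℝ v.2 (n : Perp d) * D v) := fun v => by
      ring
    simp only [h5]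
    rw [integral_sub i4 (i3.const_mul W), h0, integral_const_mul]
    ring
  have hinc := (split Sm P.f₀ V V' hsub hP.f₀_longFlip (hflipm 0) h1 h1').2
  have hQ : ∫ v in Sm, inner ℝ v.2 (n : Perp d) * P.f₀ v = -P.latFlux n := by
    unfold latFlux
    rw [← integral_neg]
    congr 1
    ext v
    ring
  rw [hQ] at hinc
  -- specular reflection
  have hpre : lateralRefl (n : Perp d) ⁻¹' Sm = Sp := by
    ext v
    simp only [mem_preimage, hSm, hSp, mem_ofPred_eq, inner_lateralRefl hn]
    constructor <;> intro h <;> linarith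
  have hspec : ∀ W, IntegrableOn (fun v : Vel d => inner ℝ v.2 (n : Perp d) * (v.1 - W) * P.f₀ v) Sm →
      IntegrableOn (fun v : Vel d => inner ℝ v.2 (n : Perp d) * (v.1 - W) *
        P.f₀ (lateralRefl (n : Perp d) v)) Sp ∧
      ∫ v in Sp, inner ℝ v.2 (n : Perp d) * (v.1 - W) * P.f₀ (lateralRefl (n : Perp d) v) =
        - ∫ v in Sm, inner ℝ v.2 (n : Perp d) * (v.1 - W) * P.f₀ v := by
    intro W hi
    have hmp := measurePreserving_lateralRefl (n : Perp d)
    have hcomp : ∀ v : Vel d, inner ℝ v.2 (n : Perp d) * (v.1 - W) *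
        P.f₀ (lateralRefl (n : Perp d) v) =
        -(fun v : Vel d => inner ℝ v.2 (n : Perp d) * (v.1 - W) * P.f₀ v)
          (lateralRefl (n : Perp d) v) := fun v => by
      simp only [inner_lateralRefl hn]
      have : (lateralRefl (n : Perp d) v).1 = v.1 := by rw [lateralRefl_apply hn]
      rw [this]
      ring
    have e1 := hmp.integrableOn_comp_preimage (lateralRefl (n : Perp d)).measurableEmbedding
      (f := fun v : Vel d => inner ℝ v.2 (n : Perp d) * (v.1 - W) * P.f₀ v) (s := Sm)
    have e2 := hmp.setIntegral_preimage_emb (lateralRefl (n : Perp d)).measurableEmbedding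
      (fun v : Vel d => inner ℝ v.2 (n : Perp d) * (v.1 - W) * P.f₀ v) Sm
    rw [hpre] at e1 e2
    simp only [hcomp]
    exact ⟨(e1.mpr hi).neg, by rw [integral_neg, e2]⟩
  have hdiff : ∀ W, IntegrableOn (fun v : Vel d => inner ℝ v.2 (n : Perp d) * (v.1 - W) * P.f₀ v) Sm →
      IntegrableOn (fun v : Vel d => inner ℝ v.2 (n : Perp d) * (v.1 - W) * P.latEmitted W n v) Sp →
      IntegrableOn (fun v : Vel d => inner ℝ v.2 (n : Perp d) * (v.1 - W) *
        ((1 - P.αS) * P.latDiffuse W n v)) Sp := by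
    intro W i1 i2
    refine (i2.sub ((hspec W i1).1.const_mul P.αS)).congr ?_
    filter_upwards with v
    simp only [Pi.sub_apply, latEmitted_eq]
    ring
  have hemit : ∫ v in Sp, inner ℝ v.2 (n : Perp d) * (v.1 - V) * P.latEmitted V n v =
      P.αS * -(V * P.latFlux n) + ∫ v in Sp, inner ℝ v.2 (n : Perp d) * (v.1 - V) *
        ((1 - P.αS) * P.latDiffuse V n v) := by
    have h5 : ∀ v : Vel d, inner ℝ v.2 (n : Perp d) * (v.1 - V) * P.latEmitted V n v =
        P.αS * (inner ℝ v.2 (n : Perp d) * (v.1 - V) * P.f₀ (lateralRefl (n : Perp d) v)) +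
        inner ℝ v.2 (n : Perp d) * (v.1 - V) * ((1 - P.αS) * P.latDiffuse V n v) := fun v => by
      rw [latEmitted_eq]; ring
    simp only [h5]
    rw [integral_add ((hspec V h1).1.const_mul _) (hdiff V h1 h2), integral_const_mul,
      (hspec V h1).2, hinc]
    ring
  rw [hinc, hemit]
  unfold latDrag
  by_cases hc : P.comoving
  · rw [if_pos hc]
    have h6 : ∫ v in Sp, inner ℝ v.2 (n : Perp d) * (v.1 - V) *
        ((1 - P.αS) * P.latDiffuse V n v) = 0 := by
      refine setIntegral_eq_zero_of_odd (measurePreserving_longFlip V) (hflipp V) fun v => ?_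
      have hfr : P.latFrame V = V := by simp [latFrame, hc]
      have := hP.latDiffuse_longFlip V n v
      rw [hfr] at this
      rw [this]
      simp only [longFlip_apply]
      ring
    rw [h6]
    ring
  · rw [if_neg hc]
    have hfr : ∀ W, P.latFrame W = 0 := fun W => by simp [latFrame, hc]
    have hDeq : ∀ v, P.latDiffuse V' n v = P.latDiffuse V n v := fun v => by
      simp [latDiffuse, hfr]
    have i2' := hdiff V' h1' h2'
    simp only [hDeq] at i2'
    have hDflip : ∀ v, P.latDiffuse V n (longFlip d 0 v) = P.latDiffuse V n v := fun v => by
      have := hP.latDiffuse_longFlip V n v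
      rwa [hfr] at this
    obtain ⟨i3, e3⟩ := split Sp (fun v => (1 - P.αS) * P.latDiffuse V n v) V V' hsub
      (fun v => by simp only [hDflip]) (hflipp 0) (hdiff V h1 h2) i2'
    rw [e3]
    -- The integrability of the diffuse flux is only known with the factor 1 - αS, so the purely
    -- specular case is separate.
    by_cases hα : 1 - P.αS = 0
    · rw [hα]
      have : P.αS = 1 := by linarith
      simp [this]
    · have i4 : IntegrableOn (fun v : Vel d => inner ℝ v.2 (n : Perp d) * P.latDiffuse V n v) Sp := by
        refine (i3.const_mul (1 - P.αS)⁻¹).congr ?_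
        filter_upwards with v
        field_simp
      have h7 : ∀ v : Vel d, inner ℝ v.2 (n : Perp d) * ((1 - P.αS) * P.latDiffuse V n v) =
          (1 - P.αS) * (inner ℝ v.2 (n : Perp d) * P.latDiffuse V n v) := fun v => by ring
      simp only [h7]
      rw [integral_const_mul, hP.integral_latDiffuse hV (hfr V) n i4.aestronglyMeasurable]
      ring

theorem Assumptions.exists_lateralForce (hP : P.Assumptions p E Vinf γ₀) :
    ∃ κ ≥ 0, ∀ V, |V - Vinf| ≤ γ₀ → P.lateralForce V = κ * V := by
  have hγ := hP.γ₀_pos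
  have hr := hP.r_pos
  have hlen := hP.len_pos
  have hα := hP.lateral.αS_mem
  have hdrag : ∀ n, 0 ≤ P.latDrag n := fun n => by
    unfold latDrag
    split_ifs
    · exact mul_nonneg (by linarith [hα.2]) (hP.latFlux_nonneg n)
    · exact le_rfl
  refine ⟨P.len * P.r ^ (d - 2) * ∫ n, P.latDrag n ∂((volume : Measure (Perp d)).toSphere),
    mul_nonneg (by positivity) (integral_nonneg hdrag), fun V hV => ?_⟩
  -- Any second admissible velocity will do.
  obtain ⟨V', hV', hne⟩ : ∃ V', |V' - Vinf| ≤ γ₀ ∧ V' ≠ V := by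
    by_cases h : V = Vinf
    · exact ⟨Vinf + γ₀, by simp [abs_of_pos hγ], by rw [h]; linarith⟩
    · exact ⟨Vinf, by simp [hγ.le], fun h' => h h'.symm⟩
  have hQm : MeasurableSet {q : Metric.sphere (0 : Perp d) 1 × Vel d |
      inner ℝ q.2.2 (q.1 : Perp d) ≤ 0} :=
    (isClosed_le (by fun_prop) continuous_const).measurableSet
  have hQp : MeasurableSet {q : Metric.sphere (0 : Perp d) 1 × Vel d |
      0 ≤ inner ℝ q.2.2 (q.1 : Perp d)} :=
    (isClosed_le continuous_const (by fun_prop)).measurableSet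
  unfold lateralForce
  rw [mul_assoc (P.len * P.r ^ (d - 2)), ← integral_mul_const]
  congr 1
  refine integral_congr_ae ?_
  filter_upwards [ae_integrableOn_section hQm (hP.lateral.integrable_incident V hV),
    ae_integrableOn_section hQm (hP.lateral.integrable_incident V' hV'),
    ae_integrableOn_section hQp (hP.lateral.integrable_emitted V hV),
    ae_integrableOn_section hQp (hP.lateral.integrable_emitted V' hV')] with n h1 h1' h2 h2'
  exact hP.lateral_density hV hne n h1 h1' h2 h2'

end BodyGas

/-! ### Slope of the fictitious force near the equilibrium -/

namespace BodyGas

variable {P : BodyGas d} {p E Vinf γ₀ : ℝ}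

theorem Assumptions.disc_pos (hP : P.Assumptions p E Vinf γ₀) : 0 < volume.real P.disc := by
  refine ENNReal.toReal_pos ?_ measure_closedBall_lt_top.ne
  exact (Metric.measure_closedBall_pos volume _ hP.r_pos).ne'

theorem Assumptions.exists_hasDerivAt_F₀ (hP : P.Assumptions p E Vinf γ₀) :
    ∃ κ ≥ 0, ∀ V, |V - Vinf| < γ₀ →
      HasDerivAt P.F₀ (κ + volume.real P.disc * pressureDeriv P.ell P.a₀ P.ellZero V) V := by
  obtain ⟨κ, hκ, hlat⟩ := hP.exists_lateralForce
  obtain ⟨g, hg, hdom⟩ := hP.ell_dominated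
  refine ⟨κ, hκ, fun V hV => ?_⟩
  have h1 := hasDerivAt_pressure hP.a₀_cont hP.a₀_nonneg hP.a₀_even
    (fun w hw => hP.ell_differentiableAt (ne_of_lt hw)) hP.ell_deriv_continuousOn
    (fun w _ => hP.ell_nonneg w) hP.ell_tendsto hP.γ₀_pos hg hdom hV
  have h2 : HasDerivAt (fun V => κ * V + volume.real P.disc *
      ∫ w in Iio (0 : ℝ), P.ell w * (P.a₀ (w + V) - P.a₀ (w - V)))
      (κ + volume.real P.disc * pressureDeriv P.ell P.a₀ P.ellZero V) V :=
    (((hasDerivAt_id V).const_mul κ).add (h1.const_mul (volume.real P.disc))).congr_deriv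
      (by rw [mul_one])
  refine h2.congr_of_eventuallyEq ?_
  have hball : Metric.ball Vinf γ₀ ∈ nhds V := Metric.isOpen_ball.mem_nhds (by
    rw [Metric.mem_ball, Real.dist_eq]; exact hV)
  filter_upwards [hball] with W hW
  rw [Metric.mem_ball, Real.dist_eq] at hW
  unfold F₀
  rw [hP.end_pressure hW.le, hlat W hW.le]

/-- Uniform bounds for the slope of the fictitious force near the equilibrium, compared with the
largest pressure that can be missing behind the body. -/
theorem Assumptions.exists_slope_bounds (hP : P.Assumptions p E Vinf γ₀) :
    ∃ γs β q Bbar : ℝ, 0 < γs ∧ γs ≤ γ₀ ∧ 0 < β ∧ 0 < q ∧ q ≤ 3 / 4 * β ∧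
      (∀ V, |V - Vinf| < γs → DifferentiableAt ℝ P.F₀ V ∧ β ≤ deriv P.F₀ V ∧
        deriv P.F₀ V ≤ Bbar) ∧
      ContinuousOn (deriv P.F₀) {V | |V - Vinf| < γs} ∧
      ∀ w, 0 < w → w < γs → ∀ u, |u - Vinf| < γs →
        volume.real P.disc * (P.ell w * P.a₀ u) ≤ q := by
  obtain ⟨κ, hκ, hder⟩ := hP.exists_hasDerivAt_F₀
  obtain ⟨g, hg, hdom⟩ := hP.ell_dominated
  have hγ := hP.γ₀_pos
  set D := volume.real P.disc with hD
  have hD0 : 0 < D := hP.disc_pos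
  set s : ℝ → ℝ := fun V => κ + D * pressureDeriv P.ell P.a₀ P.ellZero V with hs
  have hsc : ContinuousOn s {V | |V - Vinf| < γ₀} :=
    (continuousOn_const.add (continuousOn_const.mul
      (continuousOn_pressureDeriv hP.a₀_cont hP.a₀_nonneg hP.ell_deriv_continuousOn
        (fun w _ => hP.ell_nonneg w) hg hdom))).mono fun V (hV : |V - Vinf| < γ₀) => hV.le
  have hopen : ∀ γ : ℝ, IsOpen {V : ℝ | |V - Vinf| < γ} := fun γ =>
    isOpen_lt (by fun_prop) continuous_const
  have hVinf : |Vinf - Vinf| < γ₀ := by simpa using hγ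
  have hs0 : 2 * (D * (P.ellZero * P.a₀ Vinf)) < s Vinf := by
    have := lt_pressureDeriv (l₀ := P.ellZero) hP.a₀_cont hP.a₀_nonneg hP.a₀_even
      hP.exists_a₀_ne_zero
      hP.ell_deriv_continuousOn hP.ell_deriv_neg (fun w _ => hP.ell_nonneg w) hg hdom hVinf.le
    simp only [hs]
    nlinarith
  have hsp : 0 < s Vinf := lt_of_le_of_lt (mul_nonneg zero_le_two
    (mul_nonneg hD0.le (mul_nonneg hP.ellZero_nonneg (hP.a₀_nonneg _)))) hs0
  have hsat := hsc.continuousAt ((hopen γ₀).mem_nhds hVinf)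
  have e1 : ∀ᶠ V in nhds Vinf, 7 / 8 * s Vinf < s V :=
    hsat.eventually (lt_mem_nhds (by linarith))
  have e2 : ∀ᶠ V in nhds Vinf, s V < 2 * s Vinf :=
    hsat.eventually (gt_mem_nhds (by linarith))
  -- At the equilibrium the missing pressure is below half of the slope s(V∞); 9/16 leaves room for
  -- a neighbourhood.
  obtain ⟨η, hη, hηs⟩ : ∃ η > 0, D * ((P.ellZero + η) * (P.a₀ Vinf + η)) < 9 / 16 * s Vinf := by
    have hc : Continuous fun η : ℝ => D * ((P.ellZero + η) * (P.a₀ Vinf + η)) := by fun_prop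
    have h1 : ∀ᶠ η in nhds (0 : ℝ), D * ((P.ellZero + η) * (P.a₀ Vinf + η)) < 9 / 16 * s Vinf :=
      hc.continuousAt.eventually (gt_mem_nhds (by simp only [add_zero]; linarith))
    obtain ⟨η, h2, h3⟩ := ((h1.filter_mono nhdsWithin_le_nhds).and
      (self_mem_nhdsWithin : Ioi (0 : ℝ) ∈ nhdsWithin 0 (Ioi 0))).exists
    exact ⟨η, h3, h2⟩
  have e3 : ∀ᶠ u in nhds Vinf, P.a₀ u < P.a₀ Vinf + η :=
    hP.a₀_cont.continuousAt.eventually (gt_mem_nhds (by linarith))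
  have e4 : ∀ᶠ w in nhdsWithin (0 : ℝ) (Iio 0), P.ell w < P.ellZero + η :=
    hP.ell_tendsto.eventually (gt_mem_nhds (by linarith))
  obtain ⟨γ1, hγ1, h1⟩ := Metric.eventually_nhds_iff.mp (e1.and (e2.and e3))
  obtain ⟨γ2, hγ2, h2⟩ := Metric.eventually_nhds_iff.mp (eventually_nhdsWithin_iff.mp e4)
  set γs := min γ₀ (min γ1 γ2) with hγs
  have hγs0 : γs ≤ γ₀ := min_le_left _ _
  have hγs1 : γs ≤ γ1 := (min_le_right _ _).trans (min_le_left _ _)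
  have hγs2 : γs ≤ γ2 := (min_le_right _ _).trans (min_le_right _ _)
  -- The ratio works because 9/16 < 3/4 · 7/8 = 21/32.
  refine ⟨γs, 7 / 8 * s Vinf, 9 / 16 * s Vinf, 2 * s Vinf, by positivity, hγs0, by positivity,
    by positivity, by linarith, ?_, ?_, ?_⟩
  · intro V hV
    have h3 := hder V (hV.trans_le hγs0)
    obtain ⟨h4, h5, -⟩ := h1 (y := V) (by rw [Real.dist_eq]; exact hV.trans_le hγs1)
    refine ⟨h3.differentiableAt, ?_, ?_⟩ <;> rw [h3.deriv]
    · exact h4.le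
    · exact h5.le
  · refine (hsc.mono fun V (hV : |V - Vinf| < γs) => hV.trans_le hγs0).congr fun V hV => ?_
    exact (hder V (lt_of_lt_of_le hV hγs0)).deriv
  · intro w hw hwγ u hu
    obtain ⟨-, -, h5⟩ := h1 (y := u) (by rw [Real.dist_eq]; exact hu.trans_le hγs1)
    have h6 := h2 (y := -w) (by
      rw [Real.dist_eq, sub_zero, abs_neg, abs_of_pos hw]; exact hwγ.trans_le hγs2)
      (by simpa using hw)
    rw [hP.ell_neg] at h6
    refine le_trans ?_ hηs.le
    have := hP.a₀_nonneg u
    have := hP.ell_nonneg w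
    have := hP.ellZero_nonneg
    gcongr

end BodyGas

/-! ### The force on an end in terms of the incident density -/

theorem Face.measurableSet_incident (e : Face) (V : ℝ) :
    MeasurableSet (e.incident V : Set (Vel d)) := by
  cases e
  · exact (isClosed_le (by fun_prop) continuous_const).measurableSet
  · exact (isClosed_le continuous_const (by fun_prop)).measurableSet

theorem Face.measurableSet_emitted (e : Face) (V : ℝ) :
    MeasurableSet (e.emitted V : Set (Vel d)) := by
  cases e
  · exact (isClosed_le continuous_const (by fun_prop)).measurableSet
  · exact (isClosed_le (by fun_prop) continuous_const).measurableSet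

theorem Face.longFlip_preimage (e : Face) (V : ℝ) :
    longFlip d V ⁻¹' (e.incident V) = e.emitted V := by
  cases e <;> ext v <;> simp [Face.incident, Face.emitted, longFlip_apply] <;> constructor <;>
    intro h <;> linarith

/-- The longitudinal velocities, relative to the body, of the particles emitted by an end. -/
def Face.halfLine : Face → Set ℝ
  | .right => Ici 0
  | .left => Iic 0

theorem Face.emitted_eq (e : Face) (V : ℝ) :
    (e.emitted V : Set (Vel d)) = ((fun v => v - V) ⁻¹' e.halfLine) ×ˢ univ := by
  cases e <;> ext v <;> simp [Face.emitted, Face.halfLine]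

theorem Face.incident_eq (e : Face) (V : ℝ) :
    (e.incident V : Set (Vel d)) = ((fun v => V - v) ⁻¹' e.halfLine) ×ˢ univ := by
  cases e <;> ext v <;> simp [Face.incident, Face.halfLine]

theorem ae_fst_ne (V : ℝ) : ∀ᵐ u : Vel d, u.1 ≠ V := by
  rw [ae_iff]
  have : {u : Vel d | ¬u.1 ≠ V} = {V} ×ˢ (univ : Set (Perp d)) := by ext; simp
  rw [this, Measure.volume_eq_prod, Measure.prod_prod]
  simp

theorem setIntegral_halfLine_even {φ : ℝ → ℝ} (hφ : ∀ v, φ (-v) = φ v)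
    (hi : IntegrableOn φ (Ici 0)) (e : Face) :
    IntegrableOn φ e.halfLine ∧ ∫ v in e.halfLine, φ v = ∫ v in Ici (0 : ℝ), φ v := by
  cases e
  · exact ⟨hi, rfl⟩
  · have hmp := Measure.measurePreserving_neg (volume : Measure ℝ)
    have hemb := (MeasurableEquiv.neg ℝ).measurableEmbedding
    have hpre : (Neg.neg : ℝ → ℝ) ⁻¹' Ici 0 = Iic 0 := by ext; simp
    have h1 := hmp.integrableOn_comp_preimage hemb (f := φ) (s := Ici 0)
    have h2 := hmp.setIntegral_preimage_emb hemb φ (Ici 0)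
    rw [hpre] at h1 h2
    simp only [hφ] at h2
    refine ⟨(h1.mpr hi).congr ?_, h2⟩
    filter_upwards with v
    exact hφ v

namespace BodyGas

variable {P : BodyGas d} {p E Vinf γ₀ V₀ : ℝ} {V : ℝ → ℝ}
  {fm fp : Face → ℝ → Perp d → Vel d → ℝ}

theorem Assumptions.lintegral_emitted_kernel (hP : P.Assumptions p E Vinf γ₀) (e : Face) (W : ℝ)
    {w : ℝ} (hw : w ≠ 0) :
    ∫⁻ v in (e.emitted W : Set (Vel d)), ENNReal.ofReal ((v.1 - W) ^ 2 * (P.k (v.1 - W) w * P.b v.2))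
      = ENNReal.ofReal (P.moment w) := by
  set φ : ℝ → ℝ := fun v => v ^ 2 * P.k v w with hφ
  obtain ⟨h1, h2⟩ := setIntegral_halfLine_even (φ := φ)
    (fun v => by simp only [hφ, neg_sq, hP.k_even_left]) (hP.moment_integrable w hw) e
  have hmp := measurePreserving_sub_right (volume : Measure ℝ) W
  have hemb := (MeasurableEquiv.subRight W).measurableEmbedding
  have h3 : IntegrableOn (fun v => φ (v - W)) ((fun v => v - W) ⁻¹' e.halfLine) :=
    (hmp.integrableOn_comp_preimage hemb (f := φ)).mpr h1
  have h4 : ∫ v in (fun v => v - W) ⁻¹' e.halfLine, φ (v - W) = P.moment w :=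
    (hmp.setIntegral_preimage_emb hemb φ e.halfLine).trans h2
  have h5 : ∀ v : Vel d, (v.1 - W) ^ 2 * (P.k (v.1 - W) w * P.b v.2) = φ (v.1 - W) * P.b v.2 :=
    fun v => by simp only [hφ]; ring
  simp only [h5]
  rw [Face.emitted_eq, ← ofReal_integral_eq_lintegral_ofReal]
  · congr 1
    have := setIntegral_prod_mul (μ := (volume : Measure ℝ)) (ν := (volume : Measure (Perp d)))
      (fun v => φ (v - W)) P.b ((fun v => v - W) ⁻¹' e.halfLine) univ
    rw [setIntegral_univ, hP.b_mass, mul_one, h4] at this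
    exact this
  · rw [Measure.volume_eq_prod, ← Measure.prod_restrict, Measure.restrict_univ]
    exact Integrable.mul_prod h3 hP.b_integrable
  · refine Eventually.of_forall fun v => ?_
    exact mul_nonneg (mul_nonneg (sq_nonneg _) (hP.k_nonneg _ _)) (hP.b_nonneg _)

/-- The kernel, modified on the null set of vanishing incident velocities. -/
def kReg (P : BodyGas d) (q : ℝ × ℝ) : ℝ := {q : ℝ × ℝ | q.2 ≠ 0}.indicator (fun q => P.k q.1 q.2) q

theorem kReg_eq {v w : ℝ} (hw : w ≠ 0) : P.kReg (v, w) = P.k v w := by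
  simp [kReg, hw]

theorem Assumptions.kReg_measurable (hP : P.Assumptions p E Vinf γ₀) : Measurable P.kReg := by
  have hm : MeasurableSet {q : ℝ × ℝ | q.2 ≠ 0} :=
    (isOpen_ne_fun continuous_snd continuous_const).measurableSet
  classical
  have h1 := ContinuousOn.measurable_piecewise hP.k_cont
    (show ContinuousOn (0 : ℝ × ℝ → ℝ) _ from continuousOn_const) hm
  rwa [Set.piecewise_eq_indicator] at h1

/-- The momentum flux of the emitted particles, in terms of the density of the incident ones. -/
theorem IsSolution.lintegral_emitted (hS : P.IsSolution E V₀ V fm fp)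
    (hP : P.Assumptions p E Vinf γ₀) (e : Face) {t : ℝ} (ht : 0 ≤ t) {x : Perp d}
    (hx : x ∈ P.disc) :
    ∫⁻ v in e.emitted (V t), ENNReal.ofReal ((v.1 - V t) ^ 2 * fp e t x v) =
      ∫⁻ u in e.incident (V t),
        ENNReal.ofReal ((P.ell (u.1 - V t) - (u.1 - V t) ^ 2) * fm e t x u) := by
  set W := V t with hW
  have hα0 := hP.α_mem.1
  have hα1 : 0 ≤ 1 - P.α := by linarith [hP.α_mem.2]
  obtain ⟨M, hM⟩ := hS.fm_bdd
  have hfm0 : ∀ u ∈ e.incident W, 0 ≤ fm e t x u := fun u hu => (hM e t ht x hx u hu).1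
  have hfmm : Measurable (fm e t x) := (hS.fm_measurable e).comp
    (measurable_const.prodMk (measurable_const.prodMk measurable_id))
  have hmi := Face.measurableSet_incident (d := d) e W
  have hme := Face.measurableSet_emitted (d := d) e W
  have hflip : ∀ v, v ∈ e.emitted W → longFlip d W v ∈ e.incident W := fun v hv => by
    rw [← e.longFlip_preimage] at hv
    exact hv
  set J : Vel d → ℝ := fun v => ∫ u in e.incident W, P.K (boost W v) (boost W u) * fm e t x u
    with hJ
  have hKnn : ∀ v u, 0 ≤ P.K v u := fun v u => mul_nonneg (hP.k_nonneg _ _) (hP.b_nonneg _)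
  have hJ0 : ∀ v, 0 ≤ J v := fun v =>
    setIntegral_nonneg hmi fun u hu => mul_nonneg (hKnn _ _) (hfm0 u hu)
  calc ∫⁻ v in e.emitted W, ENNReal.ofReal ((v.1 - W) ^ 2 * fp e t x v)
      = ∫⁻ v in e.emitted W,
          (ENNReal.ofReal (P.α * (W - (longFlip d W v).1) ^ 2 * fm e t x (longFlip d W v)) +
          ENNReal.ofReal ((1 - P.α) * (v.1 - W) ^ 2 * J v)) := by
        refine setLIntegral_congr_fun hme fun v hv => ?_
        rw [hS.reflection e t ht x hx v hv, ← ENNReal.ofReal_add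
          (mul_nonneg (mul_nonneg hα0 (sq_nonneg _)) (hfm0 _ (hflip v hv)))
          (mul_nonneg (mul_nonneg hα1 (sq_nonneg _)) (hJ0 v))]
        congr 1
        simp only [longFlip_apply, hJ, ← hW]
        ring
    _ = (∫⁻ v in e.emitted W,
          ENNReal.ofReal (P.α * (W - (longFlip d W v).1) ^ 2 * fm e t x (longFlip d W v))) +
        ∫⁻ v in e.emitted W, ENNReal.ofReal ((1 - P.α) * (v.1 - W) ^ 2 * J v) := by
        refine lintegral_add_left (Measurable.ennreal_ofReal ?_) _
        exact (((measurable_const.sub (measurable_fst.comp (longFlip d W).measurable)).pow_const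
          2).const_mul _).mul (hfmm.comp (longFlip d W).measurable)
    -- The specular part is transformed by the flip of v_x at W. In the diffuse part Tonelli
    -- integrates the kernel over emitted velocities first, which produces the moment.
    _ = (∫⁻ u in e.incident W, ENNReal.ofReal (P.α * (W - u.1) ^ 2 * fm e t x u)) +
        ∫⁻ u in e.incident W, ENNReal.ofReal ((1 - P.α) * P.moment (u.1 - W) * fm e t x u) := by
        congr 1
        · have := (measurePreserving_longFlip (d := d) W).setLIntegral_comp_preimage_emb
            (longFlip d W).measurableEmbedding
            (fun u => ENNReal.ofReal (P.α * (W - u.1) ^ 2 * fm e t x u)) (e.incident W)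
          rw [e.longFlip_preimage] at this
          exact this
        · calc ∫⁻ v in e.emitted W, ENNReal.ofReal ((1 - P.α) * (v.1 - W) ^ 2 * J v)
              = ∫⁻ v in e.emitted W, ∫⁻ u in e.incident W,
                  ENNReal.ofReal ((1 - P.α) * fm e t x u) *
                    ENNReal.ofReal ((v.1 - W) ^ 2 * (P.kReg (v.1 - W, u.1 - W) * P.b v.2)) := by
                refine setLIntegral_congr_fun hme fun v hv => ?_
                have hc : 0 ≤ (1 - P.α) * (v.1 - W) ^ 2 := mul_nonneg hα1 (sq_nonneg _)
                rw [ENNReal.ofReal_mul hc, hJ, ofReal_integral_eq_lintegral_ofReal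
                  (hS.diffuse_integrable e t ht x hx v hv), ← lintegral_const_mul']
                · refine lintegral_congr_ae ?_
                  filter_upwards [ae_restrict_mem hmi, ae_restrict_of_ae (ae_fst_ne W)] with u hu hu0
                  rw [← ENNReal.ofReal_mul hc, ← ENNReal.ofReal_mul
                    (mul_nonneg hα1 (hfm0 u hu)), kReg_eq (sub_ne_zero.mpr hu0)]
                  congr 1
                  simp only [K, boost]
                  ring
                · exact ENNReal.ofReal_ne_top
                · filter_upwards [ae_restrict_mem hmi] with u hu
                  exact mul_nonneg (hKnn _ _) (hfm0 u hu)
            _ = ∫⁻ u in e.incident W, ∫⁻ v in e.emitted W,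
                  ENNReal.ofReal ((1 - P.α) * fm e t x u) *
                    ENNReal.ofReal ((v.1 - W) ^ 2 * (P.kReg (v.1 - W, u.1 - W) * P.b v.2)) := by
                refine lintegral_lintegral_swap (Measurable.aemeasurable ?_)
                refine Measurable.mul (Measurable.ennreal_ofReal
                  ((hfmm.comp measurable_snd).const_mul _)) (Measurable.ennreal_ofReal ?_)
                refine Measurable.mul (Continuous.measurable (by fun_prop)) (Measurable.mul ?_ ?_)
                · exact hP.kReg_measurable.comp (Continuous.measurable (by fun_prop))
                · exact hP.b_cont.measurable.comp (Continuous.measurable (by fun_prop))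
            _ = _ := by
                refine lintegral_congr_ae ?_
                filter_upwards [ae_restrict_mem hmi, ae_restrict_of_ae (ae_fst_ne W)] with u hu hu0
                rw [lintegral_const_mul' _ _ ENNReal.ofReal_ne_top]
                simp only [kReg_eq (sub_ne_zero.mpr hu0)]
                rw [hP.lintegral_emitted_kernel e W (sub_ne_zero.mpr hu0),
                  ← ENNReal.ofReal_mul (mul_nonneg hα1 (hfm0 u hu))]
                congr 1
                ring
    _ = _ := by
        rw [← lintegral_add_left]
        · refine setLIntegral_congr_fun hmi fun u hu => ?_
          rw [← ENNReal.ofReal_add (mul_nonneg (mul_nonneg hα0 (sq_nonneg _)) (hfm0 u hu))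
            (mul_nonneg (mul_nonneg hα1 (hP.moment_nonneg _)) (hfm0 u hu))]
          congr 1
          simp only [ell]
          ring
        · refine Measurable.ennreal_ofReal (Measurable.mul ?_ hfmm)
          exact Continuous.measurable (by fun_prop)

theorem Assumptions.sq_le_ell_add (hP : P.Assumptions p E Vinf γ₀) (w : ℝ) :
    0 ≤ P.ell w - w ^ 2 := by
  have h1 := hP.α_mem.1
  have h2 : 0 ≤ 1 - P.α := by linarith [hP.α_mem.2]
  have h3 := hP.moment_nonneg w
  have : P.ell w - w ^ 2 = P.α * w ^ 2 + (1 - P.α) * P.moment w := by unfold ell; ring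
  rw [this]
  positivity

/-- The force on one end, in terms of the incident density alone. -/
theorem IsSolution.faceForce_eq (hS : P.IsSolution E V₀ V fm fp)
    (hP : P.Assumptions p E Vinf γ₀) (e : Face) {t : ℝ} (ht : 0 ≤ t) :
    IntegrableOn (fun q : Perp d × Vel d => P.ell (q.2.1 - V t) * fm e t q.1 q.2)
      (P.disc ×ˢ e.incident (V t)) ∧
    P.faceForce V fm fp t e =
      ∫ q in P.disc ×ˢ e.incident (V t), P.ell (q.2.1 - V t) * fm e t q.1 q.2 := by
  have hmi := Face.measurableSet_incident (d := d) e (V t)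
  have hme := Face.measurableSet_emitted (d := d) e (V t)
  have hmd : MeasurableSet P.disc := Metric.isClosed_closedBall.measurableSet
  obtain ⟨M, hM⟩ := hS.fm_bdd
  obtain ⟨M', hM'⟩ := hS.fp_bdd
  have hfmm : Measurable fun q : Perp d × Vel d => fm e t q.1 q.2 := (hS.fm_measurable e).comp
    (measurable_const.prodMk measurable_id)
  have hfpm : Measurable fun q : Perp d × Vel d => fp e t q.1 q.2 := (hS.fp_measurable e).comp
    (measurable_const.prodMk measurable_id)
  have hm1 : Measurable fun q : Perp d × Vel d => q.2.1 - V t :=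
    Continuous.measurable (by fun_prop)
  have hG : Measurable fun q : Perp d × Vel d =>
      (P.ell (q.2.1 - V t) - (q.2.1 - V t) ^ 2) * fm e t q.1 q.2 :=
    ((hP.ell_measurable.comp hm1).sub (hm1.pow_const 2)).mul hfmm
  have hF : Measurable fun q : Perp d × Vel d => (q.2.1 - V t) ^ 2 * fp e t q.1 q.2 :=
    (hm1.pow_const 2).mul hfpm
  have hFnn : ∀ᵐ q ∂(volume : Measure (Perp d × Vel d)).restrict (P.disc ×ˢ e.emitted (V t)),
      0 ≤ (q.2.1 - V t) ^ 2 * fp e t q.1 q.2 := by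
    filter_upwards [ae_restrict_mem (hmd.prod hme)] with q hq
    exact mul_nonneg (sq_nonneg _) (hM' e t ht q.1 hq.1 q.2 hq.2).1
  have hGnn : ∀ᵐ q ∂(volume : Measure (Perp d × Vel d)).restrict (P.disc ×ˢ e.incident (V t)),
      0 ≤ (P.ell (q.2.1 - V t) - (q.2.1 - V t) ^ 2) * fm e t q.1 q.2 := by
    filter_upwards [ae_restrict_mem (hmd.prod hmi)] with q hq
    exact mul_nonneg (hP.sq_le_ell_add _) (hM e t ht q.1 hq.1 q.2 hq.2).1
  have hlint : ∫⁻ q in P.disc ×ˢ e.emitted (V t),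
      ENNReal.ofReal ((q.2.1 - V t) ^ 2 * fp e t q.1 q.2) =
      ∫⁻ q in P.disc ×ˢ e.incident (V t),
        ENNReal.ofReal ((P.ell (q.2.1 - V t) - (q.2.1 - V t) ^ 2) * fm e t q.1 q.2) := by
    rw [Measure.volume_eq_prod, ← Measure.prod_restrict, ← Measure.prod_restrict,
      lintegral_prod _ hF.ennreal_ofReal.aemeasurable,
      lintegral_prod _ hG.ennreal_ofReal.aemeasurable]
    exact setLIntegral_congr_fun hmd fun x hx => hS.lintegral_emitted hP e ht hx
  -- Finiteness is transferred from the emitted side, where it is part of the notion of solution, by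
  -- the equality of the nonnegative integrals.
  have hGi : IntegrableOn (fun q : Perp d × Vel d =>
      (P.ell (q.2.1 - V t) - (q.2.1 - V t) ^ 2) * fm e t q.1 q.2)
      (P.disc ×ˢ e.incident (V t)) := by
    refine ⟨hG.aestronglyMeasurable, ?_⟩
    rw [hasFiniteIntegral_iff_ofReal hGnn, ← hlint]
    exact (hasFiniteIntegral_iff_ofReal hFnn).mp (hS.emitted_integrable e t ht).2
  have hIi := hS.incident_integrable e t ht
  have heq : ∫ q in P.disc ×ˢ e.emitted (V t), (q.2.1 - V t) ^ 2 * fp e t q.1 q.2 =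
      ∫ q in P.disc ×ˢ e.incident (V t),
        (P.ell (q.2.1 - V t) - (q.2.1 - V t) ^ 2) * fm e t q.1 q.2 := by
    rw [integral_eq_lintegral_of_nonneg_ae hFnn hF.aestronglyMeasurable,
      integral_eq_lintegral_of_nonneg_ae hGnn hG.aestronglyMeasurable, hlint]
  have hsum : ∀ q : Perp d × Vel d, P.ell (q.2.1 - V t) * fm e t q.1 q.2 =
      (q.2.1 - V t) ^ 2 * fm e t q.1 q.2 +
        (P.ell (q.2.1 - V t) - (q.2.1 - V t) ^ 2) * fm e t q.1 q.2 := fun q => by ring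
  have hp1 := setIntegral_prod (μ := (volume : Measure (Perp d))) (ν := (volume : Measure (Vel d)))
    (fun q : Perp d × Vel d => (q.2.1 - V t) ^ 2 * fm e t q.1 q.2) hIi
  have hp2 := setIntegral_prod (μ := (volume : Measure (Perp d))) (ν := (volume : Measure (Vel d)))
    (fun q : Perp d × Vel d => (q.2.1 - V t) ^ 2 * fp e t q.1 q.2) (hS.emitted_integrable e t ht)
  simp only [hsum]
  refine ⟨hIi.add hGi, ?_⟩
  rw [integral_add hIi hGi, ← heq]
  unfold faceForce
  rw [← hp1, ← hp2]
  rfl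

/-! ### Splitting off the recollision force -/

/-- The part of the force on an end that is due to particles that met the body before. -/
def recollision (P : BodyGas d) (V : ℝ → ℝ) (fm : Face → ℝ → Perp d → Vel d → ℝ) (e : Face)
    (t : ℝ) : ℝ :=
  ∫ q in P.disc ×ˢ e.incident (V t), P.ell (q.2.1 - V t) * (fm e t q.1 q.2 - P.f₀ q.2)

theorem Assumptions.integrableOn_ell_f₀ (hP : P.Assumptions p E Vinf γ₀) (e : Face) {W : ℝ}
    (hW : |W - Vinf| ≤ γ₀) :
    IntegrableOn (fun v : Vel d => P.ell (v.1 - W) * P.f₀ v) (e.incident W) := by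
  obtain ⟨g, hg, hdom⟩ := hP.ell_dominated
  obtain ⟨i1, i2⟩ := integrableOn_pressure hP.a₀_cont hP.a₀_nonneg
    (fun w hw => hP.ell_differentiableAt (ne_of_lt hw)) (fun w _ => hP.ell_nonneg w) hg hdom hW
  have h1 : IntegrableOn (fun v => P.ell (v - W) * P.a₀ v) ((fun v => W - v) ⁻¹' e.halfLine) := by
    cases e
    · have hmp := measurePreserving_sub_right (volume : Measure ℝ) W
      have hemb := (MeasurableEquiv.subRight W).measurableEmbedding
      have := (hmp.integrableOn_comp_preimage hemb
        (f := fun w => P.ell w * P.a₀ (w + W)) (s := Iic 0)).mpr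
        (i1.congr_set_ae Iio_ae_eq_Iic.symm)
      have hset : (fun v => W - v) ⁻¹' Face.right.halfLine = (fun v => v - W) ⁻¹' Iic 0 := by
        ext v; simp [Face.halfLine]
      rw [hset]
      refine this.congr ?_
      filter_upwards with v
      simp
    · have hmp := (volume : Measure ℝ).measurePreserving_sub_left W
      have hemb := (MeasurableEquiv.subLeft W).measurableEmbedding
      have := (hmp.integrableOn_comp_preimage hemb
        (f := fun w => P.ell w * P.a₀ (w - W)) (s := Iic 0)).mpr
        (i2.congr_set_ae Iio_ae_eq_Iic.symm)
      refine this.congr ?_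
      filter_upwards with v
      simp only [Function.comp_apply]
      rw [← hP.ell_neg, ← hP.a₀_even]
      congr 2 <;> ring
  have h2 : ∀ v : Vel d, P.ell (v.1 - W) * P.f₀ v =
      (fun v => P.ell (v - W) * P.a₀ v) v.1 * P.b v.2 := fun v => by simp only [f₀]; ring
  simp only [h2]
  rw [Face.incident_eq, IntegrableOn, Measure.volume_eq_prod, ← Measure.prod_restrict,
    Measure.restrict_univ]
  exact Integrable.mul_prod h1 hP.b_integrable

theorem IsSolution.integrableOn_recollision (hS : P.IsSolution E V₀ V fm fp)
    (hP : P.Assumptions p E Vinf γ₀) (e : Face) {t : ℝ} (ht : 0 ≤ t) (hV : |V t - Vinf| ≤ γ₀) :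
    IntegrableOn (fun q : Perp d × Vel d => P.ell (q.2.1 - V t) * P.f₀ q.2)
      (P.disc ×ˢ e.incident (V t)) ∧
    IntegrableOn (fun q : Perp d × Vel d =>
      P.ell (q.2.1 - V t) * (fm e t q.1 q.2 - P.f₀ q.2)) (P.disc ×ˢ e.incident (V t)) := by
  have : IsFiniteMeasure ((volume : Measure (Perp d)).restrict P.disc) :=
    ⟨by rw [Measure.restrict_apply_univ]; exact measure_closedBall_lt_top⟩
  have h1 : IntegrableOn (fun q : Perp d × Vel d => P.ell (q.2.1 - V t) * P.f₀ q.2)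
      (P.disc ×ˢ e.incident (V t)) := by
    rw [IntegrableOn, Measure.volume_eq_prod, ← Measure.prod_restrict]
    exact Integrable.comp_snd (hP.integrableOn_ell_f₀ e hV) _
  refine ⟨h1, ((hS.faceForce_eq hP e ht).1.sub h1).congr ?_⟩
  filter_upwards with q
  simp only [Pi.sub_apply]
  ring

theorem IsSolution.faceForce_eq_add (hS : P.IsSolution E V₀ V fm fp)
    (hP : P.Assumptions p E Vinf γ₀) (e : Face) {t : ℝ} (ht : 0 ≤ t) (hV : |V t - Vinf| ≤ γ₀) :
    P.faceForce V fm fp t e = P.recollision V fm e t +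
      volume.real P.disc * ∫ v in e.incident (V t), P.ell (v.1 - V t) * P.f₀ v := by
  obtain ⟨h1, h2⟩ := hS.integrableOn_recollision hP e ht hV
  rw [(hS.faceForce_eq hP e ht).2]
  have h3 : ∫ q in P.disc ×ˢ e.incident (V t), P.ell (q.2.1 - V t) * P.f₀ q.2 =
      volume.real P.disc * ∫ v in e.incident (V t), P.ell (v.1 - V t) * P.f₀ v := by
    have := setIntegral_prod_mul (μ := (volume : Measure (Perp d)))
      (ν := (volume : Measure (Vel d))) (fun _ => (1 : ℝ))
      (fun v => P.ell (v.1 - V t) * P.f₀ v) P.disc (e.incident (V t))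
    simp only [one_mul, setIntegral_const, smul_eq_mul, mul_one] at this
    exact this
  rw [← h3, recollision, ← integral_add h2 h1]
  congr 1
  ext q
  ring

/-- Replacing f₋ by f₀ on both ends turns the force into F₀. The differences are the memory terms of
the equation for V∞ - V. -/
theorem IsSolution.force_eq (hS : P.IsSolution E V₀ V fm fp)
    (hP : P.Assumptions p E Vinf γ₀) {t : ℝ} (ht : 0 ≤ t) (hV : |V t - Vinf| ≤ γ₀) :
    P.force V fm fp t = P.F₀ (V t) + P.recollision V fm .right t - P.recollision V fm .left t := by
  unfold force F₀
  rw [hS.faceForce_eq_add hP .right ht hV, hS.faceForce_eq_add hP .left ht hV]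
  simp only [Face.incident]
  ring

end BodyGas

/-! ### Geometry of precollisions -/

theorem timeAvg_const_sub {V : ℝ → ℝ} (hV : Continuous V) (c : ℝ) {s t : ℝ} (hst : s < t) :
    timeAvg (fun τ => c - V τ) s t = c - timeAvg V s t := by
  unfold timeAvg
  rw [intervalIntegral.integral_sub (continuous_const.intervalIntegrable _ _)
    (hV.intervalIntegrable _ _), intervalIntegral.integral_const, smul_eq_mul]
  have : t - s ≠ 0 := by linarith
  field_simp

theorem hasDerivAt_displacement {V : ℝ → ℝ} (hV : Continuous V) (t u s : ℝ) :
    HasDerivAt (fun s => (∫ τ in s..t, V τ) - (t - s) * u) (u - V s) s := by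
  have h1 : HasDerivAt (fun s => ∫ τ in s..t, V τ) (-V s) s :=
    intervalIntegral.integral_hasDerivAt_left (hV.intervalIntegrable _ _)
      (hV.stronglyMeasurableAtFilter _ _) hV.continuousAt
  exact (h1.sub (((hasDerivAt_id s).const_sub t).mul_const u)).congr_deriv (by ring)

/-- A velocity between the mean velocity and the final velocity of a body is the mean velocity over
a later time interval that begins when the body is not faster. -/
theorem exists_overtaking {V : ℝ → ℝ} (hV : Continuous V) {t u : ℝ} (ht : 0 < t)
    (h1 : timeAvg V 0 t < u) (h2 : u < V t) :
    ∃ s ∈ Ioo 0 t, (t - s) * u = ∫ τ in s..t, V τ ∧ V s ≤ u := by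
  by_contra! hcon
  -- The displacement of the body relative to the particle is negative at time 0. Without the
  -- required s it could only cross zero downwards, so it would still be negative at time t, where
  -- it vanishes.
  have hbar := barrier (a := 0) (fun s _ => hasDerivAt_displacement hV t u s)
    (by
      unfold timeAvg at h1
      rw [sub_zero, div_lt_iff₀ ht] at h1
      simp only [sub_zero]
      linarith)
    (by
      intro s hs hpast h0
      rcases lt_trichotomy s t with hst | rfl | hst
      · have := hcon s ⟨hs, hst⟩ (by linarith)
        linarith
      · linarith
      · have := hpast t ⟨ht.le, hst⟩
        simp at this)
    t ht.le
  simp at hbar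

namespace BodyGas

variable {P : BodyGas d} {p E Vinf γ₀ V₀ γb : ℝ} {V : ℝ → ℝ}
  {fm fp : Face → ℝ → Perp d → Vel d → ℝ}

theorem fst_eq_timeAvg {e : Face} {t s : ℝ} {x : Perp d} {u : Vel d}
    (h : s ∈ P.precollisions V e t x u) : u.1 = timeAvg V s t := by
  unfold timeAvg
  rw [eq_div_iff (by linarith [h.2.1]), mul_comm]
  exact h.2.2.1

/-- If u_x ≠ V(t), the relative displacement has nonzero derivative at t, so precollisions stay away
from t; the closed conditions then give compactness. -/
theorem exists_isGreatest_precollisions (hV : Continuous V) {e : Face} {t : ℝ} {x : Perp d}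
    {u : Vel d} (hu : u.1 ≠ V t) (hne : (P.precollisions V e t x u).Nonempty) :
    ∃ τ, IsGreatest (P.precollisions V e t x u) τ := by
  obtain ⟨s₀, hs₀⟩ := hne
  have h1 := (hasDerivAt_displacement hV t u.1 t).eventually_ne (sub_ne_zero.mpr hu) (c := 0)
  obtain ⟨η, hη, h2⟩ := Metric.eventually_nhds_iff.mp (eventually_nhdsWithin_iff.mp h1)
  have hlate : ∀ s ∈ P.precollisions V e t x u, s ≤ t - η := by
    intro s hs
    by_contra! hcon
    refine h2 (y := s) ?_ (ne_of_lt hs.2.1) ?_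
    · rw [Real.dist_eq, abs_lt]
      constructor <;> linarith [hs.2.1]
    · linarith [hs.2.2.1]
  have hemit : IsClosed {s | u ∈ e.emitted (V s)} := by
    cases e
    · exact isClosed_le hV continuous_const
    · exact isClosed_le continuous_const hV
  have hint : Continuous fun s => ∫ τ in s..t, V τ := continuous_iff_continuousAt.mpr fun s =>
    (intervalIntegral.integral_hasDerivAt_left (hV.intervalIntegrable _ _)
      (hV.stronglyMeasurableAtFilter _ _) hV.continuousAt).continuousAt
  have hcl : IsClosed {s : ℝ | (t - s) * u.1 = ∫ τ in s..t, V τ} :=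
    isClosed_eq (by fun_prop) hint
  have hcl' : IsClosed {s : ℝ | ‖x - (t - s) • u.2‖ ≤ P.r} :=
    isClosed_le (by fun_prop) continuous_const
  have hcomp : IsCompact (Icc s₀ (t - η) ∩ ({s : ℝ | (t - s) * u.1 = ∫ τ in s..t, V τ} ∩
      ({s : ℝ | ‖x - (t - s) • u.2‖ ≤ P.r} ∩ {s | u ∈ e.emitted (V s)}))) :=
    isCompact_Icc.inter_right (hcl.inter (hcl'.inter hemit))
  obtain ⟨τ, hτ⟩ := hcomp.exists_isGreatest
    ⟨s₀, ⟨le_rfl, hlate s₀ hs₀⟩, hs₀.2.2.1, hs₀.2.2.2.1, hs₀.2.2.2.2⟩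
  refine ⟨τ, ⟨hs₀.1.trans_le hτ.1.1.1, ?_, hτ.1.2.1, hτ.1.2.2.1, hτ.1.2.2.2⟩, ?_⟩
  · have := hτ.1.1.2
    linarith
  · intro s hs
    rcases le_total s₀ s with h3 | h3
    · exact hτ.2 ⟨⟨h3, hlate s hs⟩, hs.2.2.1, hs.2.2.2.1, hs.2.2.2.2⟩
    · exact h3.trans hτ.1.1.1

/-- The incident density is either the initial one or it comes from an earlier emission. -/
theorem IsSolution.incident_cases (hS : P.IsSolution E V₀ V fm fp) {e : Face} {t : ℝ} (ht : 0 ≤ t)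
    {x : Perp d} (hx : x ∈ P.disc) {u : Vel d} (hu : u ∈ e.incident (V t)) :
    fm e t x u = P.f₀ u ∨ ∃ τ ∈ P.precollisions V e t x u,
      x - (t - τ) • u.2 ∈ P.disc ∧ fm e t x u = fp e τ (x - (t - τ) • u.2) u := by
  by_cases h : ∃ τ, IsGreatest (P.precollisions V e t x u) τ
  · obtain ⟨τ, hτ⟩ := h
    refine Or.inr ⟨τ, hτ.1, ?_, hS.transport e t ht x hx u hu τ hτ⟩
    simpa [disc] using hτ.1.2.2.2.1
  · exact Or.inl (hS.transport_init e t ht x hx u hu h)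

/-- A recolliding particle moves with a mean velocity of the body, and these all exceed V∞ - γb. -/
theorem IsSolution.incident_eq_f₀_of_slow (hS : P.IsSolution E V₀ V fm fp) {t : ℝ} (ht : 0 ≤ t)
    (hist : ∀ s ∈ Icc 0 t, 0 ≤ Vinf - V s ∧ Vinf - V s < γb)
    {x : Perp d} (hx : x ∈ P.disc) {u : Vel d} (hu : u.1 ≤ Vinf - γb) :
    fm .right t x u = P.f₀ u := by
  have hinc : u ∈ Face.right.incident (V t) := by
    have := (hist t ⟨ht, le_rfl⟩).2
    show u.1 ≤ V t
    linarith
  rcases hS.incident_cases ht hx hinc with h | ⟨τ, hτ, -, -⟩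
  · exact h
  · have h1 : Vinf - γb < timeAvg V τ t :=
      lt_timeAvg hS.contDiff.continuous hτ.2.1 fun s hs => by
        have := (hist s ⟨hτ.1.le.trans hs.1, hs.2.le⟩).2
        linarith
    rw [← fst_eq_timeAvg hτ] at h1
    linarith

/-! ### Bounds of the densities at the right end -/

/-- The density of diffusively emitted particles at the right end, up to the factor `b`. -/
def gain (P : BodyGas d) (V : ℝ → ℝ) (fm : Face → ℝ → Perp d → Vel d → ℝ) (t : ℝ) (x : Perp d)
    (v : ℝ) : ℝ :=
  ∫ u in Face.right.incident (V t), P.k (v - V t) (u.1 - V t) * fm .right t x u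

theorem IsSolution.gain_integrable (hS : P.IsSolution E V₀ V fm fp)
    (hP : P.Assumptions p E Vinf γ₀) {t : ℝ} (ht : 0 ≤ t) {x : Perp d} (hx : x ∈ P.disc) {v : ℝ}
    (hv : V t ≤ v) :
    IntegrableOn (fun u : Vel d => P.k (v - V t) (u.1 - V t) * fm .right t x u)
      (Face.right.incident (V t)) := by
  have h1 := (hS.diffuse_integrable .right t ht x hx (v, 0) hv).const_mul (P.b 0)⁻¹
  refine h1.congr ?_
  filter_upwards with u
  have := hP.b_zero_pos.ne'
  simp only [K, boost]
  field_simp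

theorem IsSolution.emitted_eq (hS : P.IsSolution E V₀ V fm fp) {t : ℝ} (ht : 0 ≤ t) {x : Perp d}
    (hx : x ∈ P.disc) {v : Vel d} (hv : V t ≤ v.1) :
    fp .right t x v = P.α * fm .right t x (2 * V t - v.1, v.2) +
      (1 - P.α) * (P.b v.2 * P.gain V fm t x v.1) := by
  rw [hS.reflection .right t ht x hx v hv, gain, ← integral_const_mul (P.b v.2)]
  have h : ∀ u : Vel d, P.K (boost (V t) v) (boost (V t) u) * fm .right t x u =
      P.b v.2 * (P.k (v.1 - V t) (u.1 - V t) * fm .right t x u) := fun u => by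
    simp only [K, boost]
    ring
  simp only [h]

theorem IsSolution.fm_nonneg (hS : P.IsSolution E V₀ V fm fp) {e : Face} {t : ℝ} (ht : 0 ≤ t)
    {x : Perp d} (hx : x ∈ P.disc) {u : Vel d} (hu : u ∈ e.incident (V t)) : 0 ≤ fm e t x u := by
  obtain ⟨M, hM⟩ := hS.fm_bdd
  exact (hM e t ht x hx u hu).1

/-- Discard the specular part and keep only incident velocities below V∞ - γ₀, where the density is
still f₀; then apply (A5). It is stated for v ≤ 0, and evenness of k carries it to emitted
velocities. -/
theorem IsSolution.le_emitted (hS : P.IsSolution E V₀ V fm fp)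
    (hP : P.Assumptions p E Vinf γ₀) {δ : ℝ}
    (hδ : ∀ v ∈ Icc (-γ₀) 0, ∀ η ∈ Icc (Vinf - γ₀) Vinf,
      P.a₀ Vinf + δ ≤ (1 - P.α) * ∫ u in Iic (Vinf - γ₀), P.k v (u - η) * P.a₀ u)
    (hγb : γb ≤ γ₀) {t : ℝ} (ht : 0 ≤ t)
    (hist : ∀ s ∈ Icc 0 t, 0 ≤ Vinf - V s ∧ Vinf - V s < γb)
    {x : Perp d} (hx : x ∈ P.disc) {u : Vel d} (hu1 : V t ≤ u.1) (hu2 : u.1 ≤ Vinf) :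
    (P.a₀ Vinf + δ) * P.b u.2 ≤ fp .right t x u := by
  have hα0 := hP.α_mem.1
  have hα1 : 0 ≤ 1 - P.α := by linarith [hP.α_mem.2]
  have hVt := hist t ⟨ht, le_rfl⟩
  have hinc : ((2 * V t - u.1, u.2) : Vel d) ∈ Face.right.incident (V t) := by
    show 2 * V t - u.1 ≤ V t
    linarith
  rw [hS.emitted_eq ht hx hu1]
  have h1 := mul_nonneg hα0 (hS.fm_nonneg ht hx hinc)
  have h2 : ∫ w in Iic (Vinf - γ₀), P.k (u.1 - V t) (w - V t) * P.a₀ w ≤ P.gain V fm t x u.1 := by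
    have hsub : Iic (Vinf - γ₀) ×ˢ (univ : Set (Perp d)) ⊆ Face.right.incident (V t) := by
      intro w hw
      have : w.1 ≤ Vinf - γ₀ := hw.1
      show w.1 ≤ V t
      linarith
    have h3 : ∫ w in Iic (Vinf - γ₀) ×ˢ (univ : Set (Perp d)),
        P.k (u.1 - V t) (w.1 - V t) * fm .right t x w =
        ∫ w in Iic (Vinf - γ₀), P.k (u.1 - V t) (w - V t) * P.a₀ w := by
      have := setIntegral_prod_mul (μ := (volume : Measure ℝ)) (ν := (volume : Measure (Perp d)))
        (fun w => P.k (u.1 - V t) (w - V t) * P.a₀ w) P.b (Iic (Vinf - γ₀)) univ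
      rw [setIntegral_univ, hP.b_mass, mul_one] at this
      rw [← this]
      refine setIntegral_congr_fun (measurableSet_Iic.prod MeasurableSet.univ) fun w hw => ?_
      have hw' : w.1 ≤ Vinf - γb := by
        have : w.1 ≤ Vinf - γ₀ := hw.1
        linarith
      simp only [hS.incident_eq_f₀_of_slow ht hist hx hw', f₀]
      ring
    rw [← h3]
    refine setIntegral_mono_set (hS.gain_integrable hP ht hx hu1) ?_ hsub.eventuallyLE
    filter_upwards [ae_restrict_mem (Face.measurableSet_incident _ _)] with w hw
    exact mul_nonneg (hP.k_nonneg _ _) (hS.fm_nonneg ht hx hw)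
  have h4 := hδ (-(u.1 - V t)) ⟨by linarith, by linarith⟩ (V t) ⟨by linarith, by linarith⟩
  simp only [hP.k_even_left] at h4
  have h5 : (P.a₀ Vinf + δ) ≤ (1 - P.α) * P.gain V fm t x u.1 :=
    h4.trans (mul_le_mul_of_nonneg_left h2 hα1)
  have h6 := mul_le_mul_of_nonneg_right h5 (hP.b_nonneg u.2)
  linarith

/-- Incident velocities below V∞ - γb carry f₀ and are covered by (A4). The others lie in a strip of
width at most γb, where the kernel is at most κ and the density at most N b. The unknown bound N
thus returns with the small factor κ γb. -/
theorem IsSolution.gain_le (hS : P.IsSolution E V₀ V fm fp)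
    (hP : P.Assumptions p E Vinf γ₀) {M₄ κ N : ℝ} (hN : 0 ≤ N)
    (hM₄ : ∀ v ∈ Icc (-γ₀) 0, ∀ η ∈ Icc (Vinf - γ₀) Vinf,
      IntegrableOn (fun u => P.k v (u - η) * P.a₀ u) (Iic Vinf) ∧
        ∫ u in Iic Vinf, P.k v (u - η) * P.a₀ u ≤ M₄)
    (hκ0 : 0 ≤ κ) (hκ : ∀ v u, |u| ≤ γ₀ → P.k v u ≤ κ) (hγb0 : 0 ≤ γb)
    (hγb : γb ≤ γ₀) {t : ℝ} (ht : 0 ≤ t)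
    (hist : ∀ s ∈ Icc 0 t, 0 ≤ Vinf - V s ∧ Vinf - V s < γb)
    {x : Perp d} (hx : x ∈ P.disc) {v : ℝ} (hv1 : V t ≤ v) (hv2 : v ≤ Vinf)
    (hle : ∀ u ∈ Face.right.incident (V t), fm .right t x u ≤ N * P.b u.2) :
    P.gain V fm t x v ≤ M₄ + κ * N * γb := by
  have hVt := hist t ⟨ht, le_rfl⟩
  obtain ⟨hi, hM⟩ := hM₄ (-(v - V t)) ⟨by linarith, by linarith⟩ (V t) ⟨by linarith, by linarith⟩
  simp only [hP.k_even_left] at hi hM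
  set S : Set (Vel d) := Iic Vinf ×ˢ univ with hSdef
  set χ : ℝ → ℝ := (Ioc (Vinf - γb) Vinf).indicator fun _ => 1 with hχ
  have hχi : IntegrableOn χ (Iic Vinf) := by
    refine ((integrable_indicator_iff measurableSet_Ioc).mpr ?_).integrableOn
    exact integrableOn_const (by simp)
  have hχint : ∫ w in Iic Vinf, χ w = γb := by
    rw [hχ, setIntegral_indicator measurableSet_Ioc,
      inter_eq_self_of_subset_right Ioc_subset_Iic_self]
    simp [hγb0]
  have hG1 : IntegrableOn (fun w : Vel d => (P.k (v - V t) (w.1 - V t) * P.a₀ w.1) * P.b w.2) S := by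
    rw [hSdef, IntegrableOn, Measure.volume_eq_prod, ← Measure.prod_restrict, Measure.restrict_univ]
    exact Integrable.mul_prod hi hP.b_integrable
  have hG2 : IntegrableOn (fun w : Vel d => χ w.1 * P.b w.2) S := by
    rw [hSdef, IntegrableOn, Measure.volume_eq_prod, ← Measure.prod_restrict, Measure.restrict_univ]
    exact Integrable.mul_prod hχi hP.b_integrable
  have hI1 : ∫ w in S, (P.k (v - V t) (w.1 - V t) * P.a₀ w.1) * P.b w.2 ≤ M₄ := by
    have := setIntegral_prod_mul (μ := (volume : Measure ℝ)) (ν := (volume : Measure (Perp d)))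
      (fun w => P.k (v - V t) (w - V t) * P.a₀ w) P.b (Iic Vinf) univ
    rw [setIntegral_univ, hP.b_mass, mul_one] at this
    exact this.le.trans hM
  have hI2 : ∫ w in S, χ w.1 * P.b w.2 = γb := by
    have := setIntegral_prod_mul (μ := (volume : Measure ℝ)) (ν := (volume : Measure (Perp d)))
      χ P.b (Iic Vinf) univ
    rw [setIntegral_univ, hP.b_mass, mul_one, hχint] at this
    exact this
  have hχ0 : ∀ w, 0 ≤ χ w := fun w => indicator_nonneg (fun _ _ => zero_le_one) w
  have hGnn : ∀ w : Vel d, 0 ≤ (P.k (v - V t) (w.1 - V t) * P.a₀ w.1) * P.b w.2 +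
      κ * N * (χ w.1 * P.b w.2) := fun w => by
    have := hP.k_nonneg (v - V t) (w.1 - V t)
    have := hP.a₀_nonneg w.1
    have := hP.b_nonneg w.2
    have := hχ0 w.1
    positivity
  have hsub : Face.right.incident (V t) ⊆ S := fun w hw => by
    have : w.1 ≤ V t := hw
    exact ⟨by show w.1 ≤ Vinf; linarith, mem_univ _⟩
  calc P.gain V fm t x v ≤ ∫ w in Face.right.incident (V t),
        ((P.k (v - V t) (w.1 - V t) * P.a₀ w.1) * P.b w.2 + κ * N * (χ w.1 * P.b w.2)) := by
        refine setIntegral_mono_on (hS.gain_integrable hP ht hx hv1)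
          ((hG1.add (hG2.const_mul (κ * N))).mono_set hsub) (Face.measurableSet_incident _ _) ?_
        intro w hw
        have hk := hP.k_nonneg (v - V t) (w.1 - V t)
        have hb := hP.b_nonneg w.2
        by_cases hslow : w.1 ≤ Vinf - γb
        · rw [hS.incident_eq_f₀_of_slow ht hist hx hslow, f₀]
          have := mul_nonneg (mul_nonneg hκ0 hN) (mul_nonneg (hχ0 w.1) hb)
          linarith
        · push Not at hslow
          have hw' : w.1 ≤ V t := hw
          have h1 : χ w.1 = 1 := indicator_of_mem (by constructor <;> linarith) _
          have h2 : P.k (v - V t) (w.1 - V t) ≤ κ := hκ _ _ (by rw [abs_le]; constructor <;> linarith)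
          have h3 := mul_le_mul h2 (hle w hw) (hS.fm_nonneg ht hx hw) hκ0
          have h4 := mul_nonneg (mul_nonneg hk (hP.a₀_nonneg w.1)) hb
          rw [h1]
          linarith
    _ ≤ ∫ w in S, ((P.k (v - V t) (w.1 - V t) * P.a₀ w.1) * P.b w.2 + κ * N * (χ w.1 * P.b w.2)) :=
        setIntegral_mono_set (hG1.add (hG2.const_mul (κ * N)))
          (Eventually.of_forall hGnn) hsub.eventuallyLE
    _ ≤ M₄ + κ * N * γb := by
        rw [integral_add hG1 (hG2.const_mul _), integral_const_mul, hI2]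
        linarith

/-- A bound of the incident density at the right end by a multiple of `b`, uniform in the
solution. -/
theorem IsSolution.incident_le (hS : P.IsSolution E V₀ V fm fp)
    (hP : P.Assumptions p E Vinf γ₀) {M₄ κ S : ℝ}
    (hM₄ : ∀ v ∈ Icc (-γ₀) 0, ∀ η ∈ Icc (Vinf - γ₀) Vinf,
      IntegrableOn (fun u => P.k v (u - η) * P.a₀ u) (Iic Vinf) ∧
        ∫ u in Iic Vinf, P.k v (u - η) * P.a₀ u ≤ M₄)
    (hκ0 : 0 ≤ κ) (hκ : ∀ v u, |u| ≤ γ₀ → P.k v u ≤ κ) (hγb0 : 0 ≤ γb)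
    (hγb : γb ≤ γ₀) (hκγ : κ * γb ≤ 1 / 2) (hSa : ∀ v, P.a₀ v ≤ S) (hSM : 2 * M₄ ≤ S) {T : ℝ}
    (hist : ∀ s ∈ Icc 0 T, 0 ≤ Vinf - V s ∧ Vinf - V s < γb) :
    ∀ t ∈ Icc 0 T, ∀ x ∈ P.disc, ∀ u ∈ Face.right.incident (V t),
      fm .right t x u ≤ S * P.b u.2 := by
  have hα0 := hP.α_mem.1
  have hα1 : 0 < 1 - P.α := by linarith [hP.α_mem.2]
  have hS0 : 0 ≤ S := (hP.a₀_nonneg 0).trans (hSa 0)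
  have hf₀ : ∀ u : Vel d, P.f₀ u ≤ S * P.b u.2 := fun u =>
    mul_le_mul_of_nonneg_right (hSa _) (hP.b_nonneg _)
  obtain ⟨M, hM⟩ := hS.fm_bdd
  obtain ⟨M', hM'⟩ := hS.fp_bdd
  -- The bound of f₊ at vanishing transversal velocity, divided by b(0), controls the gain.
  set N₁ := max (M' / P.b 0) 0 with hN₁
  have hN₁0 : 0 ≤ N₁ := le_max_right _ _
  have hgain : ∀ t ∈ Icc 0 T, ∀ x ∈ P.disc, ∀ v, V t ≤ v → (1 - P.α) * P.gain V fm t x v ≤ N₁ := by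
    intro t ht x hx v hv
    refine le_trans ?_ (le_max_left _ _)
    rw [le_div_iff₀ hP.b_zero_pos]
    have h1 := (hM' .right t ht.1 x hx (v, 0) hv).2
    rw [hS.emitted_eq ht.1 hx (show V t ≤ ((v, 0) : Vel d).1 from hv)] at h1
    have h2 : ((2 * V t - v, 0) : Vel d) ∈ Face.right.incident (V t) := by
      show 2 * V t - v ≤ V t
      linarith
    have h3 := mul_nonneg hα0 (hS.fm_nonneg ht.1 hx h2)
    simp only at h1
    linarith
  -- the incident density at a recollision in terms of the previous collision
  have step : ∀ (A B : ℝ), 0 ≤ A → 0 ≤ B →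
      (∀ t ∈ Icc 0 T, ∀ x ∈ P.disc, ∀ u ∈ Face.right.incident (V t),
        fm .right t x u ≤ A * P.b u.2 + B) → ∀ G : ℝ,
      (∀ t ∈ Icc 0 T, ∀ x ∈ P.disc, ∀ v, V t ≤ v → v ≤ Vinf → (1 - P.α) * P.gain V fm t x v ≤ G) →
      ∀ t ∈ Icc 0 T, ∀ x ∈ P.disc, ∀ u ∈ Face.right.incident (V t),
        fm .right t x u ≤ max S (P.α * A + G) * P.b u.2 + P.α * B := by
    intro A B hA hB hle G hG t ht x hx u hu
    have hαB := mul_nonneg hα0 hB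
    rcases hS.incident_cases ht.1 hx hu with h | ⟨τ, hτ, hy, h⟩
    · rw [h]
      have := mul_le_mul_of_nonneg_right (le_max_left S (P.α * A + G)) (hP.b_nonneg u.2)
      linarith [hf₀ u]
    · have hτT : τ ∈ Icc 0 T := ⟨hτ.1.le, hτ.2.1.le.trans ht.2⟩
      have hem : V τ ≤ u.1 := hτ.2.2.2.2
      have huV : u.1 ≤ V t := hu
      have hVt := (hist t ht).1
      rw [h, hS.emitted_eq hτT.1 hy hem]
      have h2 : ((2 * V τ - u.1, u.2) : Vel d) ∈ Face.right.incident (V τ) := by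
        show 2 * V τ - u.1 ≤ V τ
        linarith
      have h3 := mul_le_mul_of_nonneg_left (hle τ hτT _ hy _ h2) hα0
      have h4 := mul_le_mul_of_nonneg_right (hG τ hτT _ hy u.1 hem (by linarith)) (hP.b_nonneg u.2)
      have h5 := mul_le_mul_of_nonneg_right (le_max_right S (P.α * A + G)) (hP.b_nonneg u.2)
      simp only at h3
      linarith
  -- a bound that depends on the solution
  set N := max S (N₁ / (1 - P.α)) with hN
  have hNS : S ≤ N := le_max_left _ _
  have hN0 : 0 ≤ N := hS0.trans hNS
  have hNN₁ : P.α * N + N₁ ≤ N := by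
    have : N₁ / (1 - P.α) ≤ N := le_max_right _ _
    rw [div_le_iff₀ hα1] at this
    linarith
  have hrough : ∀ t ∈ Icc 0 T, ∀ x ∈ P.disc, ∀ u ∈ Face.right.incident (V t),
      fm .right t x u ≤ N * P.b u.2 := by
    -- Boundedness alone does not give a multiple of b. Each step back to the previous collision
    -- multiplies the surplus constant by α < 1, so it disappears in the limit.
    have hpow : ∀ n : ℕ, ∀ t ∈ Icc 0 T, ∀ x ∈ P.disc, ∀ u ∈ Face.right.incident (V t),
        fm .right t x u ≤ N * P.b u.2 + P.α ^ n * max M 0 := by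
      intro n
      induction n with
      | zero =>
        intro t ht x hx u hu
        have h1 := (hM .right t ht.1 x hx u hu).2
        have h2 := mul_nonneg hN0 (hP.b_nonneg u.2)
        have h3 := le_max_left M 0
        simp only [pow_zero, one_mul]
        linarith
      | succ n ih =>
        intro t ht x hx u hu
        have h1 := step N (P.α ^ n * max M 0) hN0 (by positivity) ih N₁
          (fun t ht x hx v hv _ => hgain t ht x hx v hv) t ht x hx u hu
        have h2 := mul_le_mul_of_nonneg_right (max_le hNS hNN₁) (hP.b_nonneg u.2)
        rw [pow_succ]
        linarith
    intro t ht x hx u hu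
    have hlim : Tendsto (fun n : ℕ => N * P.b u.2 + P.α ^ n * max M 0) atTop
        (nhds (N * P.b u.2 + 0 * max M 0)) :=
      ((tendsto_pow_atTop_nhds_zero_of_lt_one hα0 hP.α_mem.2).mul_const _).const_add _
    rw [zero_mul, add_zero] at hlim
    exact ge_of_tendsto hlim (Eventually.of_forall fun n => hpow n t ht x hx u hu)
  -- improvement by contraction
  set ρ := (1 + P.α) / 2 with hρ
  have hρ0 : 0 ≤ ρ := by positivity
  have hρ1 : ρ < 1 := by rw [hρ]; linarith
  have hpow : ∀ n : ℕ, ∀ t ∈ Icc 0 T, ∀ x ∈ P.disc, ∀ u ∈ Face.right.incident (V t),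
      fm .right t x u ≤ (S + ρ ^ n * N) * P.b u.2 := by
    intro n
    induction n with
    | zero =>
      intro t ht x hx u hu
      have h1 := hrough t ht x hx u hu
      have h2 := mul_nonneg hS0 (hP.b_nonneg u.2)
      simp only [pow_zero, one_mul]
      linarith
    | succ n ih =>
      intro t ht x hx u hu
      have hA0 : 0 ≤ S + ρ ^ n * N := by positivity
      have h1 := step (S + ρ ^ n * N) 0 hA0 le_rfl (fun t ht x hx u hu => by
          rw [add_zero]; exact ih t ht x hx u hu)
        ((1 - P.α) * (S / 2 + (S + ρ ^ n * N) / 2))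
        (fun t ht x hx v hv1 hv2 => by
          have h2 := hS.gain_le hP hA0 hM₄ hκ0 hκ hγb0 hγb ht.1
            (fun s hs => hist s ⟨hs.1, hs.2.trans ht.2⟩) hx hv1 hv2 (ih t ht x hx)
          have h3 := mul_le_mul_of_nonneg_right hκγ hA0
          refine mul_le_mul_of_nonneg_left ?_ hα1.le
          linarith) t ht x hx u hu
      -- With κ γb ≤ 1/2 the recursion is A ↦ ρA + (1 - ρ)S with ρ = (1 + α)/2. Its fixed point is
      -- S, which does not depend on the solution.
      have h4 : max S (P.α * (S + ρ ^ n * N) + (1 - P.α) * (S / 2 + (S + ρ ^ n * N) / 2)) ≤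
          S + ρ ^ (n + 1) * N := by
        refine max_le (by have : 0 ≤ ρ ^ (n + 1) * N := by positivity
                          linarith) (le_of_eq ?_)
        rw [pow_succ, hρ]
        ring
      have h5 := mul_le_mul_of_nonneg_right h4 (hP.b_nonneg u.2)
      linarith
  intro t ht x hx u hu
  have hlim : Tendsto (fun n : ℕ => (S + ρ ^ n * N) * P.b u.2) atTop
      (nhds ((S + 0 * N) * P.b u.2)) :=
    (((tendsto_pow_atTop_nhds_zero_of_lt_one hρ0 hρ1).mul_const _).const_add _).mul_const _
  rw [zero_mul, add_zero] at hlim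
  exact ge_of_tendsto hlim (Eventually.of_forall fun n => hpow n t ht x hx u hu)

end BodyGas

/-! ### Bounds of the recollision forces -/

/-- Integration of a function of the transversal velocity over a box of positions and velocities. -/
theorem setIntegral_box {d : ℕ} {φ : Perp d → ℝ} (hφ : Integrable φ) {A : Set (Perp d)} {I : Set ℝ}
    (B : Set (Perp d)) (hA : volume A ≠ ⊤) (hI : volume I ≠ ⊤) (c : ℝ) :
    IntegrableOn (fun q : Perp d × Vel d => c * φ q.2.2) (A ×ˢ (I ×ˢ B)) ∧
      ∫ q in A ×ˢ (I ×ˢ B), c * φ q.2.2 =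
        c * (volume.real A * (volume.real I * ∫ v in B, φ v)) := by
  have h1 : IntegrableOn (fun v : Vel d => (1 : ℝ) * φ v.2) (I ×ˢ B) := by
    rw [IntegrableOn, Measure.volume_eq_prod, ← Measure.prod_restrict]
    exact Integrable.mul_prod (f := fun _ : ℝ => (1 : ℝ)) (integrableOn_const hI) hφ.integrableOn
  have h2 : IntegrableOn (fun q : Perp d × Vel d => c * (1 * φ q.2.2)) (A ×ˢ (I ×ˢ B)) := by
    rw [IntegrableOn, Measure.volume_eq_prod, ← Measure.prod_restrict]
    exact Integrable.mul_prod (f := fun _ : Perp d => c) (integrableOn_const hA) h1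
  have h3 := setIntegral_prod_mul (μ := (volume : Measure ℝ)) (ν := (volume : Measure (Perp d)))
    (fun _ => (1 : ℝ)) φ I B
  have h4 := setIntegral_prod_mul (μ := (volume : Measure (Perp d)))
    (ν := (volume : Measure (Vel d))) (fun _ => c) (fun v => 1 * φ v.2) A (I ×ˢ B)
  rw [← Measure.volume_eq_prod] at h3 h4
  simp only [one_mul, setIntegral_const, smul_eq_mul, mul_one] at h2 h3 h4
  exact ⟨h2, by rw [h4, h3]; ring⟩

theorem setIntegral_indicator_box {d : ℕ} {φ : Perp d → ℝ} (hφ : Integrable φ) {A : Set (Perp d)}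
    {I : Set ℝ} {B : Set (Perp d)} (hA : volume A ≠ ⊤) (hI : volume I ≠ ⊤)
    (hmA : MeasurableSet A) (hmI : MeasurableSet I) (hmB : MeasurableSet B)
    {S : Set (Perp d × Vel d)} (hS : A ×ˢ (I ×ˢ B) ⊆ S) (c : ℝ) :
    IntegrableOn ((A ×ˢ (I ×ˢ B)).indicator fun q : Perp d × Vel d => c * φ q.2.2) S ∧
      ∫ q in S, (A ×ˢ (I ×ˢ B)).indicator (fun q : Perp d × Vel d => c * φ q.2.2) q =
        c * (volume.real A * (volume.real I * ∫ v in B, φ v)) := by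
  have hm : MeasurableSet (A ×ˢ (I ×ˢ B)) := hmA.prod (hmI.prod hmB)
  obtain ⟨h1, h2⟩ := setIntegral_box hφ B hA hI c
  refine ⟨((integrable_indicator_iff hm).mpr h1).integrableOn, ?_⟩
  rw [setIntegral_indicator hm, inter_eq_self_of_subset_right hS, h2]

theorem volume_real_closedBall_perp {d : ℕ} {ρ : ℝ} (hρ : 0 ≤ ρ) :
    volume.real (Metric.closedBall (0 : Perp d) ρ) =
      ρ ^ (d - 1) * volume.real (Metric.ball (0 : Perp d) 1) := by
  rw [Measure.addHaar_real_closedBall _ _ hρ, finrank_euclideanSpace_fin]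

theorem volume_real_ball_perp_pos {d : ℕ} : 0 < volume.real (Metric.ball (0 : Perp d) 1) :=
  ENNReal.toReal_pos (Metric.measure_ball_pos _ _ one_pos).ne' measure_ball_lt_top.ne

namespace BodyGas

variable {P : BodyGas d} {p E Vinf γ₀ V₀ γb : ℝ} {V : ℝ → ℝ}
  {fm fp : Face → ℝ → Perp d → Vel d → ℝ}

/-- Both collision points lie in the disc of diameter 2r. This is the source of the decay with
exponent d - 1. -/
theorem norm_snd_le_of_precollision {e : Face} {t s : ℝ} {x : Perp d} (hx : x ∈ P.disc) {u : Vel d}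
    (h : s ∈ P.precollisions V e t x u) {σ : ℝ} (hσ : 0 < σ) (hs : σ ≤ t - s) :
    ‖u.2‖ ≤ 2 * P.r / σ := by
  have h1 : ‖x - (t - s) • u.2‖ ≤ P.r := h.2.2.2.1
  have h2 : ‖x‖ ≤ P.r := by simpa [disc] using hx
  have h3 : ‖(t - s) • u.2‖ ≤ 2 * P.r := by
    have := norm_sub_le x (x - (t - s) • u.2)
    rw [sub_sub_cancel] at this
    linarith
  rw [norm_smul, Real.norm_of_nonneg (hσ.le.trans hs)] at h3
  rw [le_div_iff₀ hσ]
  nlinarith [norm_nonneg u.2]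

/-- The re-emitted density exceeds a₀(V∞) by δ, and continuity of a₀ near V∞ costs at most δ/2 of
this excess. -/
theorem IsSolution.le_incident_sub (hS : P.IsSolution E V₀ V fm fp)
    (hP : P.Assumptions p E Vinf γ₀) {δ : ℝ}
    (hδ : ∀ v ∈ Icc (-γ₀) 0, ∀ η ∈ Icc (Vinf - γ₀) Vinf,
      P.a₀ Vinf + δ ≤ (1 - P.α) * ∫ u in Iic (Vinf - γ₀), P.k v (u - η) * P.a₀ u)
    (ha₀ : ∀ u ∈ Icc (Vinf - γb) Vinf, P.a₀ u ≤ P.a₀ Vinf + δ / 2)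
    (hγb : γb ≤ γ₀) {t : ℝ} (ht : 0 ≤ t)
    (hist : ∀ s ∈ Icc 0 t, 0 ≤ Vinf - V s ∧ Vinf - V s < γb)
    {u : Vel d} (hu : u.1 ≤ V t) {τ : ℝ} {x y : Perp d} (hτ : τ ∈ P.precollisions V .right t x u)
    (hy : y ∈ P.disc) (h : fm .right t x u = fp .right τ y u) :
    δ / 2 * P.b u.2 ≤ fm .right t x u - P.f₀ u := by
  have hem : V τ ≤ u.1 := hτ.2.2.2.2
  have hVt := hist t ⟨ht, le_rfl⟩
  have hVτ := hist τ ⟨hτ.1.le, hτ.2.1.le⟩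
  have h1 := hS.le_emitted hP hδ hγb hτ.1.le
    (fun s hs => hist s ⟨hs.1, hs.2.trans hτ.2.1.le⟩) hy hem (by linarith)
  have h2 := mul_le_mul_of_nonneg_right (ha₀ u.1 ⟨by linarith, by linarith⟩) (hP.b_nonneg u.2)
  rw [h, f₀]
  linarith

theorem IsSolution.f₀_le_incident (hS : P.IsSolution E V₀ V fm fp)
    (hP : P.Assumptions p E Vinf γ₀) {δ : ℝ} (hδ0 : 0 < δ)
    (hδ : ∀ v ∈ Icc (-γ₀) 0, ∀ η ∈ Icc (Vinf - γ₀) Vinf,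
      P.a₀ Vinf + δ ≤ (1 - P.α) * ∫ u in Iic (Vinf - γ₀), P.k v (u - η) * P.a₀ u)
    (ha₀ : ∀ u ∈ Icc (Vinf - γb) Vinf, P.a₀ u ≤ P.a₀ Vinf + δ / 2)
    (hγb : γb ≤ γ₀) {t : ℝ} (ht : 0 ≤ t)
    (hist : ∀ s ∈ Icc 0 t, 0 ≤ Vinf - V s ∧ Vinf - V s < γb)
    {x : Perp d} (hx : x ∈ P.disc) {u : Vel d} (hu : u.1 ≤ V t) :
    P.f₀ u ≤ fm .right t x u := by
  rcases hS.incident_cases ht hx (e := .right) hu with h | ⟨τ, hτ, hy, h⟩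
  · exact h.ge
  · have h1 := hS.le_incident_sub hP hδ ha₀ hγb ht hist hu hτ hy h
    have h2 := mul_nonneg (half_pos hδ0).le (hP.b_nonneg u.2)
    linarith

theorem IsSolution.recollision_right_nonneg (hS : P.IsSolution E V₀ V fm fp)
    (hP : P.Assumptions p E Vinf γ₀) {δ : ℝ} (hδ0 : 0 < δ)
    (hδ : ∀ v ∈ Icc (-γ₀) 0, ∀ η ∈ Icc (Vinf - γ₀) Vinf,
      P.a₀ Vinf + δ ≤ (1 - P.α) * ∫ u in Iic (Vinf - γ₀), P.k v (u - η) * P.a₀ u)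
    (ha₀ : ∀ u ∈ Icc (Vinf - γb) Vinf, P.a₀ u ≤ P.a₀ Vinf + δ / 2)
    (hγb : γb ≤ γ₀) {t : ℝ} (ht : 0 ≤ t)
    (hist : ∀ s ∈ Icc 0 t, 0 ≤ Vinf - V s ∧ Vinf - V s < γb) :
    0 ≤ P.recollision V fm .right t := by
  refine setIntegral_nonneg (Metric.isClosed_closedBall.measurableSet.prod
    (Face.measurableSet_incident _ _)) fun q hq => ?_
  exact mul_nonneg (hP.ell_nonneg _)
    (sub_nonneg.mpr (hS.f₀_le_incident hP hδ0 hδ ha₀ hγb ht hist hq.1 hq.2))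

/-- Lower bound of the recollision force at the right end: particles of small transversal velocity
whose longitudinal velocity exceeds the mean velocity of the body have collided before. -/
theorem IsSolution.le_recollision_right (hS : P.IsSolution E V₀ V fm fp)
    (hP : P.Assumptions p E Vinf γ₀) {δ : ℝ} (hδ0 : 0 < δ)
    (hδ : ∀ v ∈ Icc (-γ₀) 0, ∀ η ∈ Icc (Vinf - γ₀) Vinf,
      P.a₀ Vinf + δ ≤ (1 - P.α) * ∫ u in Iic (Vinf - γ₀), P.k v (u - η) * P.a₀ u)
    (ha₀ : ∀ u ∈ Icc (Vinf - γb) Vinf, P.a₀ u ≤ P.a₀ Vinf + δ / 2)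
    (hγb : γb ≤ γ₀) {cl : ℝ} (hcl0 : 0 < cl) (hcl : ∀ w, 0 < w → w ≤ γ₀ → cl * w ^ p ≤ P.ell w)
    {ρ : ℝ} (hρ0 : 0 < ρ) (hρr : ρ ≤ P.r / 2)
    (hρ : ∀ v ∈ Metric.closedBall (0 : Perp d) ρ, P.b 0 / 2 ≤ P.b v) {t : ℝ} (ht : 0 < t)
    (hist : ∀ s ∈ Icc 0 t, 0 ≤ Vinf - V s ∧ Vinf - V s < γb)
    (hlt : timeAvg V 0 t < V t) :
    cl * (1 / 2) ^ p * (δ / 2) * (P.b 0 / 2) *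
        (volume.real (Metric.closedBall (0 : Perp d) (P.r / 2)) * (1 / 2) *
          (ρ ^ (d - 1) * volume.real (Metric.ball (0 : Perp d) 1))) *
      (V t - timeAvg V 0 t) ^ (p + 1) / (1 + t) ^ (d - 1) ≤ P.recollision V fm .right t := by
  have hcV := hS.contDiff.continuous
  set w := V t - timeAvg V 0 t with hw
  have hw0 : 0 < w := sub_pos.mpr hlt
  have hVt := hist t ⟨ht.le, le_rfl⟩
  have hwγ : w < γb := by
    have : Vinf - γb < timeAvg V 0 t := lt_timeAvg hcV ht fun s hs => by
      have := (hist s ⟨hs.1, hs.2.le⟩).2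
      linarith
    linarith
  have hVdist : |V t - Vinf| ≤ γ₀ := by
    rw [abs_le]
    constructor <;> linarith
  have hb0 := hP.b_zero_pos
  set A := Metric.closedBall (0 : Perp d) (P.r / 2) with hA
  -- On this interval V(t) - u_x is at least w/2, so ℓ is of order w^p, and u_x exceeds the mean
  -- velocity over [0, t]. The bounds on position and transversal velocity keep the particle over
  -- the disc during all of [0, t], so overtaking is a genuine precollision.
  set I := Ioo (V t - w) (V t - w / 2) with hI
  set B := Metric.closedBall (0 : Perp d) (ρ / (1 + t)) with hB
  have ht1 : 0 < 1 + t := by linarith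
  have hmA : MeasurableSet A := Metric.isClosed_closedBall.measurableSet
  have hmB : MeasurableSet B := Metric.isClosed_closedBall.measurableSet
  have hbox : MeasurableSet (A ×ˢ (I ×ˢ B)) := hmA.prod (measurableSet_Ioo.prod hmB)
  have hAd : A ⊆ P.disc := Metric.closedBall_subset_closedBall (by linarith [hP.r_pos])
  have hsub : A ×ˢ (I ×ˢ B) ⊆ P.disc ×ˢ (Face.right.incident (V t) : Set (Vel d)) := by
    rintro q ⟨h1, h2, -⟩
    refine ⟨hAd h1, ?_⟩
    show q.2.1 ≤ V t
    linarith [h2.2]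
  have hS0 : MeasurableSet (P.disc ×ˢ (Face.right.incident (V t) : Set (Vel d))) :=
    Metric.isClosed_closedBall.measurableSet.prod (Face.measurableSet_incident _ _)
  have hint := (hS.integrableOn_recollision hP .right ht.le hVdist).2
  set κ := cl * (w / 2) ^ p * (δ / 2 * (P.b 0 / 2)) with hκ
  have hpt : ∀ q ∈ A ×ˢ (I ×ˢ B), κ ≤ P.ell (q.2.1 - V t) * (fm .right t q.1 q.2 - P.f₀ q.2) := by
    rintro ⟨x, u⟩ ⟨hx, hu1, hu2⟩
    simp only at hx hu1 hu2 ⊢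
    have hxd := hAd hx
    have hlow : timeAvg V 0 t < u.1 := by
      have := hu1.1
      linarith
    have hup : u.1 < V t := by linarith [hu1.2]
    obtain ⟨s, hs, hs1, hs2⟩ := exists_overtaking hcV ht hlow hup
    have hunorm : ‖u.2‖ ≤ ρ / (1 + t) := by simpa [hB] using hu2
    have hxnorm : ‖x‖ ≤ P.r / 2 := by simpa [hA] using hx
    have hpre : s ∈ P.precollisions V .right t x u := by
      refine ⟨hs.1, hs.2, hs1, ?_, hs2⟩
      have h1 := norm_sub_le x ((t - s) • u.2)
      rw [norm_smul, Real.norm_of_nonneg (by linarith [hs.2])] at h1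
      have h2 : (t - s) * ‖u.2‖ ≤ (1 + t) * (ρ / (1 + t)) :=
        mul_le_mul (by linarith [hs.1]) hunorm (norm_nonneg _) ht1.le
      rw [mul_div_cancel₀ _ ht1.ne'] at h2
      linarith
    -- Transport refers to the latest precollision, which may differ from s; the density estimate
    -- holds for either.
    obtain ⟨τ, hτ⟩ := exists_isGreatest_precollisions hcV hup.ne ⟨s, hpre⟩
    have hy : x - (t - τ) • u.2 ∈ P.disc := by simpa [disc] using hτ.1.2.2.2.1
    have h3 := hS.le_incident_sub hP hδ ha₀ hγb ht.le hist hup.le hτ.1 hy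
      (hS.transport .right t ht.le x hxd u hup.le τ hτ)
    have h4 : P.b 0 / 2 ≤ P.b u.2 := hρ _ (by
      rw [mem_closedBall_zero_iff]
      refine hunorm.trans (div_le_self hρ0.le (by linarith)))
    have h5 : cl * (w / 2) ^ p ≤ P.ell (u.1 - V t) := by
      rw [← hP.ell_neg, neg_sub]
      have h6 := hu1.2
      have h7 := hu1.1
      refine le_trans ?_ (hcl (V t - u.1) (by linarith) (by linarith))
      exact mul_le_mul_of_nonneg_left
        (Real.rpow_le_rpow (by positivity) (by linarith) hP.p_mem.1) hcl0.le
    refine mul_le_mul h5 (le_trans ?_ h3) (by positivity) (hP.ell_nonneg _)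
    exact mul_le_mul_of_nonneg_left h4 (by positivity)
  have hvol : volume.real (A ×ˢ (I ×ˢ B)) = volume.real A * ((w / 2) *
      ((ρ / (1 + t)) ^ (d - 1) * volume.real (Metric.ball (0 : Perp d) 1))) := by
    rw [Measure.volume_eq_prod, measureReal_prod_prod, Measure.volume_eq_prod,
      measureReal_prod_prod, hB, volume_real_closedBall_perp (ρ := ρ / (1 + t)) (by positivity), hI,
      Real.volume_real_Ioo_of_le (by linarith)]
    congr 2
    ring
  have hfin : volume (A ×ˢ (I ×ˢ B)) ≠ ⊤ := by
    rw [Measure.volume_eq_prod, Measure.prod_prod, Measure.volume_eq_prod, Measure.prod_prod]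
    exact ENNReal.mul_ne_top measure_closedBall_lt_top.ne
      (ENNReal.mul_ne_top (by simp [hI]) measure_closedBall_lt_top.ne)
  calc _ = κ * volume.real (A ×ˢ (I ×ˢ B)) := by
        rw [hvol, hκ, div_pow, Real.rpow_add_one hw0.ne', show w / 2 = w * (1 / 2) by ring,
          Real.mul_rpow hw0.le (by norm_num)]
        field_simp
    _ = ∫ q in A ×ˢ (I ×ˢ B), κ := by rw [setIntegral_const, smul_eq_mul, mul_comm]
    _ ≤ ∫ q in A ×ˢ (I ×ˢ B), P.ell (q.2.1 - V t) * (fm .right t q.1 q.2 - P.f₀ q.2) :=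
        setIntegral_mono_on (integrableOn_const hfin) (hint.mono_set hsub) hbox hpt
    _ ≤ P.recollision V fm .right t := by
        refine setIntegral_mono_set hint ?_ hsub.eventuallyLE
        filter_upwards [ae_restrict_mem hS0] with q hq
        exact mul_nonneg (hP.ell_nonneg _)
          (sub_nonneg.mpr (hS.f₀_le_incident hP hδ0 hδ ha₀ hγb ht.le hist hq.1 hq.2))

theorem ae_fst_snd_ne (V : ℝ) : ∀ᵐ q : Perp d × Vel d, q.2.1 ≠ V :=
  Measure.quasiMeasurePreserving_snd.ae (ae_fst_ne V)

/-- Upper bound of the recollision force at the right end, for precollisions that are classified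
by the time elapsed. -/
theorem IsSolution.recollision_right_le (hS : P.IsSolution E V₀ V fm fp)
    (hP : P.Assumptions p E Vinf γ₀) (hγb : γb ≤ γ₀) {Cl : ℝ} (hCl0 : 0 < Cl)
    (hCl : ∀ w, 0 < w → w ≤ γ₀ → P.ell w ≤ Cl * w ^ p) {S Mb : ℝ} (hS0 : 0 ≤ S)
    (hMb : ∀ v, P.b v ≤ Mb) {t : ℝ} (ht : 0 ≤ t)
    (hist : ∀ s ∈ Icc 0 t, 0 ≤ Vinf - V s ∧ Vinf - V s < γb)
    (hfm : ∀ x ∈ P.disc, ∀ u ∈ Face.right.incident (V t), fm .right t x u ≤ S * P.b u.2)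
    {w₁ w₂ w₃ σ₁ σ₂ : ℝ} (hw₁ : 0 ≤ w₁) (hw₂ : 0 ≤ w₂) (hw₃ : 0 ≤ w₃) (hσ₁ : 0 < σ₁) (hσ₂ : 0 < σ₂)
    (h : ∀ s ∈ Ioo 0 t, (V t - timeAvg V s t ≤ w₁ ∧ σ₁ ≤ t - s) ∨
      (V t - timeAvg V s t ≤ w₂ ∧ σ₂ ≤ t - s) ∨ V t - timeAvg V s t ≤ w₃) :
    P.recollision V fm .right t ≤ Cl * S * volume.real P.disc *
      (Mb * (2 * P.r) ^ (d - 1) * volume.real (Metric.ball (0 : Perp d) 1) *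
        (w₁ ^ (p + 1) / σ₁ ^ (d - 1) + w₂ ^ (p + 1) / σ₂ ^ (d - 1)) + w₃ ^ (p + 1)) := by
  have hcV := hS.contDiff.continuous
  have hVt := hist t ⟨ht, le_rfl⟩
  have hp := hP.p_mem.1
  have hr := hP.r_pos
  have hVdist : |V t - Vinf| ≤ γ₀ := by
    rw [abs_le]
    constructor <;> linarith
  have hMb0 : 0 ≤ Mb := (hP.b_nonneg 0).trans (hMb 0)
  have hmD : MeasurableSet P.disc := Metric.isClosed_closedBall.measurableSet
  have hD : volume P.disc ≠ ⊤ := measure_closedBall_lt_top.ne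
  have hm : MeasurableSet (P.disc ×ˢ (Face.right.incident (V t) : Set (Vel d))) :=
    hmD.prod (Face.measurableSet_incident _ _)
  -- Pointwise majorant on a box of velocities: the width w bounds the longitudinal deficit, and B
  -- the transversal velocities. One box for each class of precollisions.
  obtain ⟨F, hFdef⟩ : ∃ F : ℝ → Set (Perp d) → Perp d × Vel d → ℝ, ∀ w B, F w B =
      (P.disc ×ˢ (Icc (V t - w) (V t) ×ˢ B)).indicator fun q => (Cl * w ^ p * S) * P.b q.2.2 :=
    ⟨_, fun _ _ => rfl⟩
  have hF0 : ∀ w B q, 0 ≤ w → 0 ≤ F w B q := fun w B q hw => by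
    rw [hFdef]
    exact indicator_nonneg (fun q _ => by have := hP.b_nonneg q.2.2; positivity) q
  have hF : ∀ w B, 0 ≤ w → MeasurableSet B →
      IntegrableOn (F w B) (P.disc ×ˢ Face.right.incident (V t)) ∧
      ∫ q in P.disc ×ˢ Face.right.incident (V t), F w B q =
        Cl * S * volume.real P.disc * w ^ (p + 1) * ∫ v in B, P.b v := by
    intro w B hw hmB
    have hsub : P.disc ×ˢ (Icc (V t - w) (V t) ×ˢ B) ⊆
        P.disc ×ˢ (Face.right.incident (V t) : Set (Vel d)) := by
      rintro q ⟨h1, h2, -⟩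
      exact ⟨h1, h2.2⟩
    obtain ⟨h1, h2⟩ := setIntegral_indicator_box hP.b_integrable hD (by simp) hmD measurableSet_Icc
      hmB hsub (Cl * w ^ p * S)
    rw [hFdef]
    refine ⟨h1, h2.trans ?_⟩
    rw [Real.volume_real_Icc_of_le (by linarith), Real.rpow_add_one' hw (by linarith)]
    ring
  have hball : ∀ σ, 0 < σ → ∫ v in Metric.closedBall (0 : Perp d) (2 * P.r / σ), P.b v ≤
      Mb * (2 * P.r) ^ (d - 1) * volume.real (Metric.ball (0 : Perp d) 1) / σ ^ (d - 1) := by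
    intro σ hσ
    calc ∫ v in Metric.closedBall (0 : Perp d) (2 * P.r / σ), P.b v
        ≤ ∫ v in Metric.closedBall (0 : Perp d) (2 * P.r / σ), Mb :=
          setIntegral_mono hP.b_integrable.integrableOn
            (integrableOn_const measure_closedBall_lt_top.ne) hMb
      _ = _ := by
          rw [setIntegral_const, smul_eq_mul,
            volume_real_closedBall_perp (ρ := 2 * P.r / σ) (by positivity), div_pow]
          ring
  obtain ⟨i1, e1⟩ := hF w₁ (Metric.closedBall 0 (2 * P.r / σ₁)) hw₁
    Metric.isClosed_closedBall.measurableSet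
  obtain ⟨i2, e2⟩ := hF w₂ (Metric.closedBall 0 (2 * P.r / σ₂)) hw₂
    Metric.isClosed_closedBall.measurableSet
  obtain ⟨i3, e3⟩ := hF w₃ univ hw₃ MeasurableSet.univ
  rw [setIntegral_univ, hP.b_mass, mul_one] at e3
  have key : P.recollision V fm .right t ≤
      ∫ q in P.disc ×ˢ Face.right.incident (V t), (F w₁ (Metric.closedBall 0 (2 * P.r / σ₁)) q +
        F w₂ (Metric.closedBall 0 (2 * P.r / σ₂)) q + F w₃ univ q) := by
    refine integral_mono_ae (hS.integrableOn_recollision hP .right ht hVdist).2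
      ((i1.add i2).add i3) ?_
    filter_upwards [ae_restrict_mem hm, ae_restrict_of_ae (ae_fst_snd_ne (V t))] with q hq hne
    obtain ⟨x, u⟩ := q
    simp only at hne
    have hx : x ∈ P.disc := hq.1
    have hu : u.1 ≤ V t := hq.2
    have n1 := hF0 w₁ (Metric.closedBall 0 (2 * P.r / σ₁)) (x, u) hw₁
    have n2 := hF0 w₂ (Metric.closedBall 0 (2 * P.r / σ₂)) (x, u) hw₂
    have n3 := hF0 w₃ univ (x, u) hw₃
    have hlt : u.1 < V t := lt_of_le_of_ne hu hne
    rcases hS.incident_cases ht hx (e := .right) hu with h0 | ⟨τ, hτ, hy, h0⟩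
    · simp only [h0, sub_self, mul_zero]
      linarith
    · have havg := fst_eq_timeAvg hτ
      have hlow : Vinf - γb < u.1 := by
        rw [havg]
        exact lt_timeAvg hcV hτ.2.1 fun s hs => by
          have := (hist s ⟨hτ.1.le.trans hs.1, hs.2.le⟩).2
          linarith
      have hval : ∀ w, V t - u.1 ≤ w → P.ell (u.1 - V t) * (fm .right t x u - P.f₀ u) ≤
          (Cl * w ^ p * S) * P.b u.2 := by
        intro w hw
        have h1 : P.ell (u.1 - V t) ≤ Cl * w ^ p := by
          rw [← hP.ell_neg, neg_sub]
          refine (hCl _ (by linarith) (by linarith)).trans ?_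
          exact mul_le_mul_of_nonneg_left
            (Real.rpow_le_rpow (by linarith) hw hp) hCl0.le
        have h2 : fm .right t x u - P.f₀ u ≤ S * P.b u.2 := by
          linarith [hfm x hx u hu, hP.f₀_nonneg u]
        have h3 := mul_nonneg hS0 (hP.b_nonneg u.2)
        calc _ ≤ P.ell (u.1 - V t) * (S * P.b u.2) := mul_le_mul_of_nonneg_left h2 (hP.ell_nonneg _)
          _ ≤ Cl * w ^ p * (S * P.b u.2) := mul_le_mul_of_nonneg_right h1 h3
          _ = _ := by ring
      have hin : ∀ w B, V t - u.1 ≤ w → u.2 ∈ B →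
          P.ell (u.1 - V t) * (fm .right t x u - P.f₀ u) ≤ F w B (x, u) := by
        intro w B hw hB
        rw [hFdef, indicator_of_mem (show (x, u) ∈ P.disc ×ˢ (Icc (V t - w) (V t) ×ˢ B) from
          ⟨hx, ⟨by simp only; linarith, hu⟩, hB⟩)]
        exact hval w hw
      rcases h τ ⟨hτ.1, hτ.2.1⟩ with ⟨g1, g2⟩ | ⟨g1, g2⟩ | g1
      · have := hin w₁ (Metric.closedBall 0 (2 * P.r / σ₁)) (by rwa [havg])
          (by rw [mem_closedBall_zero_iff]; exact norm_snd_le_of_precollision hx hτ hσ₁ g2)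
        simp only
        linarith
      · have := hin w₂ (Metric.closedBall 0 (2 * P.r / σ₂)) (by rwa [havg])
          (by rw [mem_closedBall_zero_iff]; exact norm_snd_le_of_precollision hx hτ hσ₂ g2)
        simp only
        linarith
      · have := hin w₃ univ (by rwa [havg]) (mem_univ _)
        simp only
        linarith
  rw [integral_add (f := fun q => F w₁ (Metric.closedBall 0 (2 * P.r / σ₁)) q +
    F w₂ (Metric.closedBall 0 (2 * P.r / σ₂)) q) (i1.add i2) i3, integral_add i1 i2, e1, e2, e3] at key
  have hc : ∀ w, 0 ≤ w → 0 ≤ Cl * S * volume.real P.disc * w ^ (p + 1) := fun w hw => by positivity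
  have k1 := mul_le_mul_of_nonneg_left (hball σ₁ hσ₁) (hc w₁ hw₁)
  have k2 := mul_le_mul_of_nonneg_left (hball σ₂ hσ₂) (hc w₂ hw₂)
  refine key.trans ((add_le_add (add_le_add k1 k2) le_rfl).trans (le_of_eq ?_))
  ring

/-- As f₋ ≥ 0, the loss at a recolliding velocity is at most ℓ f₀. Such velocities lie between V(t)
and the largest past mean, in an interval of length w. -/
theorem IsSolution.neg_recollision_left_le (hS : P.IsSolution E V₀ V fm fp)
    (hP : P.Assumptions p E Vinf γ₀) {t : ℝ} (ht : 0 ≤ t) (hV : |V t - Vinf| ≤ γ₀) {w c : ℝ}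
    (hw : 0 ≤ w) (hc0 : 0 ≤ c) (hc : ∀ z, 0 < z → z ≤ w → P.ell z * P.a₀ (V t + z) ≤ c)
    (h : ∀ s ∈ Ioo 0 t, timeAvg V s t - V t ≤ w) :
    -P.recollision V fm .left t ≤ c * (volume.real P.disc * w) := by
  have hmD : MeasurableSet P.disc := Metric.isClosed_closedBall.measurableSet
  have hD : volume P.disc ≠ ⊤ := measure_closedBall_lt_top.ne
  have hm : MeasurableSet (P.disc ×ˢ (Face.left.incident (V t) : Set (Vel d))) :=
    hmD.prod (Face.measurableSet_incident _ _)
  have hsub : P.disc ×ˢ (Icc (V t) (V t + w) ×ˢ (univ : Set (Perp d))) ⊆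
      P.disc ×ˢ (Face.left.incident (V t) : Set (Vel d)) := by
    rintro q ⟨h1, h2, -⟩
    exact ⟨h1, h2.1⟩
  obtain ⟨h1, h2⟩ := setIntegral_indicator_box hP.b_integrable hD (by simp) hmD measurableSet_Icc
    MeasurableSet.univ hsub c
  rw [setIntegral_univ, hP.b_mass, Real.volume_real_Icc_of_le (by linarith), mul_one,
    add_sub_cancel_left] at h2
  rw [← h2, recollision, ← integral_neg]
  refine integral_mono_ae (hS.integrableOn_recollision hP .left ht hV).2.neg h1 ?_
  filter_upwards [ae_restrict_mem hm, ae_restrict_of_ae (ae_fst_snd_ne (V t))] with q hq hne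
  obtain ⟨x, u⟩ := q
  simp only at hne
  have hx : x ∈ P.disc := hq.1
  have hu : V t ≤ u.1 := hq.2
  have hlt : V t < u.1 := lt_of_le_of_ne hu (Ne.symm hne)
  rcases hS.incident_cases ht hx (e := .left) hu with h0 | ⟨τ, hτ, hy, h0⟩
  · simp only [h0, sub_self, mul_zero, neg_zero]
    exact indicator_nonneg (fun q _ => mul_nonneg hc0 (hP.b_nonneg _)) _
  · have havg := fst_eq_timeAvg hτ
    have h3 := h τ ⟨hτ.1, hτ.2.1⟩
    rw [← havg] at h3
    rw [indicator_of_mem (show (x, u) ∈ P.disc ×ˢ (Icc (V t) (V t + w) ×ˢ (univ : Set (Perp d))) from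
      ⟨hx, ⟨hu, by simp only; linarith⟩, mem_univ _⟩)]
    have h4 := hc (u.1 - V t) (by linarith) h3
    rw [add_sub_cancel] at h4
    have h5 := mul_le_mul_of_nonneg_right h4 (hP.b_nonneg u.2)
    have h6 := mul_nonneg (hP.ell_nonneg (u.1 - V t))
      (hS.fm_nonneg (e := .left) ht hx (u := u) hu)
    simp only [f₀]
    linarith

/-- A recollision behind the body needs a past mean velocity of at least V(t). -/
theorem IsSolution.recollision_left_eq_zero (hS : P.IsSolution E V₀ V fm fp) {t : ℝ} (ht : 0 ≤ t)
    (h : ∀ s ∈ Ico 0 t, V s < V t) : P.recollision V fm .left t = 0 := by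
  have hm : MeasurableSet (P.disc ×ˢ (Face.left.incident (V t) : Set (Vel d))) :=
    Metric.isClosed_closedBall.measurableSet.prod (Face.measurableSet_incident _ _)
  refine setIntegral_eq_zero_of_forall_eq_zero fun q hq => ?_
  rcases hS.incident_cases ht hq.1 (e := .left) hq.2 with h0 | ⟨τ, hτ, -, -⟩
  · rw [h0, sub_self, mul_zero]
  · have h1 := fst_eq_timeAvg hτ
    have hu : V t ≤ q.2.1 := hq.2
    have h2 : -V t < timeAvg (fun s => 0 - V s) τ t :=
      lt_timeAvg (by have := hS.contDiff.continuous; fun_prop) hτ.2.1 fun s hs => by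
        have := h s ⟨hτ.1.le.trans hs.1, hs.2⟩
        linarith
    rw [timeAvg_const_sub hS.contDiff.continuous 0 hτ.2.1, ← h1] at h2
    linarith

end BodyGas

/-! ### Solutions are flows with memory -/

namespace BodyGas

variable {P : BodyGas d} {p E Vinf γ₀ : ℝ}

/-- The recollision forces on a body near its equilibrium velocity satisfy memory bounds that are
uniform in the solution. -/
theorem Assumptions.exists_memoryBounds (hP : P.Assumptions p E Vinf γ₀) {γs q : ℝ} (hγs0 : 0 < γs)
    (hγs : γs ≤ γ₀) (hq0 : 0 < q)
    (hq : ∀ w, 0 < w → w < γs → ∀ u, |u - Vinf| < γs →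
      volume.real P.disc * (P.ell w * P.a₀ u) ≤ q) :
    ∃ γb cR K : ℝ, 0 < γb ∧ γb ≤ γs ∧ 0 < cR ∧ 0 < K ∧ ∀ (V₀ : ℝ) (V : ℝ → ℝ)
      (fm fp : Face → ℝ → Perp d → Vel d → ℝ), P.IsSolution E V₀ V fm fp →
      MemoryBounds (d - 1) p cR K q γb (fun t => Vinf - V t) (P.recollision V fm .right)
        (fun t => P.recollision V fm .right t - (P.F₀ Vinf - P.F₀ (V t)) -
          (P.force V fm fp t - E)) := by
  obtain ⟨δ, hδ0, hδ⟩ := hP.gain_lower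
  obtain ⟨M₄, hM₄⟩ := hP.gain_bdd
  obtain ⟨κ', hκ'⟩ := hP.k_bdd
  obtain ⟨Ma, hMa0, hMa⟩ := hP.exists_a₀_le
  obtain ⟨Mb, hMb0, hMb⟩ := hP.exists_b_le
  obtain ⟨cl, Cl, hcl0, hCl0, hell⟩ := hP.exists_ell_bounds
  have hγ₀ := hP.γ₀_pos
  have hr := hP.r_pos
  have hp := hP.p_mem.1
  have hD0 := hP.disc_pos
  have hb0 := hP.b_zero_pos
  set D := volume.real P.disc with hD
  set ω := volume.real (Metric.ball (0 : Perp d) 1) with hω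
  have hω0 : 0 < ω := volume_real_ball_perp_pos
  set κ := max κ' 1 with hκdef
  have hκ0 : 0 < κ := zero_lt_one.trans_le (le_max_right _ _)
  have hκ : ∀ v u, |u| ≤ γ₀ → P.k v u ≤ κ := fun v u h => (hκ' v u h).trans (le_max_left _ _)
  set S := max Ma (2 * M₄) with hS
  have hS0 : 0 < S := hMa0.trans_le (le_max_left _ _)
  obtain ⟨η, hη0, hη⟩ := Metric.continuousAt_iff.mp (hP.a₀_cont.continuousAt (x := Vinf)) (δ / 2)
    (half_pos hδ0)
  obtain ⟨ρ', hρ'0, hρ'⟩ := Metric.continuousAt_iff.mp (hP.b_cont.continuousAt (x := 0)) (P.b 0 / 2)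
    (half_pos hb0)
  set ρ := min (ρ' / 2) (P.r / 2) with hρdef
  have hρ0 : 0 < ρ := by positivity
  have hρ : ∀ v ∈ Metric.closedBall (0 : Perp d) ρ, P.b 0 / 2 ≤ P.b v := by
    intro v hv
    have h1 : dist v 0 < ρ' := by
      have h2 : ρ ≤ ρ' / 2 := min_le_left _ _
      have h3 : dist v 0 ≤ ρ := hv
      linarith
    have h4 := hρ' h1
    rw [Real.dist_eq, abs_lt] at h4
    linarith [h4.1]
  -- The bound 1/(2κ) serves the contraction for the incident density, and η/2 the continuity of a₀
  -- at V∞.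
  set γb := min γs (min (1 / (2 * κ)) (η / 2)) with hγbdef
  have hγb0 : 0 < γb := by positivity
  have hγbs : γb ≤ γs := min_le_left _ _
  have hγb : γb ≤ γ₀ := hγbs.trans hγs
  have hκγ : κ * γb ≤ 1 / 2 := by
    have h1 : γb ≤ 1 / (2 * κ) := (min_le_right _ _).trans (min_le_left _ _)
    calc κ * γb ≤ κ * (1 / (2 * κ)) := mul_le_mul_of_nonneg_left h1 hκ0.le
      _ = 1 / 2 := by field_simp
  have ha₀ : ∀ u ∈ Icc (Vinf - γb) Vinf, P.a₀ u ≤ P.a₀ Vinf + δ / 2 := by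
    intro u hu
    have h1 : γb ≤ η / 2 := (min_le_right _ _).trans (min_le_right _ _)
    have h2 : dist u Vinf < η := by
      rw [Real.dist_eq, abs_lt]
      constructor <;> linarith [hu.1, hu.2]
    have h3 := hη h2
    rw [Real.dist_eq, abs_lt] at h3
    linarith [h3.2]
  set A := Mb * (2 * P.r) ^ (d - 1) * ω with hA
  have hA0 : 0 < A := by positivity
  set cR := cl * (1 / 2) ^ p * (δ / 2) * (P.b 0 / 2) *
        (volume.real (Metric.closedBall (0 : Perp d) (P.r / 2)) * (1 / 2) *
          (ρ ^ (d - 1) * ω)) with hcR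
  have hcR0 : 0 < cR := by
    have : 0 < volume.real (Metric.closedBall (0 : Perp d) (P.r / 2)) :=
      ENNReal.toReal_pos (Metric.measure_closedBall_pos _ _ (by positivity)).ne'
        measure_closedBall_lt_top.ne
    positivity
  -- The first summand of K dominates the right end, the second one the superlinear bound at the
  -- left end.
  refine ⟨γb, cR, Cl * S * D * (A + 1) + Cl * Ma * D, hγb0, hγbs, hcR0, by positivity, ?_⟩
  intro V₀ V fm fp hsol
  have hcV := hsol.contDiff.continuous
  have hleft : ∀ t ≥ 0, (∀ s ∈ Icc 0 t, 0 ≤ Vinf - V s ∧ Vinf - V s < γb) → |V t - Vinf| ≤ γ₀ ∧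
      P.recollision V fm .right t - (P.F₀ Vinf - P.F₀ (V t)) - (P.force V fm fp t - E) =
        P.recollision V fm .left t := by
    intro t ht hist
    have h1 := hist t ⟨ht, le_rfl⟩
    have h2 : |V t - Vinf| ≤ γ₀ := by
      rw [abs_le]
      constructor <;> linarith
    refine ⟨h2, ?_⟩
    rw [hsol.force_eq hP ht h2, hP.equilibrium]
    ring
  refine ⟨?_, ?_, ?_, ?_, ?_⟩
  · intro t ht hist
    exact hsol.recollision_right_nonneg hP hδ0 hδ ha₀ hγb ht hist
  · intro t ht hist hlt
    rw [timeAvg_const_sub hcV Vinf ht] at hlt ⊢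
    simp only [sub_sub_sub_cancel_left]
    exact hsol.le_recollision_right hP hδ0 hδ ha₀ hγb hcl0 (fun w h1 h2 => (hell w h1 h2).1) hρ0
      (min_le_right _ _) hρ ht hist (by linarith)
  · intro t ht hist w₁ w₂ w₃ σ₁ σ₂ hw₁ hw₂ hw₃ hσ₁ hσ₂ h
    have h1 := hsol.recollision_right_le hP hγb hCl0 (fun w h1 h2 => (hell w h1 h2).2) hS0.le hMb ht
      hist (hsol.incident_le hP hM₄ hκ0.le hκ hγb0.le hγb hκγ
        (fun v => (hMa v).trans (le_max_left _ _)) (le_max_right _ _) hist t ⟨ht, le_rfl⟩)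
      hw₁ hw₂ hw₃ hσ₁ hσ₂ (fun s hs => by
        have := h s hs
        rw [timeAvg_const_sub hcV Vinf hs.2, sub_sub_sub_cancel_left] at this
        exact this)
    refine h1.trans ?_
    rw [← hA, ← hD]
    set X := w₁ ^ (p + 1) / σ₁ ^ (d - 1) + w₂ ^ (p + 1) / σ₂ ^ (d - 1) with hX
    have hX0 : 0 ≤ X := by positivity
    have hY0 : 0 ≤ w₃ ^ (p + 1) := by positivity
    have h2 : 0 ≤ Cl * S * D * (X + A * w₃ ^ (p + 1)) + Cl * Ma * D * (X + w₃ ^ (p + 1)) := by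
      positivity
    linarith
  · intro t ht hist w hw0 hwγ h
    obtain ⟨hVd, heq⟩ := hleft t ht hist
    have hVt := hist t ⟨ht, le_rfl⟩
    simp only [heq]
    have h' : ∀ s ∈ Ioo 0 t, timeAvg V s t - V t ≤ w := fun s hs => by
      have := h s hs
      rw [timeAvg_const_sub hcV Vinf hs.2, sub_sub_sub_cancel_left] at this
      exact this
    constructor
    · have h1 := hsol.neg_recollision_left_le hP ht hVd hw0 (c := q / D) (by positivity)
        (fun z hz hzw => by
          rw [le_div_iff₀ hD0, mul_comm]
          exact hq z hz (by linarith) _ (by rw [abs_lt]; constructor <;> linarith)) h'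
      refine h1.trans (le_of_eq ?_)
      rw [← hD]
      field_simp
    · have h1 := hsol.neg_recollision_left_le hP ht hVd hw0 (c := Cl * w ^ p * Ma) (by positivity)
        (fun z hz hzw => by
          refine mul_le_mul ?_ (hMa _) (hP.a₀_nonneg _) (by positivity)
          refine ((hell z hz (by linarith)).2).trans ?_
          exact mul_le_mul_of_nonneg_left (Real.rpow_le_rpow hz.le hzw hp) hCl0.le) h'
      refine h1.trans ?_
      rw [← hD, Real.rpow_add_one' hw0 (by linarith)]
      have h2 : 0 ≤ Cl * S * D * (A + 1) * (w ^ p * w) := by positivity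
      linarith
  · intro t ht hist h
    obtain ⟨-, heq⟩ := hleft t ht hist
    simp only [heq]
    exact hsol.recollision_left_eq_zero ht fun s hs => by
      have := h s hs
      linarith

/-- The left memory term is defined as the remainder in the equation of motion. The differential
equation then holds at all times, before V is known to stay near V∞; while it does, the remainder is
the left recollision force. -/
theorem IsSolution.memoryFlow {n : ℕ} {cR K q γb γ : ℝ} {V : ℝ → ℝ}
    {fm fp : Face → ℝ → Perp d → Vel d → ℝ} (hS : P.IsSolution E (Vinf - γ) V fm fp)
    (hm : MemoryBounds n p cR K q γb (fun t => Vinf - V t) (P.recollision V fm .right)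
        (fun t => P.recollision V fm .right t - (P.F₀ Vinf - P.F₀ (V t)) -
          (P.force V fm fp t - E))) :
    MemoryFlow n p cR K q γb γ (fun x => P.F₀ Vinf - P.F₀ (Vinf - x)) (fun t => Vinf - V t)
      (P.recollision V fm .right) (fun t => P.recollision V fm .right t -
        (P.F₀ Vinf - P.F₀ (V t)) - (P.force V fm fp t - E)) := by
  refine { hm with
    continuous := continuous_const.sub hS.contDiff.continuous
    init := by rw [hS.init, sub_sub_cancel]
    motion := fun t ht => ?_ }
  refine ((hS.motion t ht).const_sub Vinf).congr_deriv ?_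
  simp only [sub_sub_cancel]
  ring

end BodyGas

/-! ### Conclusion -/

theorem isTheta_rpow_neg {g : ℝ → ℝ} {e B c C γ T : ℝ} (he : 0 ≤ e) (hB : 0 < B) (hc : 0 < c)
    (hC : 0 ≤ C) (hγ : 0 ≤ γ) (hlow : ∀ t ≥ T, c / t ^ e ≤ g t)
    (hup : ∀ t ≥ 0, g t ≤ γ * Real.exp (-B * t) + C / (1 + t) ^ e) :
    g =Θ[atTop] fun t : ℝ => t ^ (-e) := by
  obtain ⟨A, hA0, hA⟩ := exists_exp_neg_le_div_rpow hB e
  have hpos : ∀ t : ℝ, 1 ≤ t → 0 < t ^ e := fun t ht => Real.rpow_pos_of_pos (by linarith) e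
  constructor
  · refine IsBigO.of_bound (γ * A + C) ?_
    filter_upwards [eventually_ge_atTop T, eventually_ge_atTop 1] with t hT h1
    have h0 : 0 ≤ g t := le_trans (div_nonneg hc.le (hpos t h1).le) (hlow t hT)
    rw [Real.norm_of_nonneg h0, Real.norm_of_nonneg (Real.rpow_nonneg (by linarith) _),
      Real.rpow_neg (by linarith), ← div_eq_mul_inv]
    have h2 := mul_le_mul_of_nonneg_left (hA t (by linarith)) hγ
    rw [← neg_mul] at h2
    calc g t ≤ γ * (A / (1 + t) ^ e) + C / (1 + t) ^ e := by linarith [hup t (by linarith)]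
      _ = (γ * A + C) / (1 + t) ^ e := by ring
      _ ≤ (γ * A + C) / t ^ e := div_le_div_of_nonneg_left (by positivity) (hpos t h1)
          (Real.rpow_le_rpow (by linarith) (by linarith) he)
  · refine IsBigO.of_bound (1 / c) ?_
    filter_upwards [eventually_ge_atTop T, eventually_ge_atTop 1] with t hT h1
    have h0 : 0 ≤ g t := le_trans (div_nonneg hc.le (hpos t h1).le) (hlow t hT)
    rw [Real.norm_of_nonneg h0, Real.norm_of_nonneg (Real.rpow_nonneg (by linarith) _),
      Real.rpow_neg (by linarith)]
    have h2 := hlow t hT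
    rw [div_eq_mul_inv] at h2
    rw [one_div, ← div_eq_inv_mul, le_div_iff₀ hc, mul_comm]
    exact h2

theorem theorem1p2 (d : ℕ) (hd : 2 ≤ d) (P : BodyGas d) (p E Vinf γ₀ : ℝ)
    (hP : P.Assumptions p E Vinf γ₀) :
    ∃ γ₁ c C : ℝ, 0 < γ₁ ∧ γ₁ ≤ γ₀ ∧ 0 < c ∧ 0 < C ∧
      ∀ γ : ℝ, 0 < γ → γ < γ₁ →
        (∀ V ∈ Set.Icc (Vinf - γ) Vinf, DifferentiableAt ℝ P.F₀ V) ∧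
        ∃ B₀ Binf : ℝ,
          IsLeast (deriv P.F₀ '' Set.Icc (Vinf - γ) Vinf) B₀ ∧
          IsGreatest (deriv P.F₀ '' Set.Icc (Vinf - γ) Vinf) Binf ∧
          0 < B₀ ∧
          ∃ t₀ : ℝ, 0 < t₀ ∧
            ∀ (V : ℝ → ℝ) (fm fp : Face → ℝ → Perp d → Vel d → ℝ),
              P.IsSolution E (Vinf - γ) V fm fp →
              (∀ t : ℝ, 0 ≤ t →
                γ * Real.exp (-Binf * t) +
                    (Set.Ioi (2 * t₀)).indicator
                      (fun s => c * γ ^ (p + 1) / s ^ ((d : ℝ) + p)) t ≤ Vinf - V t ∧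
                Vinf - V t ≤
                  γ * Real.exp (-B₀ * t) + C * γ ^ (p + 1) / (1 + t) ^ ((d : ℝ) + p)) ∧
              (fun t => Vinf - V t) =Θ[Filter.atTop] (fun t : ℝ => t ^ (-((d : ℝ) + p))) := by
  obtain ⟨γs, β, q, Bbar, hγs0, hγs, hβ, hq0, hqβ, hslope, hcont, hq⟩ := hP.exists_slope_bounds
  obtain ⟨γb, cR, K, hγb0, hγbs, hcR, hK, hmem⟩ := hP.exists_memoryBounds hγs0 hγs hq0 hq
  have hp := hP.p_mem.1
  obtain ⟨γ₁, c, C, t₀, hγ₁0, hγ₁, hc, hC, ht₀, hdecay⟩ :=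
    exists_decay_constants (n := d - 1) (Bbar := Bbar) (by lia) hp hcR hK hγb0 hβ hqβ
  -- The decay exponent: d - 1 from the transversal directions and p + 1 from the longitudinal one.
  have hexp : (((d - 1 : ℕ) : ℝ) + (p + 1)) = (d : ℝ) + p := by
    rw [Nat.cast_sub (by lia)]
    push_cast
    ring
  simp only [hexp] at hdecay
  have hnear : ∀ x < γs, ∀ V ∈ Icc (Vinf - x) Vinf, |V - Vinf| < γs := fun x hx V hV => by
    rw [abs_lt]
    constructor <;> linarith [hV.1, hV.2]
  refine ⟨γ₁, c, C, hγ₁0, by linarith, hc, hC, fun γ hγ hγγ₁ => ?_⟩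
  have hγγs : γ < γs := by linarith
  refine ⟨fun V hV => (hslope V (hnear γ hγγs V hV)).1, ?_⟩
  have hcomp : IsCompact (deriv P.F₀ '' Icc (Vinf - γ) Vinf) :=
    isCompact_Icc.image_of_continuousOn (hcont.mono (hnear γ hγγs))
  have hne : (deriv P.F₀ '' Icc (Vinf - γ) Vinf).Nonempty :=
    (nonempty_Icc.mpr (by linarith)).image _
  obtain ⟨B₀, hB₀⟩ := hcomp.exists_isLeast hne
  obtain ⟨Binf, hBinf⟩ := hcomp.exists_isGreatest hne
  have hβB₀ : β ≤ B₀ := by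
    obtain ⟨W, hW, rfl⟩ := hB₀.1
    exact (hslope W (hnear γ hγγs W hW)).2.1
  have hBinfB : Binf ≤ Bbar := by
    obtain ⟨W, hW, rfl⟩ := hBinf.1
    exact (hslope W (hnear γ hγγs W hW)).2.2
  have hB₀pos : 0 < B₀ := hβ.trans_le hβB₀
  refine ⟨B₀, Binf, hB₀, hBinf, hB₀pos, t₀, by linarith, fun V fm fp hS => ?_⟩
  -- The mean value theorem turns bounds of F₀' on the interval into linear bounds for Φ, both with
  -- the uniform β and with the extrema for the given γ.
  have hmvt : ∀ x, 0 ≤ x → x < γs → ∀ B : ℝ,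
      ((∀ W ∈ Icc (Vinf - x) Vinf, B ≤ deriv P.F₀ W) → B * x ≤ P.F₀ Vinf - P.F₀ (Vinf - x)) ∧
      ((∀ W ∈ Icc (Vinf - x) Vinf, deriv P.F₀ W ≤ B) →
        P.F₀ Vinf - P.F₀ (Vinf - x) ≤ B * x) := by
    intro x hx0 hxs B
    have hdiff : ∀ W ∈ Icc (Vinf - x) Vinf, DifferentiableAt ℝ P.F₀ W := fun W hW =>
      (hslope W (hnear x hxs W hW)).1
    have hc1 : ContinuousOn P.F₀ (Icc (Vinf - x) Vinf) := fun W hW =>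
      (hdiff W hW).continuousAt.continuousWithinAt
    have hd1 : DifferentiableOn ℝ P.F₀ (interior (Icc (Vinf - x) Vinf)) := fun W hW =>
      (hdiff W (interior_subset hW)).differentiableWithinAt
    have hl : Vinf - x ∈ Icc (Vinf - x) Vinf := ⟨le_rfl, by linarith⟩
    have hr : Vinf ∈ Icc (Vinf - x) Vinf := ⟨by linarith, le_rfl⟩
    constructor
    · intro h
      have := (convex_Icc (Vinf - x) Vinf).mul_sub_le_image_sub_of_le_deriv hc1 hd1
        (fun W hW => h W (interior_subset hW)) _ hl _ hr hl.2
      rwa [sub_sub_cancel] at this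
    · intro h
      have := (convex_Icc (Vinf - x) Vinf).image_sub_le_mul_sub_of_deriv_le hc1 hd1
        (fun W hW => h W (interior_subset hW)) _ hl _ hr hl.2
      rwa [sub_sub_cancel] at this
  have hres := hdecay γ hγ hγγ₁ B₀ Binf _ _ _ _ hβB₀
    (hB₀.2 hBinf.1) hBinfB (by simp)
    (fun x hx => (hmvt x hx.1 (by linarith [hx.2]) β).1 fun W hW =>
      (hslope W (hnear x (by linarith [hx.2]) W hW)).2.1)
    (fun x hx => by
      have hsub : Icc (Vinf - x) Vinf ⊆ Icc (Vinf - γ) Vinf :=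
        Icc_subset_Icc_left (by linarith [hx.2])
      have hxs : x < γs := by linarith [hx.2]
      exact ⟨(hmvt x hx.1 hxs B₀).1 fun W hW => hB₀.2 (mem_image_of_mem _ (hsub hW)),
        (hmvt x hx.1 hxs Binf).2 fun W hW => hBinf.2 (mem_image_of_mem _ (hsub hW))⟩)
    (hS.memoryFlow (hmem _ V fm fp hS))
  refine ⟨fun t ht => ⟨?_, (hres t ht).2⟩, ?_⟩
  · by_cases h : t ∈ Ioi (2 * t₀)
    · rw [indicator_of_mem h]
      exact (hres t ht).1.2 (le_of_lt h)
    · rw [indicator_of_notMem h, add_zero]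
      exact (hres t ht).1.1
  · refine isTheta_rpow_neg (B := B₀) (c := c * γ ^ (p + 1)) (C := C * γ ^ (p + 1)) (γ := γ)
      (T := 2 * t₀) (by positivity) hB₀pos (by positivity) (by positivity) hγ.le
      (fun t ht => ?_) fun t ht => (hres t ht).2
    have h1 := (hres t (by linarith)).1.2 ht
    have h2 : 0 ≤ γ * Real.exp (-Binf * t) := by positivity
    linarith
end
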